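/- Let $N\ge 1$ and let $g:\mathbb R\to\mathbb R$ satisfy: $g\in C^{1,\sigma}(\mathbb R)$ for some $\sigma\in(0,1)$ (i.e. $g\in C^1$ and $g'$ is $\sigma$-Hölder continuous on bounded intervals); $g$ is odd; $g'(0)>0$; and there is $\alpha_0\in(0,\infty)$ such that $g>0$ on $(0,\alpha_0)$ and $g<0$ on $(\alpha_0,\infty)$. Put $G(z)=\int_0^z g(t)\,dt$. Let $\Omega\subset\mathbb R^N$ be a bounded domain (non-empty, open, connected), let $$\lambda_1(\Omega)=\inf_{u\in H^1_0(\Omega)\setminus\{0\}}\frac{\int_\Omega|\nabla u|^2}{\int_\Omega u^2}$$ be the first Dirichlet eigenvalue of $-\Delta$ on $\Omega$, and assume $g'(0)>\lambda_1(\Omega)$. Then the functional $$I_\Omega:H^1_0(\Omega)\to\mathbb R\cup\{+\infty\},\qquad I_\Omega(u)=\frac12\int_\Omega|\nabla u|^2-\int_\Omega G(u),$$ has a global minimizer $u_\Omega\in H^1_0(\Omega)$ which belongs to $C^2(\Omega)$ (after modification on a null set), is a classical solution of $$-\Delta w=g(w)\ \text{ in }\Omega,\qquad w\in H^1_0(\Omega),$$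 and satisfies $0<u_\Omega<\alpha_0$ everywhere in $\Omega$. -/

import Mathlib

open MeasureTheory Set
open scoped ENNReal ContDiff

noncomputable section

/-- `C_c^∞(Ω)`: smooth functions on `ℝᴺ` whose compact support is contained in `Ω`. -/
def IsTestFunction {N : ℕ} (Ω : Set (EuclideanSpace ℝ (Fin N)))
    (φ : EuclideanSpace ℝ (Fin N) → ℝ) : Prop :=
  ContDiff ℝ ∞ φ ∧ HasCompactSupport φ ∧ tsupport φ ⊆ Ω

/-- `V` is the weak (distributional) gradient of `u` in `Ω`. -/
def HasWeakGradient {N : ℕ} (Ω : Set (EuclideanSpace ℝ (Fin N)))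
    (u : EuclideanSpace ℝ (Fin N) → ℝ)
    (V : EuclideanSpace ℝ (Fin N) → EuclideanSpace ℝ (Fin N)) : Prop :=
  ∀ φ : EuclideanSpace ℝ (Fin N) → ℝ, IsTestFunction Ω φ →
    ∫ x in Ω, u x • gradient φ x = - ∫ x in Ω, φ x • V x

/-- An element of `H¹₀(Ω)`, given by a representative together with a representative of its weak
gradient: a function of `H¹(Ω)` (square integrable with square integrable weak gradient) that lies
in the closure of `C_c^∞(Ω)` for the `H¹`-norm. Only the values on `Ω` matter. -/
structure H10 {N : ℕ} (Ω : Set (EuclideanSpace ℝ (Fin N))) where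
  /-- the function -/
  toFun : EuclideanSpace ℝ (Fin N) → ℝ
  /-- its weak gradient -/
  grad : EuclideanSpace ℝ (Fin N) → EuclideanSpace ℝ (Fin N)
  memLp_toFun : MemLp toFun 2 (volume.restrict Ω)
  memLp_grad : MemLp grad 2 (volume.restrict Ω)
  hasWeakGradient : HasWeakGradient Ω toFun grad
  mem_closure : ∀ ε : ℝ≥0∞, 0 < ε → ∃ φ : EuclideanSpace ℝ (Fin N) → ℝ, IsTestFunction Ω φ ∧
    eLpNorm (fun x => toFun x - φ x) 2 (volume.restrict Ω) < ε ∧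
    eLpNorm (fun x => grad x - gradient φ x) 2 (volume.restrict Ω) < ε

/-- The first Dirichlet eigenvalue `λ₁(Ω)` of `-Δ`: the infimum of the Rayleigh quotient
`∫_Ω |∇u|² / ∫_Ω u²` over the nonzero elements of `H¹₀(Ω)`. -/
def firstDirichletEigenvalue {N : ℕ} (Ω : Set (EuclideanSpace ℝ (Fin N))) : ℝ :=
  sInf {r : ℝ | ∃ u : H10 Ω, (∫ x in Ω, u.toFun x ^ 2) ≠ 0 ∧
    r = (∫ x in Ω, ‖u.grad x‖ ^ 2) / ∫ x in Ω, u.toFun x ^ 2}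

/-- `g ∈ C^{1,σ}(ℝ)`: `g` is continuously differentiable and `g'` is Hölder continuous with
exponent `σ` on every bounded interval. -/
def IsC1Holder (σ : ℝ) (g : ℝ → ℝ) : Prop :=
  ContDiff ℝ 1 g ∧ ∀ R : ℝ, ∃ C : ℝ, ∀ x ∈ Icc (-R) R, ∀ y ∈ Icc (-R) R,
    |deriv g x - deriv g y| ≤ C * |x - y| ^ σ

/-- The primitive `G` of `g` with `G 0 = 0`. -/
def primitive (g : ℝ → ℝ) (z : ℝ) : ℝ := ∫ t in (0 : ℝ)..z, g t

/-- The integral of `f` over `Ω` in the extended sense, `∫ f⁺ - ∫ f⁻`. It equals `-∞` when `f⁻` is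
not integrable and `f⁺` is. -/
def extIntegral {N : ℕ} (Ω : Set (EuclideanSpace ℝ (Fin N)))
    (f : EuclideanSpace ℝ (Fin N) → ℝ) : EReal :=
  ((∫⁻ x in Ω, ENNReal.ofReal (f x) : ℝ≥0∞) : EReal) -
    ((∫⁻ x in Ω, ENNReal.ofReal (-f x) : ℝ≥0∞) : EReal)

/-- The functional `I_Ω(u) = ½ ∫_Ω |∇u|² - ∫_Ω G(u)` on `H¹₀(Ω)`, with the value `+∞` allowed. -/
def energy {N : ℕ} (Ω : Set (EuclideanSpace ℝ (Fin N))) (g : ℝ → ℝ) (u : H10 Ω) : EReal :=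
  ((1 / 2 * ∫ x in Ω, ‖u.grad x‖ ^ 2 : ℝ) : EReal) -
    extIntegral Ω (fun x => primitive g (u.toFun x))

/-- `w` is a classical solution in `Ω` of `-Δw = g(w)`. -/
def IsClassicalSolution {N : ℕ} (Ω : Set (EuclideanSpace ℝ (Fin N))) (g : ℝ → ℝ)
    (w : EuclideanSpace ℝ (Fin N) → ℝ) : Prop :=
  ContDiffOn ℝ 2 w Ω ∧ ∀ x ∈ Ω, -(Laplacian.laplacian w x) = g (w x)

end

section Auxiliary

open Filter Topology Laplacian InnerProductSpace

/-! ### Second derivatives at minima and explicit Laplacians -/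

section Classical

variable {E : Type*} [NormedAddCommGroup E] [InnerProductSpace ℝ E]

/-! Let γ be g composed with the projection onto [-α₀, α₀], and Γ the primitive of γ. Since g
vanishes at α₀ and is negative beyond it, Γ is even, bounded, nonnegative, constant beyond α₀, at
least G everywhere, and equal to G on [0, α₀]. So a minimizer of J(u) = ½∫|∇u|² - ∫Γ(u) with values
in [0, α₀] also minimizes I_Ω, and no integrability of G(v) has to be discussed
(`truncEnergy_le_energy`, `energy_eq_truncEnergy`).

Existence (`exists_truncated_minimizer`): J is bounded below, Γ being bounded and Ω of finite
volume. Replacing a test function φ by a smoothed min(|φ|, α₀) raises J by as little as desired, so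
there is a minimizing sequence of uniformly bounded test functions. A Rellich argument in L¹
(`exists_subseq_tendsto_ae`) gives an a.e. limit U. The parallelogram law at midpoints then makes
the gradients Cauchy in L², so the convergence is strong, U lies in H¹₀(Ω), and 0 ≤ U ≤ α₀ a.e.
Density extends minimality from test functions to H¹₀(Ω).

Regularity (`exists_classical_rep`): the first variation gives -ΔU = γ(U) weakly. A maximum
principle argument bounds the gradient at the centre of a ball of radius d by nM/d + Fd/2 when |u| ≤
M and |Δu| ≤ F there (`norm_fderiv_le_of_laplacian_bound`). For mollifications of U this yields a
locally Lipschitz representative. Then γ(U) is locally Lipschitz as well, the gradients of the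
mollifications have bounded Laplacian, and the same estimate, applied to differences on small balls,
makes first and then second derivatives converge uniformly.

Strict bounds: as λ₁(Ω) < g'(0), a small multiple of a suitable test function has J < 0
(`exists_truncEnergy_neg`), so U is not zero. By Hopf's strong minimum principle
(`eqOn_zero_of_laplacian_le`) a zero of U would make U vanish identically. Applied to α₀ - U, it
shows that a contact with α₀ would make U constant; the weak equation then forces ∇U = 0, and
Poincaré's inequality gives U = 0 again. -/

lemma deriv_deriv_line {f : E → ℝ} {x : E} (hf : ContDiffAt ℝ 2 f x) (e : E) :
    deriv (deriv fun t : ℝ => f (x + t • e)) 0 = fderiv ℝ (fderiv ℝ f) x e e := by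
  have hl : ∀ t : ℝ, HasDerivAt (fun t : ℝ => x + t • e) e t := fun t => by
    simpa using ((hasDerivAt_id t).smul_const e).const_add x
  have hc : Tendsto (fun t : ℝ => x + t • e) (𝓝 0) (𝓝 x) := by
    have : ContinuousAt (fun t : ℝ => x + t • e) 0 := (hl 0).continuousAt
    simpa [ContinuousAt] using this
  have h1 : ∀ᶠ t in 𝓝 (0 : ℝ), deriv (fun t : ℝ => f (x + t • e)) t
      = fderiv ℝ f (x + t • e) e := by
    filter_upwards [hc.eventually (hf.eventually (by simp))] with t ht
    exact ((ht.differentiableAt (by simp)).hasFDerivAt.comp_hasDerivAt t (hl t)).deriv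
  rw [EventuallyEq.deriv_eq h1]
  have h2 : HasFDerivAt (fderiv ℝ f) (fderiv ℝ (fderiv ℝ f) x) (x + (0 : ℝ) • e) := by
    simpa using ((hf.fderiv_right (m := 1) (by norm_num)).differentiableAt (by simp)).hasFDerivAt
  have h3 := h2.comp_hasDerivAt (0 : ℝ) (hl 0)
  have h4 := (ContinuousLinearMap.apply ℝ ℝ e).hasFDerivAt.comp_hasDerivAt (0 : ℝ) h3
  simpa [Function.comp_def] using h4.deriv

/-- A negative second derivative along a line would make the point a local maximum of the
restriction too. The restriction would then be locally constant, with second derivative zero. -/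
lemma fderiv_fderiv_nonneg_of_isLocalMin {f : E → ℝ} {x : E} (hf : ContDiffAt ℝ 2 f x)
    (hm : IsLocalMin f x) (e : E) : 0 ≤ fderiv ℝ (fderiv ℝ f) x e e := by
  by_contra! hneg
  rw [← deriv_deriv_line hf] at hneg
  set φ : ℝ → ℝ := fun t => f (x + t • e) with hφ
  have hcl : Continuous fun t : ℝ => x + t • e := by fun_prop
  have hmin : IsLocalMin φ 0 := by
    have hc : Tendsto (fun t : ℝ => x + t • e) (𝓝 0) (𝓝 x) := by
      simpa using hcl.tendsto 0
    have := hc.eventually hm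
    filter_upwards [this] with t ht
    simpa [hφ] using ht
  have hcont : ContinuousAt φ 0 := by
    have : ContinuousAt f (x + (0 : ℝ) • e) := by simpa using hf.continuousAt
    exact ContinuousAt.comp (f := fun t : ℝ => x + t • e) this hcl.continuousAt
  have hmax := isLocalMax_of_deriv_deriv_neg hneg hmin.deriv_eq_zero hcont
  have hconst : φ =ᶠ[𝓝 0] fun _ => φ 0 := by
    filter_upwards [hmin, hmax] with t h1 h2
    exact le_antisymm h2 h1
  have h1 : deriv φ =ᶠ[𝓝 0] fun _ => 0 := by
    have := hconst.deriv
    simpa using this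
  have := h1.deriv_eq
  simp [this] at hneg

/-- The derivative at a left end point of a nonnegative function vanishing there. -/
lemma HasDerivAt.nonneg_of_forall_Ioc {h : ℝ → ℝ} {c δ : ℝ} (hδ : 0 < δ) (hd : HasDerivAt h c 0)
    (h0 : h 0 = 0) (hn : ∀ t ∈ Ioc 0 δ, 0 ≤ h t) : 0 ≤ c := by
  have h1 := hd.hasDerivWithinAt (s := Ioi 0)
  rw [hasDerivWithinAt_iff_tendsto_slope' (by simp)] at h1
  refine ge_of_tendsto h1 ?_
  filter_upwards [Ioc_mem_nhdsGT hδ] with t ht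
  rw [slope_def_field, h0]
  have := hn t ht
  have := ht.1
  simp only [sub_zero]
  positivity

variable [FiniteDimensional ℝ E]

lemma laplacian_eq_sum_fderiv {F : Type*} [NormedAddCommGroup F] [NormedSpace ℝ F]
    {ι : Type*} [Fintype ι] (b : OrthonormalBasis ι ℝ E) (f : E → F) (x : E) :
    Δ f x = ∑ i, fderiv ℝ (fderiv ℝ f) x (b i) (b i) := by
  rw [laplacian_eq_iteratedFDeriv_orthonormalBasis f b]
  simp [iteratedFDeriv_two_apply]

lemma laplacian_eq_sum_line {ι : Type*} [Fintype ι] (b : OrthonormalBasis ι ℝ E) {f : E → ℝ}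
    {x : E} (hf : ContDiffAt ℝ 2 f x) :
    Δ f x = ∑ i, deriv (deriv fun t : ℝ => f (x + t • b i)) 0 := by
  simp [laplacian_eq_sum_fderiv b, deriv_deriv_line hf]

lemma laplacian_nonneg_of_isLocalMin {f : E → ℝ} {x : E} (hf : ContDiffAt ℝ 2 f x)
    (hm : IsLocalMin f x) : 0 ≤ Δ f x := by
  rw [laplacian_eq_sum_fderiv (stdOrthonormalBasis ℝ E)]
  exact Finset.sum_nonneg fun i _ => fderiv_fderiv_nonneg_of_isLocalMin hf hm _

lemma laplacian_comp_isometry {f : E → ℝ} {x c : E} (R : E ≃ₗᵢ[ℝ] E)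
    (hf : ContDiffAt ℝ 2 f (c + R x)) : Δ (fun y => f (c + R y)) x = Δ f (c + R x) := by
  have hR : ContDiffAt ℝ 2 (fun y => c + R y) x :=
    (contDiff_const.add R.contDiff).contDiffAt
  have h : ContDiffAt ℝ 2 (fun y => f (c + R y)) x :=
    ContDiffAt.comp (f := fun y => c + R y) (g := f) x hf hR
  set b := stdOrthonormalBasis ℝ E
  rw [laplacian_eq_sum_line b h, laplacian_eq_sum_line (b.map R) hf]
  simp [add_assoc]

/-- This is the family containing the barrier of the interior gradient estimate. -/
lemma laplacian_norm_sq_add {A B C : ℝ} (e x : E) (he : ‖e‖ = 1) :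
    Δ (fun y : E => A * ‖y‖ ^ 2 + B * ⟪y, e⟫_ℝ + C * ⟪y, e⟫_ℝ ^ 2) x
      = 2 * Module.finrank ℝ E * A + 2 * C := by
  set b := stdOrthonormalBasis ℝ E
  have hf : ContDiff ℝ 2 (fun y : E => A * ‖y‖ ^ 2 + B * ⟪y, e⟫_ℝ + C * ⟪y, e⟫_ℝ ^ 2) := by
    have h1 := contDiff_norm_sq ℝ (E := E) (n := 2)
    have h2 : ContDiff ℝ 2 fun y : E => ⟪y, e⟫_ℝ := contDiff_id.inner ℝ contDiff_const
    exact ((contDiff_const.mul h1).add (contDiff_const.mul h2)).add (contDiff_const.mul (h2.pow 2))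
  rw [laplacian_eq_sum_line b hf.contDiffAt]
  have key : ∀ i, deriv (deriv fun t : ℝ => (fun y : E => A * ‖y‖ ^ 2 + B * ⟪y, e⟫_ℝ
      + C * ⟪y, e⟫_ℝ ^ 2) (x + t • b i)) 0 = 2 * A + 2 * C * ⟪b i, e⟫_ℝ ^ 2 := by
    intro i
    have h1 : (fun t : ℝ => (fun y : E => A * ‖y‖ ^ 2 + B * ⟪y, e⟫_ℝ
      + C * ⟪y, e⟫_ℝ ^ 2) (x + t • b i)) = fun t : ℝ =>
        (A * ‖x‖ ^ 2 + B * ⟪x, e⟫_ℝ + C * ⟪x, e⟫_ℝ ^ 2) +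
        t * (2 * A * ⟪x, b i⟫_ℝ + B * ⟪b i, e⟫_ℝ + 2 * C * ⟪x, e⟫_ℝ * ⟪b i, e⟫_ℝ) +
        t ^ 2 * (A + C * ⟪b i, e⟫_ℝ ^ 2) := by
      funext t
      simp only [norm_add_sq_real, inner_add_left, inner_smul_left, inner_smul_right, norm_smul,
        b.norm_eq_one]
      simp
      ring
    rw [h1]
    set c0 := (A * ‖x‖ ^ 2 + B * ⟪x, e⟫_ℝ + C * ⟪x, e⟫_ℝ ^ 2)
    set c1 := (2 * A * ⟪x, b i⟫_ℝ + B * ⟪b i, e⟫_ℝ + 2 * C * ⟪x, e⟫_ℝ * ⟪b i, e⟫_ℝ)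
    set c2 := (A + C * ⟪b i, e⟫_ℝ ^ 2) with hc2
    have h2 : deriv (fun t : ℝ => c0 + t * c1 + t ^ 2 * c2) = fun t => c1 + 2 * t * c2 := by
      funext t
      have := (((hasDerivAt_id' t).mul_const c1).const_add c0).fun_add
        (((hasDerivAt_id' t).fun_pow 2).mul_const c2)
      refine HasDerivAt.deriv ?_
      simpa using this
    rw [h2]
    have := (((hasDerivAt_id (0 : ℝ)).const_mul 2).mul_const c2).const_add c1
    have := this.deriv
    simp only [id_eq] at this
    rw [this, hc2]; ring
  simp only [key, Finset.sum_add_distrib, ← Finset.mul_sum]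
  have := b.sum_sq_inner_right e
  simp [he] at this
  simp [this]
  ring

/-- The Gaussian is Hopf's barrier: away from the centre `c` its Laplacian dominates any multiple of
it once `a` is large. -/
lemma laplacian_exp_norm_sq (a : ℝ) (c x : E) :
    Δ (fun y : E => Real.exp (-a * ‖y - c‖ ^ 2)) x
      = (4 * a ^ 2 * ‖x - c‖ ^ 2 - 2 * a * Module.finrank ℝ E)
        * Real.exp (-a * ‖x - c‖ ^ 2) := by
  set b := stdOrthonormalBasis ℝ E
  have hf : ContDiff ℝ 2 (fun y : E => Real.exp (-a * ‖y - c‖ ^ 2)) := by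
    have := (contDiff_norm_sq ℝ (E := E) (n := 2)).comp (contDiff_id.sub (contDiff_const (c := c)))
    exact (contDiff_const.mul this).exp
  rw [laplacian_eq_sum_line b hf.contDiffAt]
  have key : ∀ i, deriv (deriv fun t : ℝ => (fun y : E => Real.exp (-a * ‖y - c‖ ^ 2))
      (x + t • b i)) 0 = (4 * a ^ 2 * ⟪x - c, b i⟫_ℝ ^ 2 - 2 * a)
        * Real.exp (-a * ‖x - c‖ ^ 2) := by
    intro i
    set p := ‖x - c‖ ^ 2
    set q := ⟪x - c, b i⟫_ℝ
    have h1 : (fun t : ℝ => (fun y : E => Real.exp (-a * ‖y - c‖ ^ 2)) (x + t • b i))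
        = fun t : ℝ => Real.exp (-a * (p + 2 * t * q + t ^ 2)) := by
      funext t
      have : x + t • b i - c = (x - c) + t • b i := by abel
      simp only [this, norm_add_sq_real, inner_smul_right, norm_smul, b.norm_eq_one]
      simp [p, q, mul_assoc]
    rw [h1]
    have hin : ∀ t : ℝ, HasDerivAt (fun t : ℝ => -a * (p + 2 * t * q + t ^ 2))
        (-a * (2 * q + 2 * t)) t := by
      intro t
      have := (((((hasDerivAt_id t).const_mul 2).mul_const q).const_add p).add
        ((hasDerivAt_id t).pow 2)).const_mul (-a)
      simpa using this
    have h2 : deriv (fun t : ℝ => Real.exp (-a * (p + 2 * t * q + t ^ 2))) =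
        fun t => Real.exp (-a * (p + 2 * t * q + t ^ 2)) * (-a * (2 * q + 2 * t)) := by
      funext t
      exact (hin t).exp.deriv
    rw [h2]
    have h3 : HasDerivAt (fun t : ℝ => -a * (2 * q + 2 * t)) (-a * 2) 0 := by
      simpa using (((hasDerivAt_id (0 : ℝ)).const_mul 2).const_add (2 * q)).const_mul (-a)
    have := ((hin 0).exp.mul h3).deriv
    rw [show (fun t => Real.exp (-a * (p + 2 * t * q + t ^ 2)) * (-a * (2 * q + 2 * t)))
      = (fun t => Real.exp (-a * (p + 2 * t * q + t ^ 2))) * (fun t => -a * (2 * q + 2 * t)) from rfl,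
      this]
    simp
    ring
  simp only [key, ← Finset.sum_mul, Finset.sum_sub_distrib, ← Finset.mul_sum]
  rw [b.sum_sq_inner_left]
  simp
  ring

end Classical

/-! ### Interior gradient estimate and strong minimum principle -/

section Comparison

variable {E : Type*} [NormedAddCommGroup E] [InnerProductSpace ℝ E] [FiniteDimensional ℝ E]

lemma abs_laplacian_oddPart_le {u : E → ℝ} {x₀ : E} {d F : ℝ}
    (hu : ∀ y ∈ Metric.closedBall x₀ d, ContDiffAt ℝ 2 u y)
    (hF : ∀ y ∈ Metric.closedBall x₀ d, |Δ u y| ≤ F) (R : E ≃ₗᵢ[ℝ] E) {y : E} (hy : ‖y‖ ≤ d) :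
    ContDiffAt ℝ 2 (fun y => (1 / 2 : ℝ) * (u (x₀ + y) - u (x₀ + R y))) y ∧
    |Δ (fun y => (1 / 2 : ℝ) * (u (x₀ + y) - u (x₀ + R y))) y| ≤ F := by
  have m1 : x₀ + y ∈ Metric.closedBall x₀ d := by simpa using hy
  have m2 : x₀ + R y ∈ Metric.closedBall x₀ d := by simpa using hy
  have c1 : ContDiffAt ℝ 2 (fun y => u (x₀ + y)) y :=
    ContDiffAt.comp (f := fun y => x₀ + y) (g := u) y (hu _ m1)
      (contDiff_const.add contDiff_id).contDiffAt
  have c2 : ContDiffAt ℝ 2 (fun y => u (x₀ + R y)) y :=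
    ContDiffAt.comp (f := fun y => x₀ + R y) (g := u) y (hu _ m2)
      (contDiff_const.add R.contDiff).contDiffAt
  have e : (fun y => (1 / 2 : ℝ) * (u (x₀ + y) - u (x₀ + R y)))
      = (1 / 2 : ℝ) • ((fun y => u (x₀ + y)) - fun y => u (x₀ + R y)) := by
    ext y; simp
  refine ⟨contDiffAt_const.mul (c1.sub c2), ?_⟩
  rw [e, laplacian_smul (f := (fun y => u (x₀ + y)) - fun y => u (x₀ + R y)) _ (c1.sub c2), c1.laplacian_sub c2, laplacian_comp_isometry R (hu _ m2)]
  have h1 := laplacian_comp_isometry (LinearIsometryEquiv.refl ℝ E) (x := y) (hu _ m1)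
  simp only [LinearIsometryEquiv.coe_refl, id_eq] at h1
  rw [h1]
  have := abs_le.1 (hF _ m1)
  have := abs_le.1 (hF _ m2)
  rw [abs_le]
  constructor <;> simp only [smul_eq_mul] <;> linarith

/-- The odd part φ of `u` under reflection in the hyperplane orthogonal to `e` has the same
derivative along `e` at the centre, and vanishes on that hyperplane. On the half ball it stays below
the barrier ψ(y) = M|y|²/d² + A t (d - t), where t = ⟨y, e⟩. Both vanish at the centre, so their
slopes there compare, and that of ψ is `A * d`. -/
lemma fderiv_apply_le_of_laplacian_bound {u : E → ℝ} {x₀ e : E} {d M F A : ℝ} (hd : 0 < d)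
    (he : ‖e‖ = 1)
    (hu : ∀ y ∈ Metric.closedBall x₀ d, ContDiffAt ℝ 2 u y)
    (hM : ∀ y ∈ Metric.closedBall x₀ d, |u y| ≤ M)
    (hF : ∀ y ∈ Metric.closedBall x₀ d, |Δ u y| ≤ F)
    (hA : Module.finrank ℝ E * M / d ^ 2 + F / 2 < A) : fderiv ℝ u x₀ e ≤ A * d := by
  have hM0 : 0 ≤ M := (abs_nonneg _).trans (hM x₀ (Metric.mem_closedBall_self hd.le))
  have hF0 : 0 ≤ F := (abs_nonneg _).trans (hF x₀ (Metric.mem_closedBall_self hd.le))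
  have hA0 : 0 < A := lt_of_le_of_lt (by positivity) hA
  set R : E ≃ₗᵢ[ℝ] E := (ℝ ∙ e)ᗮ.reflection with hR
  have hRfix : ∀ y, ⟪y, e⟫_ℝ = 0 → R y = y := fun y hy => by
    rw [hR, Submodule.reflection_eq_self_iff, Submodule.mem_orthogonal_singleton_iff_inner_left]
    exact hy
  have hRe : R e = -e := by
    rw [hR]; exact Submodule.reflection_orthogonalComplement_singleton_eq_neg e
  set φ : E → ℝ := fun y => (1 / 2 : ℝ) * (u (x₀ + y) - u (x₀ + R y)) with hφ
  set ψ : E → ℝ := fun y => M / d ^ 2 * ‖y‖ ^ 2 + A * d * ⟪y, e⟫_ℝ + (-A) * ⟪y, e⟫_ℝ ^ 2 with hψ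
  have hφc : ∀ y, ‖y‖ ≤ d → ContDiffAt ℝ 2 φ y ∧ |Δ φ y| ≤ F :=
    fun y hy => abs_laplacian_oddPart_le hu hF R hy
  have hinner : Continuous fun y : E => ⟪y, e⟫_ℝ := continuous_id.inner continuous_const
  have hψc : ContDiff ℝ 2 ψ := by
    have h1 := contDiff_norm_sq ℝ (E := E) (n := 2)
    have h2 : ContDiff ℝ 2 fun y : E => ⟪y, e⟫_ℝ := contDiff_id.inner ℝ contDiff_const
    exact ((contDiff_const.mul h1).add (contDiff_const.mul h2)).add (contDiff_const.mul (h2.pow 2))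
  have hφM : ∀ y, ‖y‖ ≤ d → φ y ≤ M := by
    intro y hy
    have m1 := abs_le.1 (hM (x₀ + y) (by simpa using hy))
    have m2 := abs_le.1 (hM (x₀ + R y) (by simpa using hy))
    simp only [hφ]; linarith
  have hinner_le : ∀ y, ‖y‖ ≤ d → ⟪y, e⟫_ℝ ≤ d := by
    intro y hy
    have := real_inner_le_norm y e
    rw [he, mul_one] at this
    exact this.trans hy
  set K : Set E := Metric.closedBall 0 d ∩ {y | 0 ≤ ⟪y, e⟫_ℝ} with hK
  have hKc : IsCompact K :=
    (isCompact_closedBall 0 d).inter_right (isClosed_le continuous_const hinner)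
  have hKn : K.Nonempty := ⟨0, by simp [hK, hd.le]⟩
  have hcont : ContinuousOn (ψ - φ) K := by
    intro y hy
    have : ‖y‖ ≤ d := by simpa using hy.1
    exact (hψc.continuous.continuousAt.sub (hφc y this).1.continuousAt).continuousWithinAt
  have hcomp : ∀ y ∈ K, φ y ≤ ψ y := by
    obtain ⟨z, hzK, hzmin⟩ := hKc.exists_isMinOn hKn hcont
    have hz1 : ‖z‖ ≤ d := by simpa using hzK.1
    have hz2 : 0 ≤ ⟪z, e⟫_ℝ := hzK.2
    suffices h : 0 ≤ ψ z - φ z by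
      intro y hy
      have := hzmin hy
      simp only [mem_ofPred_eq, Pi.sub_apply] at this
      linarith
    by_contra! hneg
    have hψlin : 0 ≤ A * d * ⟪z, e⟫_ℝ + (-A) * ⟪z, e⟫_ℝ ^ 2 := by
      have := hinner_le z hz1
      have h3 : 0 ≤ A * (⟪z, e⟫_ℝ * (d - ⟪z, e⟫_ℝ)) :=
        mul_nonneg hA0.le (mul_nonneg hz2 (by linarith))
      nlinarith
    -- On the sphere the quadratic term alone equals M, which bounds φ.
    have hz3 : ‖z‖ < d := by
      refine lt_of_le_of_ne hz1 fun h => ?_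
      have h1 := hφM z hz1
      have h2 : M / d ^ 2 * ‖z‖ ^ 2 = M := by rw [h]; field_simp
      simp only [hψ] at hneg
      linarith
    -- On the flat face φ vanishes while ψ is nonnegative.
    have hz4 : 0 < ⟪z, e⟫_ℝ := by
      refine lt_of_le_of_ne hz2 fun h => ?_
      have h1 : φ z = 0 := by simp [hφ, hRfix z h.symm]
      have h2 : 0 ≤ M / d ^ 2 * ‖z‖ ^ 2 := by positivity
      simp only [hψ] at hneg hψlin
      linarith
    have hloc : IsLocalMin (ψ - φ) z := by
      refine hzmin.isLocalMin ?_
      refine inter_mem (Metric.closedBall_mem_nhds_of_mem (by simpa using hz3)) ?_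
      filter_upwards [hinner.continuousAt.eventually (lt_mem_nhds hz4)] with y hy
      exact le_of_lt hy
    -- At an interior minimum Δ(ψ - φ) ≤ 2nM/d² - 2A + F, which `hA` makes negative.
    have hlap := laplacian_nonneg_of_isLocalMin (hψc.contDiffAt.sub (hφc z hz1).1) hloc
    have hsub := hψc.contDiffAt.laplacian_sub (hφc z hz1).1
    change 0 ≤ Δ (ψ - φ) z at hlap
    rw [hsub, hψ, laplacian_norm_sq_add e z he] at hlap
    have := abs_le.1 (hφc z hz1).2
    have h5 : 2 * (Module.finrank ℝ E : ℝ) * (M / d ^ 2) = 2 * (Module.finrank ℝ E * M / d ^ 2) := by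
      ring
    linarith
  have hline : HasDerivAt (fun t : ℝ => x₀ + t • e) e 0 := by
    simpa using ((hasDerivAt_id (0 : ℝ)).smul_const e).const_add x₀
  have hline' : HasDerivAt (fun t : ℝ => x₀ + t • -e) (-e) 0 := by
    simpa using ((hasDerivAt_id (0 : ℝ)).smul_const (-e)).const_add x₀
  have hud : DifferentiableAt ℝ u x₀ :=
    (hu x₀ (Metric.mem_closedBall_self hd.le)).differentiableAt (by simp)
  have d1 : HasDerivAt (fun t : ℝ => u (x₀ + t • e)) (fderiv ℝ u x₀ e) 0 := by
    have : HasFDerivAt u (fderiv ℝ u x₀) (x₀ + (0 : ℝ) • e) := by simpa using hud.hasFDerivAt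
    exact this.comp_hasDerivAt (0 : ℝ) hline
  have d2 : HasDerivAt (fun t : ℝ => u (x₀ + t • -e)) (-fderiv ℝ u x₀ e) 0 := by
    have : HasFDerivAt u (fderiv ℝ u x₀) (x₀ + (0 : ℝ) • -e) := by simpa using hud.hasFDerivAt
    exact (this.comp_hasDerivAt (0 : ℝ) hline').congr_deriv (by simp)
  have d3 : HasDerivAt (fun t : ℝ => M / d ^ 2 * t ^ 2 + A * d * t + (-A) * t ^ 2) (A * d) 0 := by
    have := ((((hasDerivAt_id' (0 : ℝ)).fun_pow 2).const_mul (M / d ^ 2)).fun_add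
      ((hasDerivAt_id' (0 : ℝ)).const_mul (A * d))).fun_add
      (((hasDerivAt_id' (0 : ℝ)).fun_pow 2).const_mul (-A))
    exact this.congr_deriv (by simp)
  have d4 := d3.sub ((d1.sub d2).const_mul (1 / 2 : ℝ))
  have := d4.nonneg_of_forall_Ioc hd (by simp) ?_
  · linarith
  · intro t ht
    have hte : ‖t • e‖ = t := by simp [norm_smul, he, abs_of_pos ht.1]
    have hin : ⟪t • e, e⟫_ℝ = t := by simp [inner_smul_left, he]
    have hmem : t • e ∈ K := ⟨by simpa [hte] using ht.2, by simpa [hin] using ht.1.le⟩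
    have := hcomp _ hmem
    simp only [hφ, hψ, hte, hin, map_smul, hRe] at this
    simp only [Pi.sub_apply]
    linarith

/-- Interior gradient estimate for Poisson's equation. -/
lemma norm_fderiv_le_of_laplacian_bound {F' : Type*} [NormedAddCommGroup F'] [NormedSpace ℝ F']
    {u : E → F'} {x₀ : E} {d M F : ℝ} (hd : 0 < d)
    (hu : ∀ y ∈ Metric.closedBall x₀ d, ContDiffAt ℝ 2 u y)
    (hM : ∀ y ∈ Metric.closedBall x₀ d, ‖u y‖ ≤ M)
    (hF : ∀ y ∈ Metric.closedBall x₀ d, ‖Δ u y‖ ≤ F) :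
    ‖fderiv ℝ u x₀‖ ≤ Module.finrank ℝ E * M / d + F * d / 2 := by
  have hM0 : 0 ≤ M := (norm_nonneg _).trans (hM x₀ (Metric.mem_closedBall_self hd.le))
  have hF0 : 0 ≤ F := (norm_nonneg _).trans (hF x₀ (Metric.mem_closedBall_self hd.le))
  have key : ∀ e : E, ‖e‖ = 1 → ‖fderiv ℝ u x₀ e‖ ≤
      Module.finrank ℝ E * M / d + F * d / 2 := by
    intro e he
    -- A norming functional reduces vector values, needed later for `u` a derivative, to the scalar
    -- case.
    obtain ⟨l, hl1, hl2⟩ := exists_dual_vector'' ℝ (fderiv ℝ u x₀ e)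
    have hle : ∀ w : F', |l w| ≤ ‖w‖ := fun w =>
      (l.le_opNorm w).trans (by simpa using mul_le_mul_of_nonneg_right hl1 (norm_nonneg w))
    have hlap : ∀ y ∈ Metric.closedBall x₀ d, Δ (l ∘ u) y = l (Δ u y) := fun y hy => by
      simpa using (hu y hy).laplacian_CLM_comp_left (l := l)
    have hfd : fderiv ℝ (l ∘ u) x₀ e = ‖fderiv ℝ u x₀ e‖ := by
      rw [fderiv_comp _ l.differentiableAt
        ((hu x₀ (Metric.mem_closedBall_self hd.le)).differentiableAt (by simp))]
      simpa using hl2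
    rw [← hfd]
    -- The scalar estimate needs a strict inequality for A; the excess ε / d contributes ε to the
    -- bound.
    refine le_of_forall_pos_le_add fun ε hε => ?_
    have := fderiv_apply_le_of_laplacian_bound (u := l ∘ u) (M := M) (F := F)
      (A := Module.finrank ℝ E * M / d ^ 2 + F / 2 + ε / d) hd he
      (fun y hy => l.contDiff.contDiffAt.comp y (hu y hy))
      (fun y hy => (hle _).trans (hM y hy))
      (fun y hy => by rw [hlap y hy]; exact (hle _).trans (hF y hy)) (by simp; positivity)
    refine this.trans (le_of_eq ?_)
    field_simp
  refine ContinuousLinearMap.opNorm_le_bound _ (by positivity) fun w => ?_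
  rcases eq_or_ne w 0 with rfl | hw
  · simp
  have hw' : 0 < ‖w‖ := norm_pos_iff.2 hw
  have := key (‖w‖⁻¹ • w) (by simp [norm_smul, hw'.ne'])
  rw [map_smul, norm_smul, norm_inv, norm_norm, inv_mul_le_iff₀ hw'] at this
  linarith

/-- Hopf's strong minimum principle for `Δ v ≤ L v`. -/
lemma eqOn_zero_of_laplacian_le {Ω : Set E} (hΩ : IsOpen Ω) (hconn : IsPreconnected Ω)
    {v : E → ℝ} {L : ℝ} (hL : 0 ≤ L) (hv : ∀ x ∈ Ω, ContDiffAt ℝ 2 v x)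
    (hv0 : ∀ x ∈ Ω, 0 ≤ v x) (hlap : ∀ x ∈ Ω, Δ v x ≤ L * v x) {x₁ : E} (hx₁ : x₁ ∈ Ω)
    (hx₁0 : v x₁ = 0) : ∀ x ∈ Ω, v x = 0 := by
  have hcontΩ : ContinuousOn v Ω := fun x hx => (hv x hx).continuousAt.continuousWithinAt
  have hopen : ∀ x₀ ∈ Ω, v x₀ = 0 → ∀ᶠ y in 𝓝 x₀, v y = 0 := by
    intro x₀ hx₀ hvx₀
    obtain ⟨r, hr, hrΩ⟩ := Metric.nhds_basis_closedBall.mem_iff.1 (hΩ.mem_nhds hx₀)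
    refine Filter.eventually_of_mem (Metric.ball_mem_nhds x₀ (half_pos hr)) fun y hy => ?_
    by_contra hvy
    -- the zero of `v` nearest to `y`
    set Z : Set E := Metric.closedBall x₀ r ∩ v ⁻¹' {0} with hZ
    have hZc : IsCompact Z := by
      refine (isCompact_closedBall x₀ r).of_isClosed_subset ?_ inter_subset_left
      exact (hcontΩ.mono hrΩ).preimage_isClosed_of_isClosed Metric.isClosed_closedBall
        isClosed_singleton
    have hZn : Z.Nonempty := ⟨x₀, by simp [hr.le], hvx₀⟩
    obtain ⟨z, hzZ, hzmin⟩ := hZc.exists_isMinOn hZn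
      (f := fun z => dist z y) (by fun_prop)
    set R := dist z y with hRdef
    have hzv : v z = 0 := hzZ.2
    -- The zero x₀ lies within r / 2 of y, so the ball about y up to its nearest zero stays in the
    -- ball of radius r about x₀.
    have hRlt : R < r / 2 := by
      have : R ≤ dist x₀ y := hzmin (show x₀ ∈ Z from ⟨by simp [hr.le], hvx₀⟩)
      rw [dist_comm] at this
      exact this.trans_lt (Metric.mem_ball.1 hy)
    have hR0 : 0 < R := by
      refine dist_pos.2 fun h => hvy (h ▸ hzv)
    have hball : ∀ w, dist w y ≤ R → dist w x₀ < r := fun w hw => by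
      have := dist_triangle w y x₀
      have := Metric.mem_ball.1 hy
      linarith
    have hballΩ : ∀ w, dist w y ≤ R → w ∈ Ω := fun w hw => hrΩ (hball w hw).le
    have hvpos : ∀ w, dist w y < R → 0 < v w := by
      intro w hw
      refine lt_of_le_of_ne (hv0 w (hballΩ w hw.le)) fun h => ?_
      have : R ≤ dist w y := hzmin (show w ∈ Z from ⟨(hball w hw.le).le, h.symm⟩)
      linarith
    set n : ℝ := (Module.finrank ℝ E : ℝ) with hn
    have hn0 : 0 ≤ n := Nat.cast_nonneg _
    -- Where |w - y| ≥ R / 2, one has 4a²|w - y|² - 2an ≥ a(aR² - 2n) ≥ a(L + 1) > L. The final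
    -- summand 1 secures a ≥ 1.
    set a : ℝ := (2 * n + L + 1) / R ^ 2 + 1 with ha
    have ha1 : 1 ≤ a := by
      have : 0 ≤ (2 * n + L + 1) / R ^ 2 := by positivity
      linarith
    have haR : 2 * n + L + 1 ≤ a * R ^ 2 := by
      rw [ha, add_mul, div_mul_cancel₀ _ (by positivity)]
      nlinarith [sq_nonneg R]
    set h : E → ℝ := fun w => Real.exp (-a * ‖w - y‖ ^ 2) - Real.exp (-a * R ^ 2) with hh
    have hexpc : ContDiff ℝ 2 (fun w : E => Real.exp (-a * ‖w - y‖ ^ 2)) := by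
      have := (contDiff_norm_sq ℝ (E := E) (n := 2)).comp
        (contDiff_id.sub (contDiff_const (c := y)))
      exact (contDiff_const.mul this).exp
    have hhc : ContDiff ℝ 2 h := hexpc.sub contDiff_const
    have hhlap : ∀ w, R / 2 ≤ dist w y → L * h w < Δ h w := by
      intro w hw
      have e1 : Δ h w = Δ (fun w : E => Real.exp (-a * ‖w - y‖ ^ 2)) w := by
        have := hexpc.contDiffAt (x := w).laplacian_sub
          (contDiffAt_const (c := Real.exp (-a * R ^ 2)))
        rw [laplacian_const, Pi.zero_apply, sub_zero] at this
        exact this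
      rw [e1, laplacian_exp_norm_sq]
      rw [dist_eq_norm] at hw
      have e2 : R ^ 2 / 4 ≤ ‖w - y‖ ^ 2 := by nlinarith
      have e3 : L < 4 * a ^ 2 * ‖w - y‖ ^ 2 - 2 * a * n := by
        have : a * (a * R ^ 2) ≤ 4 * a ^ 2 * ‖w - y‖ ^ 2 := by nlinarith [sq_nonneg a]
        have : a * (2 * n + L + 1) ≤ a * (a * R ^ 2) := by gcongr
        nlinarith
      have e4 : h w < Real.exp (-a * ‖w - y‖ ^ 2) := by
        simp only [hh]; linarith [Real.exp_pos (-a * R ^ 2)]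
      calc L * h w ≤ L * Real.exp (-a * ‖w - y‖ ^ 2) := by gcongr
        _ < _ := by gcongr
    -- the minimum of `v` on the closed ball of half the radius
    have hinner : IsCompact (Metric.closedBall y (R / 2)) := isCompact_closedBall _ _
    obtain ⟨p, hpm, hpmin⟩ := hinner.exists_isMinOn
      ⟨y, Metric.mem_closedBall_self (by positivity)⟩
      (hcontΩ.mono fun w hw => hballΩ w (by
        have := Metric.mem_closedBall.1 hw; linarith))
    have hvp : 0 < v p := hvpos p (by have := Metric.mem_closedBall.1 hpm; linarith)
    set ε := v p with hε
    have hh1 : ∀ w, h w ≤ 1 := fun w => by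
      have : Real.exp (-a * ‖w - y‖ ^ 2) ≤ 1 := Real.exp_le_one_iff.2 (by
        have := sq_nonneg ‖w - y‖; nlinarith)
      simp only [hh]; linarith [Real.exp_pos (-a * R ^ 2)]
    -- Comparison takes place on an annulus, as the barrier has the wrong sign of Laplacian near y.
    -- On the outer sphere h = 0 ≤ v, on the inner one ε h ≤ ε ≤ v, and at an interior negative
    -- minimum Δ(v - εh) < L(v - εh) < 0 or, for L = 0, at least Δ(v - εh) < 0.
    set K : Set E := Metric.closedBall y R ∩ {w | R / 2 ≤ dist w y} with hK
    have hKc : IsCompact K := (isCompact_closedBall y R).inter_right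
      (isClosed_le continuous_const (by fun_prop))
    have hKΩ : ∀ w ∈ K, w ∈ Ω := fun w hw => hballΩ w hw.1
    have hcmp : ∀ w ∈ K, ε * h w ≤ v w := by
      have hKn : K.Nonempty := ⟨z, by simp [hRdef], by
        change R / 2 ≤ R; linarith⟩
      obtain ⟨q, hqK, hqmin⟩ := hKc.exists_isMinOn hKn (f := v - ε • h)
        ((hcontΩ.mono hKΩ).sub (hhc.continuous.const_smul ε).continuousOn)
      suffices hs : 0 ≤ v q - ε * h q by
        intro w hw
        have := hqmin hw
        simp only [mem_ofPred_eq, Pi.sub_apply, Pi.smul_apply, smul_eq_mul] at this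
        linarith
      by_contra! hneg
      have hqΩ := hKΩ q hqK
      have hq1 : dist q y < R := by
        refine lt_of_le_of_ne hqK.1 fun heq => ?_
        have : h q = 0 := by simp [hh, ← dist_eq_norm, heq]
        rw [this] at hneg
        linarith [hv0 q hqΩ]
      have hq2 : R / 2 < dist q y := by
        refine lt_of_le_of_ne hqK.2 fun heq => ?_
        have h1 : ε ≤ v q := hpmin (show q ∈ Metric.closedBall y (R / 2) from heq.symm.le)
        have h2 := mul_le_mul_of_nonneg_left (hh1 q) hvp.le
        linarith
      have hloc : IsLocalMin (v - ε • h) q := by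
        refine hqmin.isLocalMin (inter_mem (Metric.closedBall_mem_nhds_of_mem hq1) ?_)
        have : ContinuousAt (fun w => dist w y) q := by fun_prop
        filter_upwards [this.eventually (lt_mem_nhds hq2)] with w hw
        exact le_of_lt hw
      have hεc : ContDiffAt ℝ 2 (ε • h) q := contDiffAt_const.smul hhc.contDiffAt
      have hsub := (hv q hqΩ).laplacian_sub hεc
      have hl : 0 ≤ Δ (v - ε • h) q := laplacian_nonneg_of_isLocalMin ((hv q hqΩ).sub hεc) hloc
      rw [hsub, laplacian_smul _ hhc.contDiffAt, smul_eq_mul] at hl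
      have h1 := hlap q hqΩ
      have h2 := mul_lt_mul_of_pos_left (hhlap q hq2.le) hvp
      nlinarith
    -- the derivative in the inner normal direction at `z`
    have hzΩ : z ∈ Ω := hballΩ z le_rfl
    have hloc : IsLocalMin v z := by
      filter_upwards [hΩ.mem_nhds hzΩ] with w hw
      rw [hzv]; exact hv0 w hw
    -- The zero z is an interior minimum of v, so its gradient vanishes. The barrier below v has
    -- positive slope at z towards y: this is the contradiction.
    have hfd : fderiv ℝ v z = 0 := hloc.fderiv_eq_zero
    have hline : HasDerivAt (fun t : ℝ => z + t • (y - z)) (y - z) 0 := by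
      simpa using ((hasDerivAt_id (0 : ℝ)).smul_const (y - z)).const_add z
    have d1 : HasDerivAt (fun t : ℝ => v (z + t • (y - z))) 0 0 := by
      have : HasFDerivAt v (0 : E →L[ℝ] ℝ) (z + (0 : ℝ) • (y - z)) := by
        have := ((hv z hzΩ).differentiableAt (by simp)).hasFDerivAt
        rw [hfd] at this
        simpa using this
      exact (this.comp_hasDerivAt (0 : ℝ) hline).congr_deriv (by simp)
    have d2 : HasDerivAt (fun t : ℝ => Real.exp (-a * ((1 - t) ^ 2 * R ^ 2)) - Real.exp (-a * R ^ 2))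
        (Real.exp (-a * R ^ 2) * (2 * a * R ^ 2)) 0 := by
      have i1 : HasDerivAt (fun t : ℝ => -a * ((1 - t) ^ 2 * R ^ 2)) (2 * a * R ^ 2) 0 := by
        have := ((((hasDerivAt_id (0 : ℝ)).const_sub 1).pow 2).mul_const (R ^ 2)).const_mul (-a)
        refine HasDerivAt.congr_deriv this ?_
        simp; ring
      have := i1.exp.sub_const (Real.exp (-a * R ^ 2))
      simpa using this
    have := (d1.sub (d2.const_mul ε)).nonneg_of_forall_Ioc (δ := 1 / 2) (by norm_num)
      (by simp [hzv]) ?_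
    · have : 0 < ε * (Real.exp (-a * R ^ 2) * (2 * a * R ^ 2)) := by
        have := Real.exp_pos (-a * R ^ 2)
        positivity
      linarith
    · intro t ht
      have e1 : z + t • (y - z) - y = (1 - t) • (z - y) := by module
      have e2 : ‖z + t • (y - z) - y‖ = (1 - t) * R := by
        rw [e1, norm_smul, Real.norm_eq_abs, abs_of_nonneg (by linarith [ht.2]), ← dist_eq_norm]
      have hm : z + t • (y - z) ∈ K := by
        constructor
        · rw [Metric.mem_closedBall, dist_eq_norm, e2]; nlinarith [ht.1]
        · change R / 2 ≤ dist _ _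
          rw [dist_eq_norm, e2]; nlinarith [ht.2]
      have := hcmp _ hm
      simp only [hh, e2, mul_pow] at this
      simp only [Pi.sub_apply]
      linarith
  -- connectedness
  have hO : IsOpen {x | x ∈ Ω ∧ v x = 0} := by
    rw [isOpen_iff_mem_nhds]
    rintro x ⟨hx, hx0⟩
    filter_upwards [hΩ.mem_nhds hx, hopen x hx hx0] with w h1 h2 using ⟨h1, h2⟩
  have hO' : IsOpen {x | x ∈ Ω ∧ v x ≠ 0} := by
    have := hcontΩ.isOpen_inter_preimage hΩ (isOpen_compl_singleton (x := (0 : ℝ)))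
    convert this using 1
    ext x; simp
  by_contra! hex
  obtain ⟨x₂, hx₂, hx₂0⟩ := hex
  obtain ⟨w, -, hw1, hw2⟩ := hconn _ _ hO hO'
    (fun x hx => by by_cases h : v x = 0 <;> simp [hx, h])
    ⟨x₁, hx₁, hx₁, hx₁0⟩ ⟨x₂, hx₂, hx₂, hx₂0⟩
  exact hw2.2 hw1.2

end Comparison

/-! ### C² limits under bounds on Laplacians -/

section Limits

variable {E : Type*} [NormedAddCommGroup E] [InnerProductSpace ℝ E] [FiniteDimensional ℝ E]
variable {F : Type*} [NormedAddCommGroup F] [NormedSpace ℝ F]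

/-- Third derivatives are symmetric: swapping the last two and then the first two arguments moves
the direction `e` to the outermost derivative. -/
lemma laplacian_fderiv_comm {u : E → F} (hu : ContDiff ℝ ∞ u) (x : E) :
    Δ (fderiv ℝ u) x = fderiv ℝ (Δ u) x := by
  set b := stdOrthonormalBasis ℝ E
  have c1 : ContDiff ℝ ∞ (fderiv ℝ u) := hu.fderiv_right (by simp)
  have c2 : ContDiff ℝ ∞ (fderiv ℝ (fderiv ℝ u)) := c1.fderiv_right (by simp)
  have hd : ∀ y, HasFDerivAt (fderiv ℝ (fderiv ℝ u)) (fderiv ℝ (fderiv ℝ (fderiv ℝ u)) y) y :=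
    fun y => ((c2.differentiable (by simp)) y).hasFDerivAt
  have happ : ∀ p q a : E, fderiv ℝ (fun y => fderiv ℝ (fderiv ℝ u) y p q) x a
      = fderiv ℝ (fderiv ℝ (fderiv ℝ u)) x a p q := by
    intro p q a
    have := (((hd x).clm_apply (hasFDerivAt_const p x)).clm_apply (hasFDerivAt_const q x)).fderiv
    rw [this]
    simp
  have hsymm1 : ∀ y p q, fderiv ℝ (fderiv ℝ u) y p q = fderiv ℝ (fderiv ℝ u) y q p := fun y p q =>
    (hu.contDiffAt.isSymmSndFDerivAt (by simp [ENat.LEInfty.out])) p q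
  have hsymm2 : ∀ p q, fderiv ℝ (fderiv ℝ (fderiv ℝ u)) x p q
      = fderiv ℝ (fderiv ℝ (fderiv ℝ u)) x q p := fun p q =>
    (c1.contDiffAt.isSymmSndFDerivAt (by simp [ENat.LEInfty.out])) p q
  have hlast : ∀ a p q, fderiv ℝ (fderiv ℝ (fderiv ℝ u)) x a p q
      = fderiv ℝ (fderiv ℝ (fderiv ℝ u)) x a q p := fun a p q => by
    rw [← happ, ← happ]
    simp_rw [hsymm1 _ p q]
  ext e
  have hΔ : Δ u = fun y => ∑ i, fderiv ℝ (fderiv ℝ u) y (b i) (b i) := by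
    ext y; exact laplacian_eq_sum_fderiv b u y
  have hdiff : ∀ i ∈ Finset.univ, DifferentiableAt ℝ
      (fun y => fderiv ℝ (fderiv ℝ u) y (b i) (b i)) x := fun i _ =>
    (((hd x).clm_apply (hasFDerivAt_const (b i) x)).clm_apply
      (hasFDerivAt_const (b i) x)).differentiableAt
  rw [laplacian_eq_sum_fderiv b, hΔ, fderiv_fun_sum hdiff]
  simp only [sum_apply, happ]
  refine Finset.sum_congr rfl fun i _ => ?_
  rw [hlast, hsymm2]

/-- The gradient estimate for differences reads nδ/r + Br, where δ bounds the difference of the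
functions. The Laplacians need only be bounded: a small radius r handles the second term, and a late
index then handles the first. -/
lemma uniformCauchySeqOn_fderiv_of_laplacian_bound {v : ℕ → E → F} {x : E} {ρ B : ℝ} (hρ : 0 < ρ)
    (hv : ∀ n, ContDiff ℝ 2 (v n))
    (hc : UniformCauchySeqOn v atTop (Metric.ball x (2 * ρ)))
    (hB : ∀ n, ∀ y ∈ Metric.ball x (2 * ρ), ‖Δ (v n) y‖ ≤ B) :
    UniformCauchySeqOn (fun n => fderiv ℝ (v n)) atTop (Metric.ball x ρ) := by
  have hB0 : 0 ≤ B := (norm_nonneg _).trans (hB 0 x (Metric.mem_ball_self (by positivity)))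
  rw [Metric.uniformCauchySeqOn_iff] at hc ⊢
  intro ε hε
  set n : ℝ := (Module.finrank ℝ E : ℝ) with hn
  have hn0 : 0 ≤ n := Nat.cast_nonneg _
  set r : ℝ := min (ρ / 2) (ε / (4 * (B + 1))) with hr
  have hr0 : 0 < r := by positivity
  have hr1 : r < ρ := (min_le_left _ _).trans_lt (by linarith)
  have hr2 : B * r ≤ ε / 4 := by
    calc B * r ≤ (B + 1) * (ε / (4 * (B + 1))) := by
          gcongr
          · linarith
          · exact min_le_right _ _
      _ = ε / 4 := by field_simp
  set δ : ℝ := ε * r / (4 * (n + 1)) with hδ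
  have hδ0 : 0 < δ := by positivity
  obtain ⟨N, hN⟩ := hc δ hδ0
  refine ⟨N, fun m hm k hk y hy => ?_⟩
  have hsub : ∀ z ∈ Metric.closedBall y r, z ∈ Metric.ball x (2 * ρ) := fun z hz => by
    have h1 := dist_triangle z y x
    have h2 := Metric.mem_closedBall.1 hz
    have h3 := Metric.mem_ball.1 hy
    rw [Metric.mem_ball]; linarith
  have := norm_fderiv_le_of_laplacian_bound (u := v m - v k) (x₀ := y) (M := δ) (F := 2 * B) hr0
    (fun z _ => ((hv m).sub (hv k)).contDiffAt)
    (fun z hz => by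
      have := hN m hm k hk z (hsub z hz)
      rw [dist_eq_norm] at this
      exact this.le)
    (fun z hz => by
      rw [(hv m).contDiffAt.laplacian_sub (hv k).contDiffAt]
      have h1 := hB m z (hsub z hz)
      have h2 := hB k z (hsub z hz)
      exact (norm_sub_le _ _).trans (by linarith))
  rw [fderiv_sub ((hv m).differentiable (by simp) y) ((hv k).differentiable (by simp) y)] at this
  rw [dist_eq_norm]
  refine this.trans_lt ?_
  have h3 : n * δ / r ≤ ε / 4 := by
    rw [hδ, div_le_iff₀ hr0, ← mul_div_assoc, div_le_iff₀ (by positivity)]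
    nlinarith [mul_pos hε hr0]
  linarith

lemma hasFDerivAt_of_uniformCauchySeqOn_fderiv [CompleteSpace F] {v : ℕ → E → F} {w : E → F}
    {x : E} {ρ : ℝ}
    (hv : ∀ n, ContDiff ℝ 1 (v n))
    (hc : UniformCauchySeqOn (fun n => fderiv ℝ (v n)) atTop (Metric.ball x ρ))
    (hw : ∀ y ∈ Metric.ball x ρ, Tendsto (fun n => v n y) atTop (𝓝 (w y))) :
    TendstoUniformlyOn (fun n => fderiv ℝ (v n)) (fderiv ℝ w) atTop (Metric.ball x ρ) ∧
    DifferentiableOn ℝ w (Metric.ball x ρ) := by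
  have hlim : ∀ y ∈ Metric.ball x ρ, ∃ l, Tendsto (fun n => fderiv ℝ (v n) y) atTop (𝓝 l) :=
    fun y hy => cauchySeq_tendsto_of_complete (hc.cauchySeq hy)
  choose! l hl using hlim
  have hu := hc.tendstoUniformlyOn_of_tendsto hl
  have hd : ∀ y ∈ Metric.ball x ρ, HasFDerivAt w (l y) y := fun y hy =>
    hasFDerivAt_of_tendstoUniformlyOn Metric.isOpen_ball hu
      (fun n z _ => ((hv n).differentiable (by simp) z).hasFDerivAt) hw hy
  exact ⟨hu.congr_right fun y hy => (hd y hy).fderiv.symm,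
    fun y hy => (hd y hy).differentiableAt.differentiableWithinAt⟩

/-- The preceding step is applied to `v n` and then to its derivative, whose Laplacian is the
derivative of Δ(v n). Each application halves the radius, hence the initial `4 * ρ`. -/
lemma contDiffAt_two_of_laplacian_bound [CompleteSpace F] {v : ℕ → E → F} {w : E → F} {x : E}
    {ρ B L : ℝ} {h : F}
    (hρ : 0 < ρ) (hv : ∀ n, ContDiff ℝ ∞ (v n))
    (hw : TendstoUniformlyOn v w atTop (Metric.ball x (4 * ρ)))
    (hB : ∀ n, ∀ y ∈ Metric.ball x (4 * ρ), ‖Δ (v n) y‖ ≤ B)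
    (hL : ∀ n, ∀ y ∈ Metric.ball x (4 * ρ), ‖fderiv ℝ (Δ (v n)) y‖ ≤ L)
    (hh : Tendsto (fun n => Δ (v n) x) atTop (𝓝 h)) :
    ContDiffAt ℝ 2 w x ∧ Δ w x = h := by
  have hsub2 : Metric.ball x (2 * ρ) ⊆ Metric.ball x (4 * ρ) :=
    Metric.ball_subset_ball (by linarith)
  have hsub1 : Metric.ball x ρ ⊆ Metric.ball x (2 * ρ) := Metric.ball_subset_ball (by linarith)
  have hv1 : ∀ n, ContDiff ℝ ∞ (fderiv ℝ (v n)) := fun n => (hv n).fderiv_right (by simp)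
  have c1 := uniformCauchySeqOn_fderiv_of_laplacian_bound (v := v) (x := x) (ρ := 2 * ρ) (B := B)
    (by linarith) (fun n => (hv n).of_le ENat.LEInfty.out)
    (by
      rw [show 2 * (2 * ρ) = 4 * ρ by ring]
      exact hw.uniformCauchySeqOn)
    (by
      rw [show 2 * (2 * ρ) = 4 * ρ by ring]
      exact hB)
  obtain ⟨t1, d1⟩ := hasFDerivAt_of_uniformCauchySeqOn_fderiv
    (fun n => (hv n).of_le ENat.LEInfty.out) c1
    fun y hy => hw.tendsto_at (hsub2 hy)
  have c2 := uniformCauchySeqOn_fderiv_of_laplacian_bound (v := fun n => fderiv ℝ (v n)) (x := x)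
    (ρ := ρ) (B := L) hρ (fun n => (hv1 n).of_le ENat.LEInfty.out) c1
    (fun n y hy => by rw [laplacian_fderiv_comm (hv n)]; exact hL n y (hsub2 hy))
  obtain ⟨t2, d2⟩ := hasFDerivAt_of_uniformCauchySeqOn_fderiv
    (fun n => (hv1 n).of_le ENat.LEInfty.out) c2
    fun y hy => t1.tendsto_at (hsub1 hy)
  have hcont : ContinuousOn (fderiv ℝ (fderiv ℝ w)) (Metric.ball x ρ) :=
    t2.continuousOn (Frequently.of_forall fun n =>
      ((hv1 n).continuous_fderiv (by simp)).continuousOn)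
  constructor
  · have : ContDiffOn ℝ 2 w (Metric.ball x ρ) := by
      rw [show (2 : WithTop ℕ∞) = 1 + 1 by norm_num,
        contDiffOn_succ_iff_fderiv_of_isOpen Metric.isOpen_ball]
      refine ⟨d1.mono hsub1, by simp, ?_⟩
      rw [show (1 : WithTop ℕ∞) = 0 + 1 by norm_num,
        contDiffOn_succ_iff_fderiv_of_isOpen Metric.isOpen_ball]
      exact ⟨d2, by simp, contDiffOn_zero.2 hcont⟩
    exact this.contDiffAt (Metric.ball_mem_nhds x hρ)
  · refine tendsto_nhds_unique ?_ hh
    simp_rw [laplacian_eq_sum_fderiv (stdOrthonormalBasis ℝ E)]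
    refine tendsto_finsetSum _ fun i _ => ?_
    have := t2.tendsto_at (Metric.mem_ball_self hρ)
    have hev : Continuous fun T : E →L[ℝ] E →L[ℝ] F =>
        T (stdOrthonormalBasis ℝ E i) (stdOrthonormalBasis ℝ E i) := by fun_prop
    exact (hev.tendsto _).comp this

end Limits

/-! ### Mollification and its derivatives -/

section Mollify

variable {E : Type*} [NormedAddCommGroup E] [InnerProductSpace ℝ E] [FiniteDimensional ℝ E]
  [MeasurableSpace E] [BorelSpace E] {μ : Measure E} [μ.IsAddHaarMeasure]

open scoped Convolution
open ContinuousLinearMap (lsmul)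

/-- A sequence of bump functions shrinking to the origin. -/
noncomputable def shrinkingBump (E : Type*) [NormedAddCommGroup E] [InnerProductSpace ℝ E] (n : ℕ) :
    ContDiffBump (0 : E) where
  rIn := 1 / (2 * ((n : ℝ) + 1))
  rOut := 1 / ((n : ℝ) + 1)
  rIn_pos := by positivity
  rIn_lt_rOut := by
    apply one_div_lt_one_div_of_lt <;> nlinarith [Nat.cast_nonneg (α := ℝ) n]

lemma tendsto_shrinkingBump_rOut :
    Tendsto (fun n => (shrinkingBump E n).rOut) atTop (𝓝 0) :=
  tendsto_one_div_add_atTop_nhds_zero_nat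

/-- Mollification of `u` at scale `1 / (n + 1)`. -/
noncomputable def mollify (μ : Measure E) (n : ℕ) (u : E → ℝ) : E → ℝ :=
  (shrinkingBump E n).normed μ ⋆[lsmul ℝ ℝ, μ] u

lemma contDiff_mollify (n : ℕ) {u : E → ℝ} (hu : LocallyIntegrable u μ) :
    ContDiff ℝ ∞ (mollify μ n u) :=
  (shrinkingBump E n).hasCompactSupport_normed.contDiff_convolution_left _
    (shrinkingBump E n).contDiff_normed hu

lemma fderiv_convolution_apply {η u : E → ℝ} (hη : ContDiff ℝ 1 η) (hs : HasCompactSupport η)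
    (hu : LocallyIntegrable u μ) (x e : E) :
    fderiv ℝ (η ⋆[lsmul ℝ ℝ, μ] u) x e = ((fun y => fderiv ℝ η y e) ⋆[lsmul ℝ ℝ, μ] u) x := by
  rw [← convolution_flip (f := η) (g := u), ← convolution_flip (g := u),
    (hs.hasFDerivAt_convolution_right _ hu hη x).fderiv,
    convolution_precompR_apply _ hu (hs.fderiv ℝ) (hη.continuous_fderiv (by simp))]

/-- All derivatives fall on the kernel, because `u` is only locally integrable. -/
lemma laplacian_convolution {η u : E → ℝ} (hη : ContDiff ℝ ∞ η) (hs : HasCompactSupport η)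
    (hu : LocallyIntegrable u μ) (x : E) :
    Δ (η ⋆[lsmul ℝ ℝ, μ] u) x = ∫ y, u y * Δ η (x - y) ∂μ := by
  set b := stdOrthonormalBasis ℝ E
  have hη1 : ∀ e, ContDiff ℝ ∞ fun y => fderiv ℝ η y e := fun e =>
    (hη.fderiv_right (by simp)).clm_apply contDiff_const
  have hη2 : ∀ e, ContDiff ℝ ∞ fun y => fderiv ℝ (fun y => fderiv ℝ η y e) y e := fun e =>
    ((hη1 e).fderiv_right (by simp)).clm_apply contDiff_const
  have hs1 : ∀ e, HasCompactSupport fun y => fderiv ℝ η y e := fun e => hs.fderiv_apply ℝ e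
  have hs2 : ∀ e, HasCompactSupport fun y => fderiv ℝ (fun y => fderiv ℝ η y e) y e := fun e =>
    (hs1 e).fderiv_apply ℝ e
  have hap : ∀ f : E → ℝ, ContDiff ℝ ∞ f → ∀ y e,
      fderiv ℝ (fderiv ℝ f) y e e = fderiv ℝ (fun y => fderiv ℝ f y e) y e := by
    intro f hf y e
    have h1 : DifferentiableAt ℝ (fderiv ℝ f) y :=
      ((hf.fderiv_right (m := ∞) (by simp)).differentiable (by simp)) y
    have := (h1.hasFDerivAt.clm_apply (hasFDerivAt_const e y)).fderiv
    rw [this]; simp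
  have hconv : ContDiff ℝ ∞ (η ⋆[lsmul ℝ ℝ, μ] u) := hs.contDiff_convolution_left _ hη hu
  have hle : ∀ f : E → ℝ, ContDiff ℝ ∞ f → ContDiff ℝ 1 f := fun f hf =>
    hf.of_le ENat.LEInfty.out
  rw [laplacian_eq_sum_fderiv b]
  have h1 : ∀ i, fderiv ℝ (fderiv ℝ (η ⋆[lsmul ℝ ℝ, μ] u)) x (b i) (b i)
      = ((fun y => fderiv ℝ (fun y => fderiv ℝ η y (b i)) y (b i)) ⋆[lsmul ℝ ℝ, μ] u) x := by
    intro i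
    rw [hap _ hconv]
    have : (fun y => fderiv ℝ (η ⋆[lsmul ℝ ℝ, μ] u) y (b i))
        = ((fun y => fderiv ℝ η y (b i)) ⋆[lsmul ℝ ℝ, μ] u) := by
      ext y; exact fderiv_convolution_apply (hle _ hη) hs hu y (b i)
    rw [this, fderiv_convolution_apply (hle _ (hη1 _)) (hs1 _) hu]
  simp_rw [h1, convolution_eq_swap]
  rw [← integral_finsetSum]
  · congr 1
    ext y
    rw [laplacian_eq_sum_fderiv b, Finset.mul_sum]
    refine Finset.sum_congr rfl fun i _ => ?_
    rw [hap _ hη, ContinuousLinearMap.lsmul_apply, smul_eq_mul, mul_comm]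
  · intro i _
    exact ((hs2 (b i)).convolutionExists_left (lsmul ℝ ℝ) (hη2 _).continuous hu x).integrable_swap

end Mollify

/-! ### Interior regularity of bounded weak solutions -/

section Regularity

variable {E : Type*} [NormedAddCommGroup E] [InnerProductSpace ℝ E] [FiniteDimensional ℝ E]
  [MeasurableSpace E] [BorelSpace E] {μ : Measure E} [μ.IsAddHaarMeasure]

open scoped Convolution
open ContinuousLinearMap (lsmul)

lemma mollify_apply (n : ℕ) (u : E → ℝ) (x : E) :
    mollify μ n u x = ∫ t, (shrinkingBump E n).normed μ t * u (x - t) ∂μ := rfl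

lemma abs_integral_bump_mul_le (n : ℕ) {h : E → ℝ} {C : ℝ}
    (hC : ∀ t ∈ Metric.ball (0 : E) (shrinkingBump E n).rOut, |h t| ≤ C) :
    |∫ t, (shrinkingBump E n).normed μ t * h t ∂μ| ≤ C := by
  set η := shrinkingBump E n
  have h1 : ‖∫ t, η.normed μ t * h t ∂μ‖ ≤ ∫ t, η.normed μ t * C ∂μ := by
    refine norm_integral_le_of_norm_le (η.integrable_normed.mul_const C)
      (Eventually.of_forall fun t => ?_)
    rw [norm_mul, Real.norm_eq_abs, Real.norm_eq_abs, abs_of_nonneg (η.nonneg_normed t)]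
    by_cases ht : t ∈ Metric.ball (0 : E) η.rOut
    · exact mul_le_mul_of_nonneg_left (hC t ht) (η.nonneg_normed t)
    · have : η.normed μ t = 0 := by
        rw [← Function.notMem_support, η.support_normed_eq]; exact ht
      simp [this]
  rwa [integral_mul_const, η.integral_normed, one_mul] at h1

lemma abs_mollify_le {n : ℕ} {u : E → ℝ} {x : E} {M : ℝ} (hM : ∀ y, |u y| ≤ M) :
    |mollify μ n u x| ≤ M :=
  abs_integral_bump_mul_le n fun _ _ => hM _

lemma abs_mollify_sub_le {n : ℕ} {f : E → ℝ} (hf : LocallyIntegrable f μ) {y z : E} {s : Set E}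
    {C : ℝ} (hC : ∀ p ∈ s, ∀ q ∈ s, |f p - f q| ≤ C * ‖p - q‖)
    (hy : Metric.ball y (shrinkingBump E n).rOut ⊆ s)
    (hz : Metric.ball z (shrinkingBump E n).rOut ⊆ s) :
    |mollify μ n f y - mollify μ n f z| ≤ C * ‖y - z‖ := by
  set η := shrinkingBump E n
  have hint : ∀ x, Integrable (fun t => η.normed μ t * f (x - t)) μ := fun x =>
    η.hasCompactSupport_normed.convolutionExists_left (lsmul ℝ ℝ) η.continuous_normed hf x
  rw [mollify_apply, mollify_apply, ← integral_sub (hint y) (hint z)]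
  simp_rw [← mul_sub]
  refine abs_integral_bump_mul_le n fun t ht => ?_
  have h1 : ∀ x, x - t ∈ Metric.ball x η.rOut := fun x => by
    simpa [dist_eq_norm] using ht
  refine (hC _ (hy (h1 y)) _ (hz (h1 z))).trans (le_of_eq ?_)
  congr 2
  abel

/-- The weak equation is tested with the reflected kernel centred at `x`. The condition on the
closed ball keeps its support inside Ω. -/
lemma laplacian_mollify {n : ℕ} {Ω : Set E} {u f : E → ℝ} (hu : LocallyIntegrable u μ)
    (hweak : ∀ ψ : E → ℝ, ContDiff ℝ ∞ ψ → HasCompactSupport ψ → tsupport ψ ⊆ Ω →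
      ∫ y, u y * Δ ψ y ∂μ = -∫ y, f y * ψ y ∂μ)
    {x : E} (hx : Metric.closedBall x (shrinkingBump E n).rOut ⊆ Ω) :
    Δ (mollify μ n u) x = -mollify μ n f x := by
  set η := shrinkingBump E n
  have hη : ContDiff ℝ ∞ (η.normed μ) := η.contDiff_normed
  set ψ : E → ℝ := fun y => η.normed μ (x - y) with hψ
  have hts : tsupport ψ ⊆ Metric.closedBall x η.rOut := by
    refine closure_minimal (fun y hy => ?_) Metric.isClosed_closedBall
    have : x - y ∈ Function.support (η.normed μ) := hy
    rw [η.support_normed_eq] at this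
    rw [Metric.mem_closedBall, dist_comm, dist_eq_norm]
    simpa using (mem_ball_zero_iff.1 this).le
  have hψc : ContDiff ℝ ∞ ψ := hη.comp (contDiff_const.sub contDiff_id)
  have hψs : HasCompactSupport ψ :=
    (isCompact_closedBall x η.rOut).of_isClosed_subset (isClosed_tsupport ψ) hts
  have hw := hweak ψ hψc hψs (hts.trans hx)
  have hlap : ∀ y, Δ ψ y = Δ (η.normed μ) (x - y) := by
    intro y
    have h2 : ContDiff ℝ 2 (η.normed μ) := hη.of_le ENat.LEInfty.out
    have := laplacian_comp_isometry (LinearIsometryEquiv.neg ℝ) (f := η.normed μ) (c := x) (x := y)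
      h2.contDiffAt
    simpa [hψ, sub_eq_add_neg] using this
  rw [mollify, laplacian_convolution hη η.hasCompactSupport_normed hu]
  simp_rw [hlap] at hw
  rw [hw, mollify, convolution_eq_swap]
  simp [hψ, mul_comm, η]

lemma eventually_rOut_lt {r : ℝ} (hr : 0 < r) : ∃ n₀ : ℕ, ∀ n ≥ n₀, (shrinkingBump E n).rOut < r :=
  eventually_atTop.1 (tendsto_shrinkingBump_rOut.eventually (gt_mem_nhds hr))

/-- Bounded weak solutions of `-Δ u = f`, `f` bounded, are locally Lipschitz. -/
lemma exists_locally_lipschitz_rep {Ω : Set E} (hΩ : IsOpen Ω) {u f : E → ℝ} {M B : ℝ}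
    (hu : LocallyIntegrable u μ) (hM : ∀ y, |u y| ≤ M) (hB : ∀ y, |f y| ≤ B)
    (hweak : ∀ ψ : E → ℝ, ContDiff ℝ ∞ ψ → HasCompactSupport ψ → tsupport ψ ⊆ Ω →
      ∫ y, u y * Δ ψ y ∂μ = -∫ y, f y * ψ y ∂μ) :
    ∃ w : E → ℝ, u =ᵐ[μ] w ∧ ∀ x ∈ Ω, ∃ r > 0, ∃ C ≥ 0, Metric.ball x r ⊆ Ω ∧
      ∀ p ∈ Metric.ball x r, ∀ q ∈ Metric.ball x r, |w p - w q| ≤ C * ‖p - q‖ := by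
  have hae : ∀ᵐ x ∂μ, Tendsto (fun n => mollify μ n u x) atTop (𝓝 (u x)) := by
    -- The outer radius of the bumps is exactly twice the inner one; this fixed ratio is what a.e.
    -- convergence requires.
    refine ContDiffBump.ae_convolution_tendsto_right_of_locallyIntegrable (K := 2)
      tendsto_shrinkingBump_rOut (Eventually.of_forall fun n => ?_) hu
    simp only [shrinkingBump]
    have : (0 : ℝ) < (n : ℝ) + 1 := by positivity
    apply le_of_eq
    field_simp
  have hdense := Measure.dense_of_ae hae
  have hloc : ∀ x ∈ Ω, ∃ r > 0, ∃ C ≥ 0, Metric.ball x r ⊆ Ω ∧ ∃ n₀ : ℕ, ∀ n ≥ n₀,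
      ∀ p ∈ Metric.ball x r, ∀ q ∈ Metric.ball x r,
        |mollify μ n u p - mollify μ n u q| ≤ C * ‖p - q‖ := by
    intro x hx
    obtain ⟨R, hR, hRΩ⟩ := Metric.isOpen_iff.1 hΩ x hx
    set r := R / 4 with hr
    have hr0 : 0 < r := by positivity
    obtain ⟨n₀, hn₀⟩ := eventually_rOut_lt (E := E) hr0
    have hM0 : 0 ≤ M := (abs_nonneg _).trans (hM x)
    have hB0 : 0 ≤ B := (abs_nonneg _).trans (hB x)
    refine ⟨r, hr0, Module.finrank ℝ E * M / r + B * r / 2, by positivity,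
      (Metric.ball_subset_ball (by linarith)).trans hRΩ, n₀, fun n hn p hp q hq => ?_⟩
    have hsmooth := contDiff_mollify n hu
    have h2 : ContDiff ℝ 2 (mollify μ n u) := hsmooth.of_le ENat.LEInfty.out
    have := (convex_ball x r).norm_image_sub_le_of_norm_fderiv_le (𝕜 := ℝ) (f := mollify μ n u)
      (C := Module.finrank ℝ E * M / r + B * r / 2) (x := q) (y := p)
      (fun y _ => hsmooth.differentiable (by simp) y) (fun y hy => ?_) hq hp
    · simpa using this
    · refine norm_fderiv_le_of_laplacian_bound hr0 (fun z _ => h2.contDiffAt)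
        (fun z _ => abs_mollify_le hM) fun z hz => ?_
      rw [laplacian_mollify hu hweak, norm_neg]
      · exact abs_mollify_le hB
      · refine Subset.trans (fun t ht => ?_) hRΩ
        have h1 := dist_triangle t z x
        have h2 := dist_triangle z y x
        have h3 := Metric.mem_closedBall.1 hz
        have h4 := Metric.mem_ball.1 hy
        have h5 := Metric.mem_closedBall.1 ht
        have h6 := hn₀ n hn
        rw [Metric.mem_ball]; linarith
  have hconv : ∀ x ∈ Ω, ∃ l, Tendsto (fun n => mollify μ n u x) atTop (𝓝 l) := by
    intro x hx
    obtain ⟨r, hr, C, hC, -, n₀, hn₀⟩ := hloc x hx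
    refine cauchySeq_tendsto_of_complete (Metric.cauchySeq_iff'.2 fun ε hε => ?_)
    set δ := min r (ε / (4 * (C + 1))) with hδ
    have hδ0 : 0 < δ := by positivity
    -- Convergence is known on a dense set, and the common Lipschitz bound carries it from a nearby
    -- y to x.
    obtain ⟨y, hyd, hy⟩ := hdense.exists_dist_lt x hδ0
    have hy' : y ∈ Metric.ball x r := by
      rw [Metric.mem_ball, dist_comm]; exact hy.trans_le (min_le_left _ _)
    have hCδ : C * ‖x - y‖ ≤ ε / 4 := by
      calc C * ‖x - y‖ ≤ (C + 1) * (ε / (4 * (C + 1))) := by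
            gcongr
            · linarith
            · rw [← dist_eq_norm]; exact hy.le.trans (min_le_right _ _)
        _ = ε / 4 := by field_simp
    obtain ⟨N', hN'⟩ := Metric.cauchySeq_iff.1 (Tendsto.cauchySeq hyd) (ε / 2) (by positivity)
    refine ⟨max n₀ N', fun n hn => ?_⟩
    have h1 := hn₀ n (le_trans (le_max_left _ _) hn) x (Metric.mem_ball_self hr) y hy'
    have h2 := hn₀ (max n₀ N') (le_max_left _ _) x (Metric.mem_ball_self hr) y hy'
    have h3 := hN' n (le_trans (le_max_right _ _) hn) (max n₀ N') (le_max_right _ _)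
    rw [Real.dist_eq] at h3 ⊢
    have := abs_le.1 h1
    have := abs_le.1 h2
    have := abs_lt.1 h3
    rw [abs_lt]; constructor <;> linarith
  classical
  refine ⟨fun x => if x ∈ Ω then limUnder atTop fun n => mollify μ n u x else u x, ?_, ?_⟩
  · filter_upwards [hae] with x hx
    by_cases h : x ∈ Ω
    · simp only [h, if_true]; exact hx.limUnder_eq.symm
    · simp [h]
  · intro x hx
    obtain ⟨r, hr, C, hC, hrΩ, n₀, hn₀⟩ := hloc x hx
    refine ⟨r, hr, C, hC, hrΩ, fun p hp q hq => ?_⟩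
    simp only [hrΩ hp, hrΩ hq, if_true]
    have hp' := tendsto_nhds_limUnder (hconv p (hrΩ hp))
    have hq' := tendsto_nhds_limUnder (hconv q (hrΩ hq))
    refine le_of_tendsto (hp'.sub hq').abs ?_
    filter_upwards [eventually_ge_atTop n₀] with n hn using hn₀ n hn p hp q hq

/-- Interior regularity for bounded weak solutions of `-Δ u = γ(u)`, `γ` Lipschitz. -/
theorem exists_classical_rep {Ω : Set E} (hΩ : IsOpen Ω) {u : E → ℝ} {M : ℝ} {γ : ℝ → ℝ} {K : ℝ}
    (hu : LocallyIntegrable u μ) (hM : ∀ y, |u y| ≤ M) (hK : 0 ≤ K)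
    (hγ : ∀ s t, |γ s - γ t| ≤ K * |s - t|)
    (hweak : ∀ ψ : E → ℝ, ContDiff ℝ ∞ ψ → HasCompactSupport ψ → tsupport ψ ⊆ Ω →
      ∫ y, u y * Δ ψ y ∂μ = -∫ y, γ (u y) * ψ y ∂μ) :
    ∃ w : E → ℝ, u =ᵐ[μ] w ∧ ∀ x ∈ Ω, ContDiffAt ℝ 2 w x ∧ Δ w x = -γ (w x) := by
  set B := |γ 0| + K * M with hB
  have hγB : ∀ t, |t| ≤ M → |γ t| ≤ B := by
    intro t ht
    have h1 := hγ t 0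
    rw [sub_zero] at h1
    have h2 : K * |t| ≤ K * M := by gcongr
    have h3 := abs_sub_abs_le_abs_sub (γ t) (γ 0)
    linarith
  have hγc : Continuous γ :=
    (LipschitzWith.of_dist_le_mul (K := ⟨K, hK⟩) fun s t => by
      rw [Real.dist_eq, Real.dist_eq]; exact hγ s t).continuous
  obtain ⟨w, huw, hw⟩ := exists_locally_lipschitz_rep hΩ hu hM (fun y => hγB _ (hM y)) hweak
  have hf : LocallyIntegrable (fun y => γ (u y)) μ := by
    have h0 : LocallyIntegrable (fun _ : E => B) μ := locallyIntegrable_const B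
    refine h0.mono (hγc.comp_aestronglyMeasurable hu.aestronglyMeasurable)
      (Eventually.of_forall fun y => ?_)
    exact (hγB _ (hM y)).trans (le_abs_self B)
  have hcw : ∀ n, mollify μ n u = mollify μ n w := fun n => convolution_congr _ .rfl huw
  have hcf : ∀ n, mollify μ n (fun y => γ (u y)) = mollify μ n (fun y => γ (w y)) := fun n =>
    convolution_congr _ .rfl (huw.mono fun y hy => by simp only [hy])
  have hfw : LocallyIntegrable (fun y => γ (w y)) μ :=
    hf.congr (huw.mono fun y hy => by simp only [hy])
  have hwm : AEStronglyMeasurable w μ := hu.aestronglyMeasurable.congr huw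
  refine ⟨w, huw, fun x hx => ?_⟩
  obtain ⟨R, hR, C, hC, hRΩ, hlip⟩ := hw x hx
  -- A ball of radius 8ρ enlarged by a mollification radius below ρ still fits in the ball of radius
  -- R = 16ρ where w is Lipschitz.
  set ρ := R / 16 with hρ
  have hρ0 : 0 < ρ := by positivity
  obtain ⟨n₀, hn₀⟩ := eventually_rOut_lt (E := E) hρ0
  have hsubR : ∀ n ≥ n₀, ∀ y ∈ Metric.ball x (8 * ρ),
      Metric.closedBall y (shrinkingBump E n).rOut ⊆ Metric.ball x R := by
    intro n hn y hy t ht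
    have h1 := dist_triangle t y x
    have h4 := Metric.mem_ball.1 hy
    have h5 := Metric.mem_closedBall.1 ht
    have h6 := hn₀ n hn
    rw [Metric.mem_ball]; linarith
  have hγlip : ∀ p ∈ Metric.ball x R, ∀ q ∈ Metric.ball x R,
      |γ (w p) - γ (w q)| ≤ K * C * ‖p - q‖ := fun p hp q hq => by
    refine (hγ _ _).trans ?_
    rw [mul_assoc]
    exact mul_le_mul_of_nonneg_left (hlip p hp q hq) hK
  have happrox : ∀ {h : E → ℝ} {D : ℝ}, 0 ≤ D → AEStronglyMeasurable h μ →
      (∀ p ∈ Metric.ball x R, ∀ q ∈ Metric.ball x R, |h p - h q| ≤ D * ‖p - q‖) →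
      ∀ n ≥ n₀, ∀ y ∈ Metric.ball x (8 * ρ),
        dist (mollify μ n h y) (h y) ≤ D * (shrinkingBump E n).rOut := by
    intro h D hD hhm hh n hn y hy
    refine ContDiffBump.dist_normed_convolution_le hhm fun t ht => ?_
    refine (hh t ?_ y ?_).trans ?_
    · exact hsubR n hn y hy (Metric.ball_subset_closedBall ht)
    · exact hsubR n hn y hy (Metric.mem_closedBall_self (shrinkingBump E n).rOut_pos.le)
    · rw [← dist_eq_norm]
      exact mul_le_mul_of_nonneg_left (Metric.mem_ball.1 ht).le hD
  have hlapf : ∀ n ≥ n₀, ∀ y ∈ Metric.ball x (8 * ρ),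
      Δ (mollify μ n u) y = -mollify μ n (fun y => γ (w y)) y := fun n hn y hy => by
    rw [laplacian_mollify hu hweak ((hsubR n hn y hy).trans hRΩ), hcf]
  have hsub8 : Metric.ball x (4 * ρ) ⊆ Metric.ball x (8 * ρ) :=
    Metric.ball_subset_ball (by linarith)
  refine contDiffAt_two_of_laplacian_bound (v := fun n => mollify μ (n + n₀) u) (ρ := ρ) (B := B)
    (L := K * C) hρ0 (fun n => contDiff_mollify _ hu) ?_ ?_ ?_ ?_
  · rw [Metric.tendstoUniformlyOn_iff]
    intro ε hε
    have h0 : Tendsto (fun n => C * (shrinkingBump E (n + n₀)).rOut) atTop (𝓝 0) := by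
      simpa using ((tendsto_add_atTop_iff_nat n₀).2 tendsto_shrinkingBump_rOut).const_mul C
    filter_upwards [h0.eventually (gt_mem_nhds hε)] with n hn y hy
    rw [dist_comm, hcw]
    exact (happrox hC hwm hlip _ (by omega) y (hsub8 hy)).trans_lt hn
  · intro n y hy
    rw [laplacian_mollify hu hweak ((hsubR _ (by omega) y (hsub8 hy)).trans hRΩ), norm_neg]
    exact abs_mollify_le fun y => hγB _ (hM y)
  · intro n y hy
    refine norm_fderiv_le_of_lipschitzOn (𝕜 := ℝ) (C := ⟨K * C, by positivity⟩)
      (Metric.isOpen_ball.mem_nhds (hsub8 hy)) (LipschitzOnWith.of_dist_le_mul ?_)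
    intro p hp q hq
    rw [hlapf _ (by omega) p hp, hlapf _ (by omega) q hq, dist_neg_neg, Real.dist_eq, dist_eq_norm]
    exact abs_mollify_sub_le hfw hγlip
      (Metric.ball_subset_closedBall.trans (hsubR _ (by omega) p hp))
      (Metric.ball_subset_closedBall.trans (hsubR _ (by omega) q hq))
  · have hx8 : x ∈ Metric.ball x (8 * ρ) := Metric.mem_ball_self (by positivity)
    have h1 : Tendsto (fun n => mollify μ (n + n₀) (fun y => γ (w y)) x) atTop (𝓝 (γ (w x))) := by
      rw [tendsto_iff_dist_tendsto_zero]
      refine squeeze_zero (fun _ => dist_nonneg)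
        (fun n => happrox (by positivity) hfw.aestronglyMeasurable hγlip (n + n₀) (by omega) x hx8)
        ?_
      simpa using ((tendsto_add_atTop_iff_nat n₀).2 tendsto_shrinkingBump_rOut).const_mul (K * C)
    exact h1.neg.congr fun n => (hlapf _ (by omega) x hx8).symm

end Regularity

/-! ### Poincaré and Rellich arguments in L¹ -/

section Compactness

variable {E : Type*} [NormedAddCommGroup E] [InnerProductSpace ℝ E] [FiniteDimensional ℝ E]
  [MeasurableSpace E] [BorelSpace E] {μ : Measure E} [μ.IsAddHaarMeasure]

open scoped Convolution
open ContinuousLinearMap (lsmul)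

/-- The increment is the integral of the derivative along the segment; Tonelli and translation
invariance do the rest. -/
lemma lintegral_translate_sub_le {φ : E → ℝ} (hφ : ContDiff ℝ 1 φ) (t : E) :
    ∫⁻ x, ‖φ (x - t) - φ x‖ₑ ∂μ ≤ ‖t‖ₑ * ∫⁻ x, ‖fderiv ℝ φ x‖ₑ ∂μ := by
  have hd : Continuous (fderiv ℝ φ) := hφ.continuous_fderiv (by simp)
  have h1 : ∀ x, ‖φ (x - t) - φ x‖ₑ
      ≤ ∫⁻ s in Ioc (0 : ℝ) 1, ‖t‖ₑ * ‖fderiv ℝ φ (x - s • t)‖ₑ := by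
    intro x
    have hder : ∀ s : ℝ, HasDerivAt (fun s : ℝ => φ (x - s • t)) (-fderiv ℝ φ (x - s • t) t) s := by
      intro s
      have hl : HasDerivAt (fun s : ℝ => x - s • t) (-t) s := by
        simpa using ((hasDerivAt_id s).smul_const t).const_sub x
      have := ((hφ.differentiable (by simp)) (x - s • t)).hasFDerivAt.comp_hasDerivAt s hl
      exact this.congr_deriv (by simp)
    have hcd : Continuous fun s : ℝ => -fderiv ℝ φ (x - s • t) t := by fun_prop
    have := intervalIntegral.integral_eq_sub_of_hasDerivAt (a := 0) (b := 1)
      (fun s _ => hder s) (hcd.intervalIntegrable 0 1)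
    simp only [one_smul, zero_smul, sub_zero] at this
    rw [← this, intervalIntegral.integral_of_le zero_le_one]
    refine (enorm_integral_le_lintegral_enorm _).trans (lintegral_mono fun s => ?_)
    rw [enorm_neg, mul_comm]
    exact ContinuousLinearMap.le_opENorm _ _
  calc ∫⁻ x, ‖φ (x - t) - φ x‖ₑ ∂μ
      ≤ ∫⁻ x, (∫⁻ s in Ioc (0 : ℝ) 1, ‖t‖ₑ * ‖fderiv ℝ φ (x - s • t)‖ₑ) ∂μ :=
        lintegral_mono h1
    _ = ∫⁻ s in Ioc (0 : ℝ) 1, ∫⁻ x, ‖t‖ₑ * ‖fderiv ℝ φ (x - s • t)‖ₑ ∂μ := by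
        refine lintegral_lintegral_swap (Continuous.measurable ?_).aemeasurable
        simp only [Function.uncurry_def]
        refine ENNReal.continuous_const_mul (by simp) |>.comp ?_
        exact (hd.comp (by fun_prop)).enorm
    _ = ∫⁻ s in Ioc (0 : ℝ) 1, ‖t‖ₑ * ∫⁻ x, ‖fderiv ℝ φ x‖ₑ ∂μ := by
        refine lintegral_congr fun s => ?_
        rw [lintegral_const_mul' _ _ (by simp),
          lintegral_sub_right_eq_self (fun x => ‖fderiv ℝ φ x‖ₑ)]
    _ = ‖t‖ₑ * ∫⁻ x, ‖fderiv ℝ φ x‖ₑ ∂μ := by simp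

/-- Poincaré's inequality in `L¹`. -/
lemma lintegral_le_of_subset_ball {φ : E → ℝ} (hφ : ContDiff ℝ 1 φ) {R : ℝ}
    (hs : Function.support φ ⊆ Metric.ball 0 R) {t : E} (ht : 2 * R ≤ ‖t‖) :
    ∫⁻ x, ‖φ x‖ₑ ∂μ ≤ ‖t‖ₑ * ∫⁻ x, ‖fderiv ℝ φ x‖ₑ ∂μ := by
  refine (lintegral_mono fun x => ?_).trans (lintegral_translate_sub_le hφ t)
  by_cases hx0 : φ x = 0
  · simp [hx0]
  · have hx := hs hx0
    have : φ (x - t) = 0 := by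
      by_contra h
      have h1 := mem_ball_zero_iff.1 (hs h)
      have h2 := mem_ball_zero_iff.1 hx
      have h3 := norm_sub_norm_le t x
      rw [norm_sub_rev] at h3
      linarith
    simp [this]

/-- The mollification averages translates by vectors shorter than the outer radius. The resulting
rate depends on φ only through its gradient, which makes it uniform along the sequence. -/
lemma lintegral_mollify_sub_le {φ : E → ℝ} (hφ : ContDiff ℝ 1 φ) (n : ℕ) :
    ∫⁻ x, ‖mollify μ n φ x - φ x‖ₑ ∂μ
      ≤ ENNReal.ofReal (shrinkingBump E n).rOut * ∫⁻ x, ‖fderiv ℝ φ x‖ₑ ∂μ := by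
  set η := shrinkingBump E n
  have hc := hφ.continuous
  have h1 : ∀ x, ‖mollify μ n φ x - φ x‖ₑ
      ≤ ∫⁻ t, ‖η.normed μ t‖ₑ * ‖φ (x - t) - φ x‖ₑ ∂μ := by
    intro x
    have hint : Integrable (fun t => η.normed μ t * φ (x - t)) μ :=
      η.hasCompactSupport_normed.convolutionExists_left (lsmul ℝ ℝ) η.continuous_normed
        hc.locallyIntegrable x
    have h2 : φ x = ∫ t, η.normed μ t * φ x ∂μ := by
      rw [integral_mul_const, η.integral_normed, one_mul]
    have h3 : mollify μ n φ x - φ x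
        = ∫ t, (η.normed μ t * φ (x - t) - η.normed μ t * φ x) ∂μ := by
      rw [integral_sub hint (η.integrable_normed.mul_const _), ← h2, mollify_apply]
    rw [h3]
    refine (enorm_integral_le_lintegral_enorm _).trans (le_of_eq (lintegral_congr fun t => ?_))
    rw [← mul_sub, enorm_mul]
  calc ∫⁻ x, ‖mollify μ n φ x - φ x‖ₑ ∂μ
      ≤ ∫⁻ x, ∫⁻ t, ‖η.normed μ t‖ₑ * ‖φ (x - t) - φ x‖ₑ ∂μ ∂μ := lintegral_mono h1
    _ = ∫⁻ t, ∫⁻ x, ‖η.normed μ t‖ₑ * ‖φ (x - t) - φ x‖ₑ ∂μ ∂μ := by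
        refine lintegral_lintegral_swap (Measurable.aemeasurable ?_)
        simp only [Function.uncurry_def]
        have m1 : Continuous fun p : E × E => η.normed μ p.2 := η.continuous_normed.comp continuous_snd
        have m2 : Continuous fun p : E × E => φ (p.1 - p.2) - φ p.1 := by fun_prop
        exact m1.enorm.measurable.mul m2.enorm.measurable
    _ ≤ ∫⁻ t, ‖η.normed μ t‖ₑ * (ENNReal.ofReal η.rOut * ∫⁻ x, ‖fderiv ℝ φ x‖ₑ ∂μ) ∂μ := by
        refine lintegral_mono fun t => ?_
        rw [lintegral_const_mul' _ _ (by simp)]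
        by_cases ht : t ∈ Metric.ball (0 : E) η.rOut
        · gcongr
          refine (lintegral_translate_sub_le hφ t).trans ?_
          gcongr
          rw [← ofReal_norm]
          exact ENNReal.ofReal_le_ofReal (mem_ball_zero_iff.1 ht).le
        · have : η.normed μ t = 0 := by
            rw [← Function.notMem_support, η.support_normed_eq]; exact ht
          simp [this]
    _ = _ := by
        rw [lintegral_mul_const _ η.continuous_normed.enorm.measurable,
          lintegral_enorm_of_nonneg η.nonneg_normed,
          ← ofReal_integral_eq_lintegral_ofReal η.integrable_normed
            (Eventually.of_forall η.nonneg_normed), η.integral_normed]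
        simp

/-- The kernel is Lipschitz and is integrated against a function bounded by M on a ball of radius R.
The constant depends on the scale `n` but not on φ. -/
lemma exists_lipschitz_mollify (n : ℕ) (M R : ℝ) (hM : 0 ≤ M) : ∃ C, 0 ≤ C ∧ ∀ φ : E → ℝ, Continuous φ →
    Function.support φ ⊆ Metric.ball 0 R → (∀ x, |φ x| ≤ M) →
    ∀ y z, |mollify μ n φ y - mollify μ n φ z| ≤ C * ‖y - z‖ := by
  set η := shrinkingBump E n
  obtain ⟨K, hK⟩ := ContDiff.lipschitzWith_of_hasCompactSupport (𝕂 := ℝ)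
    (η.hasCompactSupport_normed (μ := μ)) (η.contDiff_normed (μ := μ) (n := 1)) (by simp)
  refine ⟨M * K * μ.real (Metric.ball 0 R), by positivity, fun φ hφ hs hb y z => ?_⟩
  have hint : ∀ x, Integrable (fun t => φ t * η.normed μ (x - t)) μ := fun x => by
    have := ((η.hasCompactSupport_normed (μ := μ)).convolutionExists_left (lsmul ℝ ℝ)
      η.continuous_normed (hφ.locallyIntegrable (μ := μ)) x).integrable_swap
    simpa [mul_comm] using this
  have heq : ∀ x, mollify μ n φ x = ∫ t, φ t * η.normed μ (x - t) ∂μ := fun x => by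
    rw [mollify, convolution_eq_swap]
    simp [mul_comm, η]
  rw [heq, heq, ← integral_sub (hint y) (hint z)]
  have hfin : μ (Metric.ball (0 : E) R) < ⊤ := measure_ball_lt_top
  have h1 : ∫ t, (φ t * η.normed μ (y - t) - φ t * η.normed μ (z - t)) ∂μ
      = ∫ t in Metric.ball 0 R, (φ t * η.normed μ (y - t) - φ t * η.normed μ (z - t)) ∂μ := by
    rw [setIntegral_eq_integral_of_forall_compl_eq_zero]
    intro x hx
    have : φ x = 0 := by by_contra h; exact hx (hs h)
    simp [this]
  rw [h1]
  have := norm_setIntegral_le_of_norm_le_const (μ := μ) (s := Metric.ball (0 : E) R)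
    (f := fun t => φ t * η.normed μ (y - t) - φ t * η.normed μ (z - t))
    (C := M * (K * ‖y - z‖)) hfin (fun t _ => ?_)
  · rw [Real.norm_eq_abs] at this
    refine this.trans (le_of_eq (by ring))
  · rw [← mul_sub, norm_mul]
    refine mul_le_mul (hb t) ?_ (norm_nonneg _) hM
    have := hK.dist_le_mul (y - t) (z - t)
    simpa [dist_eq_norm] using this

/-- A form of the Rellich compactness theorem for uniformly bounded functions. -/
theorem exists_subseq_tendsto_ae {φ : ℕ → E → ℝ} {M R : ℝ} {D : ℝ≥0∞} (hD : D ≠ ⊤)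
    (hφ : ∀ k, ContDiff ℝ 1 (φ k)) (hs : ∀ k, Function.support (φ k) ⊆ Metric.ball 0 R)
    (hM : ∀ k x, |φ k x| ≤ M) (hgrad : ∀ k, ∫⁻ x, ‖fderiv ℝ (φ k) x‖ₑ ∂μ ≤ D) :
    ∃ ns : ℕ → ℕ, StrictMono ns ∧ ∃ u : E → ℝ, ∀ᵐ x ∂μ,
      Tendsto (fun k => φ (ns k) x) atTop (𝓝 (u x)) := by
  have hM0 : 0 ≤ M := (abs_nonneg _).trans (hM 0 0)
  -- Compactness of a countable product of intervals replaces a diagonal extraction: one subsequence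
  -- works at all scales and at all points of a dense sequence.
  obtain ⟨a, -, ns, hns, ha⟩ := IsCompact.tendsto_subseq
    (isCompact_univ_pi fun _ : ℕ × ℕ => isCompact_Icc (a := -M) (b := M))
    (x := fun k p => mollify μ p.1 (φ k) (TopologicalSpace.denseSeq E p.2))
    (fun k p _ => abs_le.1 (abs_mollify_le (hM k)))
  rw [tendsto_pi_nhds] at ha
  -- pointwise convergence of the mollifications
  have hptw : ∀ n x, ∃ l, Tendsto (fun k => mollify μ n (φ (ns k)) x) atTop (𝓝 l) := by
    intro n x
    obtain ⟨C, hC, hlip⟩ := exists_lipschitz_mollify (μ := μ) n M R hM0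
    refine cauchySeq_tendsto_of_complete (Metric.cauchySeq_iff'.2 fun ε hε => ?_)
    obtain ⟨j, hj⟩ := (TopologicalSpace.denseRange_denseSeq E).exists_dist_lt x
      (show 0 < ε / (4 * (C + 1)) by positivity)
    set y := TopologicalSpace.denseSeq E j
    have hCd : C * ‖x - y‖ ≤ ε / 4 := by
      calc C * ‖x - y‖ ≤ (C + 1) * (ε / (4 * (C + 1))) := by
            gcongr
            · linarith
            · rw [← dist_eq_norm]; exact hj.le
        _ = ε / 4 := by field_simp
    obtain ⟨N, hN⟩ := Metric.cauchySeq_iff'.1 (Tendsto.cauchySeq (ha (n, j))) (ε / 2)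
      (by positivity)
    refine ⟨N, fun k hk => ?_⟩
    have h1 := abs_le.1 (hlip (φ (ns k)) (hφ _).continuous (hs _) (hM _) x y)
    have h2 := abs_le.1 (hlip (φ (ns N)) (hφ _).continuous (hs _) (hM _) x y)
    have h3 := hN k hk
    rw [Real.dist_eq] at h3 ⊢
    have := abs_lt.1 h3
    simp only [Function.comp_apply] at this
    rw [abs_lt]; constructor <;> linarith
  choose l hl using hptw
  -- `L¹` convergence of the mollifications
  have hL1 : ∀ n, Tendsto (fun k => ∫⁻ x, ‖mollify μ n (φ (ns k)) x - l n x‖ₑ ∂μ) atTop (𝓝 0) := by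
    intro n
    have hmeas : ∀ k, Measurable (mollify μ n (φ (ns k))) := fun k =>
      (contDiff_mollify n (hφ _).continuous.locallyIntegrable).continuous.measurable
    have hlm : Measurable (l n) := measurable_of_tendsto_metrizable hmeas (tendsto_pi_nhds.2 (hl n))
    -- Mollification radii are at most 1, so the ball of radius R + 1 contains all supports and the
    -- constant 2M on it dominates.
    have hzero : ∀ k x, x ∉ Metric.ball (0 : E) (R + 1) → mollify μ n (φ (ns k)) x = 0 := by
      intro k x hx
      rw [mollify_apply]
      refine integral_eq_zero_of_ae (Eventually.of_forall fun t => ?_)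
      by_cases ht : t ∈ Metric.ball (0 : E) (shrinkingBump E n).rOut
      · have : φ (ns k) (x - t) = 0 := by
          by_contra h
          have h1 := mem_ball_zero_iff.1 (hs _ h)
          have h2 := mem_ball_zero_iff.1 ht
          have h3 : (shrinkingBump E n).rOut ≤ 1 := by
            simp only [shrinkingBump]
            rw [div_le_one (by positivity)]
            linarith [Nat.cast_nonneg (α := ℝ) n]
          have h4 := norm_sub_norm_le x t
          rw [mem_ball_zero_iff] at hx
          linarith
        simp [this]
      · have : (shrinkingBump E n).normed μ t = 0 := by
          rw [← Function.notMem_support, (shrinkingBump E n).support_normed_eq]; exact ht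
        simp [this]
    have hlz : ∀ x, x ∉ Metric.ball (0 : E) (R + 1) → l n x = 0 := fun x hx =>
      tendsto_nhds_unique (hl n x) (by simp [hzero _ x hx])
    have hlM : ∀ x, |l n x| ≤ M := fun x =>
      le_of_tendsto (hl n x).abs (Eventually.of_forall fun k => abs_mollify_le (hM _))
    have := tendsto_lintegral_filter_of_dominated_convergence (μ := μ) (l := atTop)
      (F := fun k x => ‖mollify μ n (φ (ns k)) x - l n x‖ₑ) (f := fun _ => 0)
      ((Metric.ball (0 : E) (R + 1)).indicator fun _ => ENNReal.ofReal (2 * M))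
      (Eventually.of_forall fun k => ((hmeas k).sub hlm).enorm)
      (Eventually.of_forall fun k => Eventually.of_forall fun x => ?_) ?_
      (Eventually.of_forall fun x => ?_)
    · simpa using this
    · by_cases hx : x ∈ Metric.ball (0 : E) (R + 1)
      · rw [indicator_of_mem hx, ← ofReal_norm]
        refine ENNReal.ofReal_le_ofReal ((norm_sub_le _ _).trans ?_)
        have h1 := abs_mollify_le (μ := μ) (n := n) (x := x) (hM (ns k))
        have h2 := hlM x
        simp only [Real.norm_eq_abs]
        linarith
      · simp [hzero k x hx, hlz x hx]
    · rw [lintegral_indicator Metric.isOpen_ball.measurableSet, setLIntegral_const]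
      exact ENNReal.mul_ne_top ENNReal.ofReal_ne_top measure_ball_lt_top.ne
    · have := ((hl n x).sub_const (l n x)).enorm
      simpa using this
  -- the sequence is Cauchy in `L¹`
  have hmem : ∀ k, MemLp (φ (ns k)) 1 μ := fun k => by
    have hcs : HasCompactSupport (φ (ns k)) := HasCompactSupport.of_support_subset_isCompact
      (isCompact_closedBall (0 : E) R) ((hs _).trans Metric.ball_subset_closedBall)
    exact (hφ _).continuous.memLp_of_hasCompactSupport hcs
  have hcauchy : CauchySeq fun k => (hmem k).toLp (φ (ns k)) := by
    rw [EMetric.cauchySeq_iff]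
    intro ε hε
    have hsmall : Tendsto (fun n => ENNReal.ofReal (shrinkingBump E n).rOut * D) atTop (𝓝 0) := by
      have := ENNReal.Tendsto.mul_const (b := D)
        (ENNReal.tendsto_ofReal (tendsto_shrinkingBump_rOut (E := E))) (Or.inr hD)
      simpa using this
    have hε4 : 0 < ε / 4 := ENNReal.div_pos hε.ne' (by simp)
    -- The scale n is fixed first, uniformly in k by the gradient bound; only then is the index N
    -- chosen for that scale.
    obtain ⟨n, hn⟩ := (hsmall.eventually (gt_mem_nhds hε4)).exists
    obtain ⟨N, hN⟩ := eventually_atTop.1 ((hL1 n).eventually (gt_mem_nhds hε4))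
    have hmeas : ∀ k, Measurable (mollify μ n (φ (ns k))) := fun k =>
      (contDiff_mollify n (hφ _).continuous.locallyIntegrable).continuous.measurable
    have hlm : Measurable (l n) := measurable_of_tendsto_metrizable hmeas (tendsto_pi_nhds.2 (hl n))
    have hk : ∀ k ≥ N, ∫⁻ x, ‖φ (ns k) x - l n x‖ₑ ∂μ < ε / 2 := by
      intro k hk
      calc ∫⁻ x, ‖φ (ns k) x - l n x‖ₑ ∂μ
          ≤ ∫⁻ x, ‖mollify μ n (φ (ns k)) x - φ (ns k) x‖ₑ
              + ‖mollify μ n (φ (ns k)) x - l n x‖ₑ ∂μ := by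
            refine lintegral_mono fun x => ?_
            simp only [← edist_eq_enorm_sub]
            exact edist_triangle_left _ _ _
        _ = ∫⁻ x, ‖mollify μ n (φ (ns k)) x - φ (ns k) x‖ₑ ∂μ
              + ∫⁻ x, ‖mollify μ n (φ (ns k)) x - l n x‖ₑ ∂μ :=
            lintegral_add_left ((hmeas k).sub (hφ _).continuous.measurable).enorm _
        _ < ε / 4 + ε / 4 := by
            refine ENNReal.add_lt_add (lt_of_le_of_lt ?_ hn) (hN k hk)
            refine (lintegral_mollify_sub_le (hφ _) n).trans ?_
            gcongr
            exact hgrad _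
        _ = ε / 2 := by
            rw [← two_mul, ← mul_div_assoc, ENNReal.div_eq_inv_mul, ENNReal.div_eq_inv_mul,
              show (4 : ℝ≥0∞) = 2 * 2 by norm_num, ENNReal.mul_inv (by simp) (by simp), ← mul_assoc,
              mul_assoc (2⁻¹ : ℝ≥0∞), ENNReal.inv_mul_cancel (by simp) (by simp), mul_one]
    refine ⟨N, fun m hm k hk' => ?_⟩
    rw [Lp.edist_toLp_toLp, eLpNorm_one_eq_lintegral_enorm]
    calc ∫⁻ x, ‖(φ (ns m) - φ (ns k)) x‖ₑ ∂μ
        ≤ ∫⁻ x, ‖φ (ns m) x - l n x‖ₑ + ‖φ (ns k) x - l n x‖ₑ ∂μ := by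
          refine lintegral_mono fun x => ?_
          simp only [Pi.sub_apply, ← edist_eq_enorm_sub]
          exact edist_triangle_right _ _ _
      _ = ∫⁻ x, ‖φ (ns m) x - l n x‖ₑ ∂μ + ∫⁻ x, ‖φ (ns k) x - l n x‖ₑ ∂μ :=
          lintegral_add_left ((hφ _).continuous.measurable.sub hlm).enorm _
      _ < ε / 2 + ε / 2 := ENNReal.add_lt_add (hk m hm) (hk k hk')
      _ = ε := ENNReal.add_halves ε
  obtain ⟨U, hU⟩ := cauchySeq_tendsto_of_complete hcauchy
  obtain ⟨ms, hms, hlim⟩ := (tendstoInMeasure_of_tendsto_Lp hU).exists_seq_tendsto_ae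
  refine ⟨ns ∘ ms, hns.comp hms, U, ?_⟩
  have hall : ∀ᵐ x ∂μ, ∀ k, (hmem k).toLp (φ (ns k)) x = φ (ns k) x :=
    ae_all_iff.2 fun k => (hmem k).coeFn_toLp
  filter_upwards [hlim, hall] with x h1 h2
  simpa [h2] using h1

end Compactness

/-! ### Calculus and truncation of test functions -/

section TestFunctions

variable {N : ℕ} {Ω : Set (EuclideanSpace ℝ (Fin N))} {φ ψ : EuclideanSpace ℝ (Fin N) → ℝ}

local notation "𝔼" => EuclideanSpace ℝ (Fin N)

lemma gradient_add_apply {f h : 𝔼 → ℝ} {x : 𝔼} (hf : DifferentiableAt ℝ f x)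
    (hh : DifferentiableAt ℝ h x) :
    gradient (fun y => f y + h y) x = gradient f x + gradient h x := by
  simp only [gradient, fderiv_fun_add hf hh, map_add]

lemma gradient_const_mul {f : 𝔼 → ℝ} {x : 𝔼} (hf : DifferentiableAt ℝ f x) (c : ℝ) :
    gradient (fun y => c * f y) x = c • gradient f x := by
  simp only [gradient, fderiv_const_mul hf c, map_smul]

lemma norm_gradient (f : 𝔼 → ℝ) (x : 𝔼) : ‖gradient f x‖ = ‖fderiv ℝ f x‖ := by
  simp [gradient]

namespace IsTestFunction

lemma differentiable (h : IsTestFunction Ω φ) : Differentiable ℝ φ :=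
  h.1.differentiable (by simp)

lemma continuous (h : IsTestFunction Ω φ) : Continuous φ := h.1.continuous

lemma eq_zero (h : IsTestFunction Ω φ) {x : 𝔼} (hx : x ∉ Ω) : φ x = 0 :=
  image_eq_zero_of_notMem_tsupport fun hx' => hx (h.2.2 hx')

lemma add (h : IsTestFunction Ω φ) (h' : IsTestFunction Ω ψ) :
    IsTestFunction Ω fun x => φ x + ψ x :=
  ⟨h.1.add h'.1, h.2.1.add h'.2.1, (tsupport_add φ ψ).trans (union_subset h.2.2 h'.2.2)⟩

lemma const_mul (h : IsTestFunction Ω φ) (c : ℝ) : IsTestFunction Ω fun x => c * φ x :=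
  ⟨contDiff_const.mul h.1, h.2.1.mul_left (f := fun _ => c),
    (tsupport_mul_subset_right (f := fun _ => c)).trans h.2.2⟩

lemma comp_left (h : IsTestFunction Ω φ) {S : ℝ → ℝ} (hS : ContDiff ℝ ∞ S) (hS0 : S 0 = 0) :
    IsTestFunction Ω fun x => S (φ x) :=
  ⟨hS.comp h.1, h.2.1.comp_left hS0, (tsupport_comp_subset hS0 φ).trans h.2.2⟩

lemma fderiv_apply (h : IsTestFunction Ω φ) (e : 𝔼) : IsTestFunction Ω fun x => fderiv ℝ φ x e :=
  ⟨(h.1.fderiv_right (by simp)).clm_apply contDiff_const, h.2.1.fderiv_apply ℝ e,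
    (tsupport_fderiv_apply_subset ℝ e).trans h.2.2⟩

lemma continuous_gradient (h : IsTestFunction Ω φ) : Continuous (gradient φ) :=
  (InnerProductSpace.toDual ℝ 𝔼).symm.continuous.comp (h.1.continuous_fderiv (by simp))

lemma gradient_eq_zero (h : IsTestFunction Ω φ) {x : 𝔼} (hx : x ∉ Ω) : gradient φ x = 0 := by
  have : fderiv ℝ φ x = 0 := image_eq_zero_of_notMem_tsupport
    fun hx' => hx (h.2.2 (tsupport_fderiv_subset ℝ hx'))
  simp [gradient, this]

lemma hasCompactSupport_gradient (h : IsTestFunction Ω φ) : HasCompactSupport (gradient φ) :=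
  (h.2.1.fderiv ℝ).comp_left (g := (InnerProductSpace.toDual ℝ 𝔼).symm) (by simp)

lemma memLp (h : IsTestFunction Ω φ) (p : ℝ≥0∞) : MemLp φ p (volume.restrict Ω) :=
  (h.continuous.memLp_of_hasCompactSupport h.2.1).restrict Ω

lemma memLp_gradient (h : IsTestFunction Ω φ) (p : ℝ≥0∞) :
    MemLp (gradient φ) p (volume.restrict Ω) :=
  (h.continuous_gradient.memLp_of_hasCompactSupport h.hasCompactSupport_gradient).restrict Ω

/-- The gradient as an element of `L²(Ω)`. -/
noncomputable def gradLp (h : IsTestFunction Ω φ) : Lp 𝔼 2 (volume.restrict Ω) :=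
  (h.memLp_gradient 2).toLp _

lemma gradLp_add (h : IsTestFunction Ω φ) (h' : IsTestFunction Ω ψ) :
    (h.add h').gradLp = h.gradLp + h'.gradLp := by
  rw [gradLp, gradLp, gradLp, ← MemLp.toLp_add]
  congr 1
  ext1 x
  exact gradient_add_apply (h.differentiable x) (h'.differentiable x)

lemma gradLp_const_mul (h : IsTestFunction Ω φ) (c : ℝ) :
    (h.const_mul c).gradLp = c • h.gradLp := by
  rw [gradLp, gradLp, ← MemLp.toLp_const_smul]
  congr 1
  ext1 x
  exact gradient_const_mul (h.differentiable x) c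

end IsTestFunction

lemma norm_sq_toLp {F : Type*} [NormedAddCommGroup F] [InnerProductSpace ℝ F]
    {μ : Measure 𝔼} {f : 𝔼 → F} (hf : MemLp f 2 μ) :
    ‖hf.toLp f‖ ^ 2 = ∫ x, ‖f x‖ ^ 2 ∂μ := by
  rw [← real_inner_self_eq_norm_sq, L2.inner_def]
  refine integral_congr_ae ?_
  filter_upwards [hf.coeFn_toLp] with x hx
  rw [hx, real_inner_self_eq_norm_sq]

/-- Hölder on the finite-volume set Ω turns the L² control given by the energy into the L¹ control
used for compactness. -/
lemma IsTestFunction.lintegral_fderiv_le (h : IsTestFunction Ω φ) (hΩ : MeasurableSet Ω) :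
    ∫⁻ x, ‖fderiv ℝ φ x‖ₑ ≤ ‖h.gradLp‖ₑ * (volume Ω) ^ (1 / 2 : ℝ) := by
  have h1 : ∫⁻ x, ‖fderiv ℝ φ x‖ₑ = eLpNorm (gradient φ) 1 (volume.restrict Ω) := by
    rw [eLpNorm_one_eq_lintegral_enorm, ← lintegral_indicator hΩ]
    refine lintegral_congr fun x => ?_
    by_cases hx : x ∈ Ω
    · rw [indicator_of_mem hx, ← ofReal_norm, ← ofReal_norm, norm_gradient]
    · have := h.gradient_eq_zero hx
      rw [indicator_of_notMem hx, ← ofReal_norm, ← norm_gradient, this]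
      simp
  rw [h1, IsTestFunction.gradLp, Lp.enorm_toLp]
  have := eLpNorm_le_eLpNorm_mul_rpow_measure_univ (p := 1) (q := 2) (by norm_num)
    (h.memLp_gradient 2).1
  refine this.trans (le_of_eq ?_)
  norm_num

/-- Smooth approximation of Lipschitz functions on the line that does not increase the Lipschitz
constant. -/
lemma exists_smooth_lipschitz_approx {T : ℝ → ℝ} (hT : ∀ s t, |T s - T t| ≤ |s - t|) (hT0 : T 0 = 0)
    {ε : ℝ} (hε : 0 < ε) :
    ∃ S : ℝ → ℝ, ContDiff ℝ ∞ S ∧ S 0 = 0 ∧ (∀ s t, |S s - S t| ≤ |s - t|) ∧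
      ∀ s, |S s - T s| ≤ ε := by
  have hTc : Continuous T := (LipschitzWith.of_dist_le_mul (K := 1) fun s t => by
    simpa [Real.dist_eq] using hT s t).continuous
  -- Half of ε pays for mollifying T, the other half for subtracting the value at 0.
  obtain ⟨n, hn⟩ := eventually_rOut_lt (E := ℝ) (half_pos hε)
  have hn := (hn n le_rfl).le
  have hli := hTc.locallyIntegrable (μ := volume)
  have happ : ∀ s, |mollify volume n T s - T s| ≤ ε / 2 := fun s => by
    have := ContDiffBump.dist_normed_convolution_le (φ := shrinkingBump ℝ n) (μ := volume)
      (x₀ := s) (ε := ε / 2) hTc.aestronglyMeasurable fun t ht => by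
        rw [Real.dist_eq]
        exact (hT t s).trans ((Metric.mem_ball.1 ht).le.trans hn)
    rwa [Real.dist_eq] at this
  refine ⟨fun s => mollify volume n T s - mollify volume n T 0,
    (contDiff_mollify n hli).sub contDiff_const, by simp, fun s t => ?_, fun s => ?_⟩
  · have := abs_mollify_sub_le (n := n) hli (s := univ) (C := 1) (y := s) (z := t)
      (fun p _ q _ => by simpa using hT p q) (subset_univ _) (subset_univ _)
    simpa using this
  · have h1 := abs_le.1 (happ s)
    have h2 := abs_le.1 (happ 0)
    rw [hT0] at h2
    rw [abs_le]; constructor <;> linarith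

/-- Composing φ with a smoothed z ↦ min(|z|, a) preserves smoothness, and compact support because
the smoothing vanishes at 0. Its slope is at most 1 in absolute value, so the chain rule cannot
enlarge the gradient. -/
lemma IsTestFunction.exists_truncation (h : IsTestFunction Ω φ) {a : ℝ} (ha : 0 < a) {ε : ℝ}
    (hε : 0 < ε) : ∃ ψ : 𝔼 → ℝ, IsTestFunction Ω ψ ∧ (∀ x, |ψ x - min |φ x| a| ≤ ε) ∧
      ∀ x, ‖gradient ψ x‖ ≤ ‖gradient φ x‖ := by
  obtain ⟨S, hS, hS0, hS1, hS2⟩ := exists_smooth_lipschitz_approx (T := fun z => min |z| a)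
    (fun s t => by
      refine (abs_min_sub_min_le_max _ _ _ _).trans ?_
      simpa using abs_abs_sub_abs_le s t) (by simp [ha.le]) hε
  refine ⟨fun x => S (φ x), h.comp_left hS hS0, fun x => hS2 _, fun x => ?_⟩
  rw [norm_gradient, norm_gradient]
  have h1 := ((hS.differentiable (by simp)) (φ x)).hasDerivAt.comp_hasFDerivAt x
    (h.differentiable x).hasFDerivAt
  have h2 : ‖deriv S (φ x)‖ ≤ 1 := by
    have : LipschitzWith 1 S := LipschitzWith.of_dist_le_mul fun s t => by
      simpa [Real.dist_eq] using hS1 s t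
    simpa using norm_deriv_le_of_lipschitz (x₀ := φ x) this
  have h3 : fderiv ℝ (fun x => S (φ x)) x = deriv S (φ x) • fderiv ℝ φ x := h1.fderiv
  rw [h3, norm_smul]
  exact mul_le_of_le_one_left (norm_nonneg _) h2

lemma IsTestFunction.integral_mul_fderiv (h : IsTestFunction Ω φ) (h' : IsTestFunction Ω ψ)
    (e : 𝔼) : ∫ x in Ω, φ x * fderiv ℝ ψ x e = -∫ x in Ω, fderiv ℝ φ x e * ψ x := by
  rw [setIntegral_eq_integral_of_forall_compl_eq_zero fun x hx => by simp [h.eq_zero hx],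
    setIntegral_eq_integral_of_forall_compl_eq_zero fun x hx => by simp [h'.eq_zero hx]]
  refine integral_mul_fderiv_eq_neg_fderiv_mul_of_integrable ?_ ?_ ?_ (fun x _ => h.differentiable x)
    fun x _ => h'.differentiable x
  · exact ((h.fderiv_apply e).continuous.mul h'.continuous).integrable_of_hasCompactSupport
      h'.2.1.mul_left
  · exact (h.continuous.mul (h'.fderiv_apply e).continuous).integrable_of_hasCompactSupport
      h.2.1.mul_right
  · exact (h.continuous.mul h'.continuous).integrable_of_hasCompactSupport h.2.1.mul_right

end TestFunctions

/-! ### Truncated energy, continuity and H¹ limits -/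

section Minimization

variable {N : ℕ} {Ω : Set (EuclideanSpace ℝ (Fin N))}

local notation "𝔼" => EuclideanSpace ℝ (Fin N)

/-- `½ ∫_Ω |V|² - ∫_Ω Γ(u)`. -/
noncomputable def truncEnergy (Ω : Set 𝔼) (Γ : ℝ → ℝ) (u : 𝔼 → ℝ) (V : 𝔼 → 𝔼) : ℝ :=
  1 / 2 * (∫ x in Ω, ‖V x‖ ^ 2) - ∫ x in Ω, Γ (u x)

/-- A bounded potential `Γ` with derivative `γ`, constant under the truncation
`s ↦ min |s| a`. -/
structure TruncatedPotential (a : ℝ) (Γ γ : ℝ → ℝ) (B C K : ℝ) : Prop where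
  lip : ∀ s t, |Γ s - Γ t| ≤ B * |s - t|
  bdd : ∀ s, |Γ s| ≤ C
  trunc : ∀ s, Γ (min |s| a) = Γ s
  zero : Γ 0 = 0
  bdd_deriv : ∀ s, |γ s| ≤ B
  lip_deriv : ∀ s t, |γ s - γ t| ≤ K * |s - t|
  taylor : ∀ s h, Γ s + γ s * h - K * h ^ 2 ≤ Γ (s + h)

lemma continuous_of_abs_sub_le {f : ℝ → ℝ} {B : ℝ} (h : ∀ s t, |f s - f t| ≤ B * |s - t|) :
    Continuous f := by
  have hB : 0 ≤ B := by simpa using (abs_nonneg _).trans (h 1 0)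
  exact (LipschitzWith.of_dist_le_mul (K := ⟨B, hB⟩) fun s t => by
    rw [Real.dist_eq, Real.dist_eq]; exact h s t).continuous

lemma integrable_comp_of_bounded {Γ : ℝ → ℝ} {C : ℝ} (hc : Continuous Γ) (hb : ∀ s, |Γ s| ≤ C)
    {μ : Measure 𝔼} [IsFiniteMeasure μ] {u : 𝔼 → ℝ} (hu : AEStronglyMeasurable u μ) :
    Integrable (fun x => Γ (u x)) μ :=
  Integrable.of_bound (hc.comp_aestronglyMeasurable hu) C (Eventually.of_forall fun _ => hb _)

lemma tendsto_toLp_of_eLpNorm {F : Type*} [NormedAddCommGroup F] {μ : Measure 𝔼} {f : 𝔼 → F}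
    {w : ℕ → 𝔼 → F} (hf : MemLp f 2 μ) (hw : ∀ k, MemLp (w k) 2 μ)
    (h : Tendsto (fun k => eLpNorm (fun x => f x - w k x) 2 μ) atTop (𝓝 0)) :
    Tendsto (fun k => (hw k).toLp (w k)) atTop (𝓝 (hf.toLp f)) := by
  rw [tendsto_iff_edist_tendsto_0]
  refine h.congr fun k => ?_
  rw [edist_comm, Lp.edist_toLp_toLp]
  rfl

lemma tendsto_integral_comp_of_eLpNorm {Γ : ℝ → ℝ} {B C : ℝ}
    (hl : ∀ s t, |Γ s - Γ t| ≤ B * |s - t|) (hb : ∀ s, |Γ s| ≤ C)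
    {μ : Measure 𝔼} [IsFiniteMeasure μ] {f : 𝔼 → ℝ}
    {w : ℕ → 𝔼 → ℝ} (hf : MemLp f 2 μ) (hw : ∀ k, MemLp (w k) 2 μ)
    (h : Tendsto (fun k => eLpNorm (fun x => f x - w k x) 2 μ) atTop (𝓝 0)) :
    Tendsto (fun k => ∫ x, Γ (w k x) ∂μ) atTop (𝓝 (∫ x, Γ (f x) ∂μ)) := by
  have hΓ := continuous_of_abs_sub_le hl
  refine tendsto_integral_of_L1 _ (hΓ.comp_aestronglyMeasurable hf.1)
    (Eventually.of_forall fun k => integrable_comp_of_bounded hΓ hb (hw k).1) ?_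
  set c : ℝ≥0∞ := ENNReal.ofReal B * μ univ ^ (1 / 2 : ℝ)
  have hc : c ≠ ⊤ := ENNReal.mul_ne_top ENNReal.ofReal_ne_top
    (ENNReal.rpow_ne_top_of_nonneg (by norm_num) (measure_ne_top _ _))
  have h0 : Tendsto (fun k => c * eLpNorm (fun x => f x - w k x) 2 μ) atTop (𝓝 0) := by
    simpa using ENNReal.Tendsto.const_mul h (Or.inr hc)
  refine tendsto_of_tendsto_of_tendsto_of_le_of_le tendsto_const_nhds h0 (fun _ => zero_le)
    fun k => ?_
  have h1 : eLpNorm (fun x => f x - w k x) 1 μ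
      ≤ eLpNorm (fun x => f x - w k x) 2 μ * μ univ ^ (1 / 2 : ℝ) := by
    refine (eLpNorm_le_eLpNorm_mul_rpow_measure_univ (p := 1) (q := 2) (by norm_num)
      (hf.1.sub (hw k).1)).trans (le_of_eq ?_)
    norm_num
    rfl
  calc ∫⁻ x, ‖Γ (w k x) - Γ (f x)‖ₑ ∂μ ≤ ∫⁻ x, ENNReal.ofReal B * ‖f x - w k x‖ₑ ∂μ := by
        refine lintegral_mono fun x => ?_
        have hB : 0 ≤ B := by simpa using (abs_nonneg _).trans (hl 1 0)
        rw [← ofReal_norm, ← ofReal_norm, ← ENNReal.ofReal_mul hB, Real.norm_eq_abs,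
          Real.norm_eq_abs, abs_sub_comm (f x)]
        exact ENNReal.ofReal_le_ofReal (hl _ _)
    _ = ENNReal.ofReal B * eLpNorm (fun x => f x - w k x) 1 μ := by
        rw [lintegral_const_mul' _ _ ENNReal.ofReal_ne_top, eLpNorm_one_eq_lintegral_enorm]
    _ ≤ _ := by
        refine (mul_le_mul_right h1 _).trans (le_of_eq ?_)
        simp only [c]; ring

lemma H10.exists_approx (v : H10 Ω) : ∃ φ : ℕ → 𝔼 → ℝ, (∀ k, IsTestFunction Ω (φ k)) ∧
    Tendsto (fun k => eLpNorm (fun x => v.toFun x - φ k x) 2 (volume.restrict Ω)) atTop (𝓝 0) ∧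
    Tendsto (fun k => eLpNorm (fun x => v.grad x - gradient (φ k) x) 2 (volume.restrict Ω))
      atTop (𝓝 0) := by
  have hpos : ∀ k : ℕ, (0 : ℝ≥0∞) < ((k : ℝ≥0∞) + 1)⁻¹ := fun k => by simp
  choose φ h1 h2 h3 using fun k : ℕ => v.mem_closure _ (hpos k)
  have h0 : Tendsto (fun k : ℕ => ((k : ℝ≥0∞) + 1)⁻¹) atTop (𝓝 0) := by
    have := (tendsto_add_atTop_iff_nat 1).2 ENNReal.tendsto_inv_nat_nhds_zero
    simpa using this
  exact ⟨φ, h1,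
    tendsto_of_tendsto_of_tendsto_of_le_of_le tendsto_const_nhds h0 (fun _ => zero_le)
      fun k => (h2 k).le,
    tendsto_of_tendsto_of_tendsto_of_le_of_le tendsto_const_nhds h0 (fun _ => zero_le)
      fun k => (h3 k).le⟩

/-- Both terms are continuous for H¹ convergence, the potential being Lipschitz. Inequalities for
the truncated energy thus pass from test functions to all of H¹₀(Ω). -/
lemma tendsto_truncEnergy (hvol : volume Ω ≠ ⊤) {Γ : ℝ → ℝ} {B C : ℝ}
    (hl : ∀ s t, |Γ s - Γ t| ≤ B * |s - t|) (hb : ∀ s, |Γ s| ≤ C) (v : H10 Ω)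
    {φ : ℕ → 𝔼 → ℝ} (hφ : ∀ k, IsTestFunction Ω (φ k))
    (h1 : Tendsto (fun k => eLpNorm (fun x => v.toFun x - φ k x) 2 (volume.restrict Ω)) atTop (𝓝 0))
    (h2 : Tendsto (fun k => eLpNorm (fun x => v.grad x - gradient (φ k) x) 2 (volume.restrict Ω))
      atTop (𝓝 0)) :
    Tendsto (fun k => truncEnergy Ω Γ (φ k) (gradient (φ k))) atTop
      (𝓝 (truncEnergy Ω Γ v.toFun v.grad)) := by
  have : IsFiniteMeasure (volume.restrict Ω) := ⟨by simpa using hvol.lt_top⟩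
  have hg := tendsto_toLp_of_eLpNorm v.memLp_grad (fun k => (hφ k).memLp_gradient 2) h2
  have hg2 := (hg.norm.pow 2)
  simp_rw [norm_sq_toLp] at hg2
  exact (hg2.const_mul _).sub
    (tendsto_integral_comp_of_eLpNorm hl hb v.memLp_toFun (fun k => (hφ k).memLp 2) h1)

/-- The `H¹` limit of test functions as an element of `H¹₀`. -/
lemma hasWeakGradient_of_tendsto {u : 𝔼 → ℝ} {V : 𝔼 → 𝔼} (hu : MemLp u 2 (volume.restrict Ω))
    (hV : MemLp V 2 (volume.restrict Ω)) {w : ℕ → 𝔼 → ℝ} (hw : ∀ k, IsTestFunction Ω (w k))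
    (h1 : Tendsto (fun k => eLpNorm (fun x => u x - w k x) 2 (volume.restrict Ω)) atTop (𝓝 0))
    (h2 : Tendsto (fun k => eLpNorm (fun x => V x - gradient (w k) x) 2 (volume.restrict Ω))
      atTop (𝓝 0)) : HasWeakGradient Ω u V := by
  intro φ hφ
  set ν := volume.restrict Ω
  have int1 : ∀ {f : 𝔼 → ℝ}, MemLp f 2 ν → Integrable (fun x => f x • gradient φ x) ν :=
    fun hf => memLp_one_iff_integrable.1 ((hφ.memLp_gradient 2).smul hf)
  have int2 : ∀ {F : 𝔼 → 𝔼}, MemLp F 2 ν → Integrable (fun x => φ x • F x) ν :=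
    fun hF => memLp_one_iff_integrable.1 (hF.smul (hφ.memLp 2))
  refine ext_inner_right ℝ fun e => ?_
  rw [inner_neg_left, real_inner_comm, ← integral_inner (int1 hu), real_inner_comm,
    ← integral_inner (int2 hV)]
  have hd1 : MemLp (fun x => fderiv ℝ φ x e) 2 ν := (hφ.fderiv_apply e).memLp 2
  have hd2 : MemLp (fun x => φ x • e) 2 ν := by
    have : IsTestFunction Ω φ := hφ
    refine MemLp.of_le_mul (c := ‖e‖) (hφ.memLp 2)
      ((hφ.continuous.smul continuous_const).aestronglyMeasurable)
      (Eventually.of_forall fun x => ?_)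
    rw [norm_smul, mul_comm]
  have e1 : ∀ {f : 𝔼 → ℝ} (hf : MemLp f 2 ν), ∫ x, ⟪e, f x • gradient φ x⟫_ℝ ∂ν
      = ⟪hf.toLp f, hd1.toLp _⟫_ℝ := by
    intro f hf
    rw [L2.inner_def]
    refine integral_congr_ae ?_
    filter_upwards [hf.coeFn_toLp, hd1.coeFn_toLp] with x hx1 hx2
    rw [hx1, hx2, inner_smul_right, real_inner_comm, inner_gradient_left]
    simp [mul_comm]
  have e2 : ∀ {F : 𝔼 → 𝔼} (hF : MemLp F 2 ν), ∫ x, ⟪e, φ x • F x⟫_ℝ ∂ν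
      = ⟪hF.toLp F, hd2.toLp _⟫_ℝ := by
    intro F hF
    rw [L2.inner_def]
    refine integral_congr_ae ?_
    filter_upwards [hF.coeFn_toLp, hd2.coeFn_toLp] with x hx1 hx2
    rw [hx1, hx2, inner_smul_right, inner_smul_right, real_inner_comm]
  have t1 := (tendsto_toLp_of_eLpNorm hu (fun k => (hw k).memLp 2) h1).inner (𝕜 := ℝ)
    (tendsto_const_nhds (x := hd1.toLp _))
  have t2 := (tendsto_toLp_of_eLpNorm hV (fun k => (hw k).memLp_gradient 2) h2).inner (𝕜 := ℝ)
    (tendsto_const_nhds (x := hd2.toLp _))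
  rw [e1 hu, e2 hV]
  -- Tested against a vector `e`, both sides are L² inner products, hence limits of the integration
  -- by parts identities for the smooth `w k`.
  refine tendsto_nhds_unique t1 (t2.neg.congr fun k => ?_)
  rw [← e1, ← e2]
  have := (hw k).integral_mul_fderiv hφ e
  have g1 : ∀ x, ⟪e, w k x • gradient φ x⟫_ℝ = w k x * fderiv ℝ φ x e := fun x => by
    rw [inner_smul_right, real_inner_comm, inner_gradient_left]
  have g2 : ∀ x, ⟪e, φ x • gradient (w k) x⟫_ℝ = fderiv ℝ (w k) x e * φ x := fun x => by
    rw [inner_smul_right, real_inner_comm, inner_gradient_left, mul_comm]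
  simp_rw [g1, g2]
  exact this.symm

/-- An `H¹` limit of test functions is an element of `H¹₀`. -/
def H10.ofTendsto {u : 𝔼 → ℝ} {V : 𝔼 → 𝔼} (hu : MemLp u 2 (volume.restrict Ω))
    (hV : MemLp V 2 (volume.restrict Ω)) {w : ℕ → 𝔼 → ℝ} (hw : ∀ k, IsTestFunction Ω (w k))
    (h1 : Tendsto (fun k => eLpNorm (fun x => u x - w k x) 2 (volume.restrict Ω)) atTop (𝓝 0))
    (h2 : Tendsto (fun k => eLpNorm (fun x => V x - gradient (w k) x) 2 (volume.restrict Ω))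
      atTop (𝓝 0)) : H10 Ω where
  toFun := u
  grad := V
  memLp_toFun := hu
  memLp_grad := hV
  hasWeakGradient := hasWeakGradient_of_tendsto hu hV hw h1 h2
  mem_closure ε hε := by
    obtain ⟨k, hk1, hk2⟩ :=
      ((h1.eventually (gt_mem_nhds hε)).and (h2.eventually (gt_mem_nhds hε))).exists
    exact ⟨w k, hw k, hk1, hk2⟩

/-- Vitali's theorem: on a finite measure space a common constant bound gives uniform integrability.
-/
lemma tendsto_eLpNorm_of_tendsto_ae {μ : Measure 𝔼} [IsFiniteMeasure μ] {u : 𝔼 → ℝ}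
    {w : ℕ → 𝔼 → ℝ} {M : ℝ} (hw : ∀ k, AEStronglyMeasurable (w k) μ) (hM : ∀ k x, |w k x| ≤ M)
    (h : ∀ᵐ x ∂μ, Tendsto (fun k => w k x) atTop (𝓝 (u x))) :
    MemLp u 2 μ ∧ Tendsto (fun k => eLpNorm (fun x => u x - w k x) 2 μ) atTop (𝓝 0) := by
  have hum : AEStronglyMeasurable u μ := aestronglyMeasurable_of_tendsto_ae atTop hw h
  have huM : ∀ᵐ x ∂μ, ‖u x‖ ≤ M := h.mono fun x hx =>
    le_of_tendsto hx.norm (Eventually.of_forall fun k => hM k x)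
  have hmem : MemLp u 2 μ := MemLp.of_bound hum M huM
  refine ⟨hmem, ?_⟩
  have hui : UnifIntegrable w 2 μ := by
    have : ∀ k, ∀ᵐ x ∂μ, ‖w k x‖ ≤ ‖(fun _ : 𝔼 => M) x‖ := fun k =>
      Eventually.of_forall fun x => (hM k x).trans (le_abs_self M)
    have hd := unifIntegrable_const (ι := ℕ) (p := 2) (μ := μ) (g := fun _ : 𝔼 => M)
      (by norm_num) (by norm_num) (memLp_const M)
    intro ε hε
    obtain ⟨δ, hδ, hh⟩ := hd hε
    refine ⟨δ, hδ, fun i s hs hμ => (eLpNorm_mono_ae ?_).trans (hh i s hs hμ)⟩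
    refine Eventually.of_forall fun x => ?_
    by_cases hx : x ∈ s
    · simpa [hx] using (hM i x).trans (le_abs_self M)
    · simp [hx]
  have := tendsto_Lp_finite_of_tendsto_ae (p := 2) (by norm_num) (by norm_num) hw hmem hui h
  refine this.congr fun k => ?_
  rw [← eLpNorm_neg]
  congr 1
  ext x
  simp

end Minimization

/-! ### Existence of a minimizer -/

section Existence

variable {N : ℕ} {Ω : Set (EuclideanSpace ℝ (Fin N))}

local notation "𝔼" => EuclideanSpace ℝ (Fin N)

lemma IsTestFunction.truncEnergy_eq {φ : 𝔼 → ℝ} (h : IsTestFunction Ω φ) (Γ : ℝ → ℝ) :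
    truncEnergy Ω Γ φ (gradient φ) = 1 / 2 * ‖h.gradLp‖ ^ 2 - ∫ x in Ω, Γ (φ x) := by
  rw [truncEnergy, IsTestFunction.gradLp, norm_sq_toLp]

/-- Every test function can be replaced by one taking values near `[0, a]` without increasing the
energy substantially. -/
lemma IsTestFunction.exists_truncation_energy_le (hvol : volume Ω ≠ ⊤) {a : ℝ} (ha : 0 < a)
    {Γ γ : ℝ → ℝ} {B C K : ℝ} (P : TruncatedPotential a Γ γ B C K) {φ : 𝔼 → ℝ}
    (h : IsTestFunction Ω φ) {ε : ℝ} (hε : 0 < ε) :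
    ∃ ψ : 𝔼 → ℝ, IsTestFunction Ω ψ ∧ (∀ x, -ε ≤ ψ x ∧ ψ x ≤ a + ε) ∧
      truncEnergy Ω Γ ψ (gradient ψ) ≤
        truncEnergy Ω Γ φ (gradient φ) + B * ε * volume.real Ω := by
  have hfin : IsFiniteMeasure (volume.restrict Ω) := ⟨by simpa using hvol.lt_top⟩
  have hΓ := continuous_of_abs_sub_le P.lip
  have hB : 0 ≤ B := by simpa using (abs_nonneg _).trans (P.lip 1 0)
  obtain ⟨ψ, hψ, hψ1, hψ2⟩ := h.exists_truncation ha hε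
  refine ⟨ψ, hψ, fun x => ?_, ?_⟩
  · have h1 := abs_le.1 (hψ1 x)
    have h2 : 0 ≤ min |φ x| a := le_min (abs_nonneg _) ha.le
    have h3 : min |φ x| a ≤ a := min_le_right _ _
    constructor <;> linarith
  · have i1 : ∫ x in Ω, ‖gradient ψ x‖ ^ 2 ≤ ∫ x in Ω, ‖gradient φ x‖ ^ 2 := by
      refine integral_mono ((hψ.memLp_gradient 2).integrable_norm_pow (by norm_num))
        ((h.memLp_gradient 2).integrable_norm_pow (by norm_num)) fun x => ?_
      have := hψ2 x
      dsimp only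
      gcongr
    have hi1 : Integrable (fun x => Γ (φ x)) (volume.restrict Ω) :=
      integrable_comp_of_bounded hΓ P.bdd h.continuous.aestronglyMeasurable
    have hi2 : Integrable (fun x => Γ (ψ x)) (volume.restrict Ω) :=
      integrable_comp_of_bounded hΓ P.bdd hψ.continuous.aestronglyMeasurable
    have i2 : ∫ x in Ω, Γ (φ x) ≤ ∫ x in Ω, (Γ (ψ x) + B * ε) := by
      refine integral_mono hi1 (hi2.add (integrable_const _)) fun x => ?_
      -- Exact truncation leaves Γ unchanged, so only the smoothing error B ε remains.
      have h1 := abs_le.1 (P.lip (ψ x) (min |φ x| a))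
      rw [P.trunc] at h1
      have h2 := mul_le_mul_of_nonneg_left (hψ1 x) hB
      dsimp only
      linarith
    rw [integral_add hi2 (integrable_const _), integral_const] at i2
    simp only [smul_eq_mul, measureReal_restrict_apply_univ] at i2
    simp only [truncEnergy]
    linarith

/-- The approximating sequence is exported along with the minimizer: the Euler-Lagrange equation and
the exclusion of the constant a are obtained by computing with it. -/
theorem exists_truncated_minimizer (hb : Bornology.IsBounded Ω) (hΩm : MeasurableSet Ω) {a : ℝ}
    (ha : 0 < a) {Γ γ : ℝ → ℝ} {B C K : ℝ} (P : TruncatedPotential a Γ γ B C K) :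
    ∃ (U : H10 Ω) (w : ℕ → 𝔼 → ℝ) (hw : ∀ k, IsTestFunction Ω (w k)),
      (∀ k x, |w k x| ≤ a + 1) ∧
      (∀ᵐ x ∂volume.restrict Ω, Tendsto (fun k => w k x) atTop (𝓝 (U.toFun x))) ∧
      Tendsto (fun k => (hw k).gradLp) atTop (𝓝 (U.memLp_grad.toLp U.grad)) ∧
      (∀ᵐ x ∂volume.restrict Ω, 0 ≤ U.toFun x ∧ U.toFun x ≤ a) ∧
      ∀ φ : 𝔼 → ℝ, IsTestFunction Ω φ →
        truncEnergy Ω Γ U.toFun U.grad ≤ truncEnergy Ω Γ φ (gradient φ) := by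
  have hvol : volume Ω ≠ ⊤ := hb.measure_lt_top.ne
  have hfin : IsFiniteMeasure (volume.restrict Ω) := ⟨by simpa using hvol.lt_top⟩
  set ν := volume.restrict Ω with hν
  have hΓ := continuous_of_abs_sub_le P.lip
  have hB : 0 ≤ B := by simpa using (abs_nonneg _).trans (P.lip 1 0)
  have hC : 0 ≤ C := (abs_nonneg _).trans (P.bdd 0)
  set J : (𝔼 → ℝ) → ℝ := fun φ => truncEnergy Ω Γ φ (gradient φ) with hJ
  set V := volume.real Ω with hV
  have hV0 : 0 ≤ V := measureReal_nonneg
  have hint : ∀ {f : 𝔼 → ℝ}, AEStronglyMeasurable f ν → |∫ x, Γ (f x) ∂ν| ≤ C * V := by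
    intro f _
    have := norm_integral_le_of_norm_le_const (μ := ν) (f := fun x => Γ (f x))
      (Eventually.of_forall fun x => P.bdd (f x))
    simpa [hν, hV] using this
  -- the infimum over test functions
  set S : Set ℝ := J '' {φ | IsTestFunction Ω φ} with hS
  have hbdd : BddBelow S := by
    refine ⟨-(C * V), ?_⟩
    rintro _ ⟨φ, hφ, rfl⟩
    have h1 := abs_le.1 (hint hφ.continuous.aestronglyMeasurable)
    have h2 : 0 ≤ 1 / 2 * ‖IsTestFunction.gradLp hφ‖ ^ 2 := by positivity
    simp only [hJ]
    rw [IsTestFunction.truncEnergy_eq hφ]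
    linarith
  have hSn : S.Nonempty := ⟨_, fun _ => 0, ⟨contDiff_const, HasCompactSupport.zero, by
    simp [tsupport]⟩, rfl⟩
  set m := sInf S with hm
  have hle : ∀ φ, IsTestFunction Ω φ → m ≤ J φ := fun φ hφ => csInf_le hbdd ⟨φ, hφ, rfl⟩
  -- In the error factor, 1 accounts for not attaining the infimum and B V for the truncation.
  have hseq : ∀ k : ℕ, ∃ ψ : 𝔼 → ℝ, IsTestFunction Ω ψ ∧
      (∀ x, -(1 / ((k : ℝ) + 1)) ≤ ψ x ∧ ψ x ≤ a + 1 / ((k : ℝ) + 1)) ∧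
      J ψ ≤ m + (1 + B * V) * (1 / ((k : ℝ) + 1)) := by
    intro k
    have hk : (0 : ℝ) < 1 / ((k : ℝ) + 1) := by positivity
    obtain ⟨_, ⟨φ, hφ, rfl⟩, hlt⟩ := exists_lt_of_csInf_lt hSn (lt_add_of_pos_right m hk)
    obtain ⟨ψ, hψ, h1, h2⟩ := IsTestFunction.exists_truncation_energy_le hvol ha P hφ hk
    refine ⟨ψ, hψ, h1, ?_⟩
    simp only [hJ] at hlt ⊢
    linarith
  choose ψ hψ hψval hψJ using hseq
  have hone : ∀ k : ℕ, 1 / ((k : ℝ) + 1) ≤ 1 := fun k => by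
    rw [div_le_one (by positivity)]
    linarith [Nat.cast_nonneg (α := ℝ) k]
  have hψM : ∀ k x, |ψ k x| ≤ a + 1 := fun k x => by
    have h1 := hψval k x
    have h2 := hone k
    rw [abs_le]; constructor <;> linarith
  have hgradb : ∀ k, ‖(hψ k).gradLp‖ ≤ Real.sqrt (2 * (m + (1 + B * V) + C * V)) := by
    intro k
    refine Real.le_sqrt_of_sq_le ?_
    have h1 := hψJ k
    simp only [hJ] at h1
    rw [(hψ k).truncEnergy_eq] at h1
    have h2 := abs_le.1 (hint (hψ k).continuous.aestronglyMeasurable)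
    have h3 : (1 + B * V) * (1 / ((k : ℝ) + 1)) ≤ (1 + B * V) * 1 :=
      mul_le_mul_of_nonneg_left (hone k) (by positivity)
    linarith
  obtain ⟨R, hR⟩ := hb.subset_ball (0 : 𝔼)
  obtain ⟨ns, hns, u, hu⟩ := exists_subseq_tendsto_ae (μ := (volume : Measure 𝔼)) (φ := ψ)
    (M := a + 1) (R := R)
    (D := ENNReal.ofReal (Real.sqrt (2 * (m + (1 + B * V) + C * V))) * volume Ω ^ (1 / 2 : ℝ))
    (ENNReal.mul_ne_top ENNReal.ofReal_ne_top (ENNReal.rpow_ne_top_of_nonneg (by norm_num) hvol))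
    (fun k => (hψ k).1.of_le ENat.LEInfty.out)
    (fun k x hx => hR (by by_contra h; exact hx ((hψ k).eq_zero h))) hψM
    (fun k => ((hψ k).lintegral_fderiv_le hΩm).trans (by
      gcongr
      rw [← ofReal_norm]
      exact ENNReal.ofReal_le_ofReal (hgradb k)))
  have hu' : ∀ᵐ x ∂ν, Tendsto (fun k => ψ (ns k) x) atTop (𝓝 (u x)) := ae_restrict_of_ae hu
  set w : ℕ → 𝔼 → ℝ := fun k => ψ (ns k) with hw
  have hwt : ∀ k, IsTestFunction Ω (w k) := fun k => hψ _
  have hwm : ∀ k, AEStronglyMeasurable (w k) ν := fun k => (hwt k).continuous.aestronglyMeasurable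
  obtain ⟨hmem, hL2⟩ := tendsto_eLpNorm_of_tendsto_ae hwm (fun k => hψM (ns k)) hu'
  have hinv : Tendsto (fun k => 1 / ((ns k : ℝ) + 1)) atTop (𝓝 0) :=
    (tendsto_one_div_add_atTop_nhds_zero_nat (𝕜 := ℝ)).comp hns.tendsto_atTop
  have hJlim : Tendsto (fun k => J (w k)) atTop (𝓝 m) := by
    refine tendsto_of_tendsto_of_tendsto_of_le_of_le tendsto_const_nhds ?_
      (fun k => hle _ (hwt k)) fun k => hψJ (ns k)
    simpa using (hinv.const_mul (1 + B * V)).const_add m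
  -- strong convergence of the gradients
  have hΓlim : ∀ {ι : Type} {l : Filter ι} [l.IsCountablyGenerated] {f : ι → 𝔼 → ℝ},
      (∀ i, Continuous (f i)) → (∀ᵐ x ∂ν, Tendsto (fun i => f i x) l (𝓝 (u x))) →
      Tendsto (fun i => ∫ x, Γ (f i x) ∂ν) l (𝓝 (∫ x, Γ (u x) ∂ν)) := by
    intro ι l _ f hf hlim
    refine tendsto_integral_filter_of_dominated_convergence (fun _ => C)
      (Eventually.of_forall fun i => (hΓ.comp (hf i)).aestronglyMeasurable)
      (Eventually.of_forall fun i => Eventually.of_forall fun x => P.bdd _) (integrable_const _) ?_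
    filter_upwards [hlim] with x hx
    exact (hΓ.tendsto _).comp hx
  have hcauchy : CauchySeq fun k => (hwt k).gradLp := by
    rw [cauchySeq_iff_tendsto_dist_atTop_0]
    set I := ∫ x, Γ (u x) ∂ν with hI
    -- Midpoints are admissible competitors, so their energy is at least m.
    set h : ℕ × ℕ → 𝔼 → ℝ := fun p x => (1 / 2) * (w p.1 x + w p.2 x) with hh
    have hht : ∀ p, IsTestFunction Ω (h p) := fun p => ((hwt p.1).add (hwt p.2)).const_mul _
    have hfst : Tendsto (Prod.fst : ℕ × ℕ → ℕ) atTop atTop := by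
      rw [← prod_atTop_atTop_eq]; exact tendsto_fst
    have hsnd : Tendsto (Prod.snd : ℕ × ℕ → ℕ) atTop atTop := by
      rw [← prod_atTop_atTop_eq]; exact tendsto_snd
    have hIh : Tendsto (fun p => ∫ x, Γ (h p x) ∂ν) atTop (𝓝 I) := by
      refine hΓlim (fun p => (hht p).continuous) ?_
      filter_upwards [hu'] with x hx
      have := ((hx.comp hfst).add (hx.comp hsnd)).const_mul (1 / 2 : ℝ)
      rw [show 1 / 2 * (u x + u x) = u x by ring] at this
      exact this
    have hIw : Tendsto (fun k => ∫ x, Γ (w k x) ∂ν) atTop (𝓝 I) :=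
      hΓlim (fun k => (hwt k).continuous) hu'
    -- By the parallelogram law |a - b|² = 2|a|² + 2|b|² - 4|(a + b)/2|². The first two terms are
    -- expressed by J, and the last is bounded by the minimality of m. All potential integrals have
    -- the same limit I, so everything cancels.
    have hbound : ∀ p : ℕ × ℕ, dist (hwt p.1).gradLp (hwt p.2).gradLp ^ 2 ≤
        4 * (J (w p.1) + ∫ x, Γ (w p.1 x) ∂ν) + 4 * (J (w p.2) + ∫ x, Γ (w p.2 x) ∂ν)
          - 8 * (m + ∫ x, Γ (h p x) ∂ν) := by
      intro p
      have e0 := hle _ (hht p)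
      simp only [hJ] at e0 ⊢
      rw [(hht p).truncEnergy_eq] at e0
      rw [(hwt p.1).truncEnergy_eq, (hwt p.2).truncEnergy_eq]
      have e1 : (hht p).gradLp = (1 / 2 : ℝ) • ((hwt p.1).gradLp + (hwt p.2).gradLp) := by
        rw [← IsTestFunction.gradLp_add, ← IsTestFunction.gradLp_const_mul]
      rw [e1, norm_smul, mul_pow] at e0
      norm_num at e0
      have e2 := parallelogram_law_with_norm ℝ (hwt p.1).gradLp (hwt p.2).gradLp
      rw [dist_eq_norm]
      nlinarith
    have hlim0 : Tendsto (fun p : ℕ × ℕ =>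
        4 * (J (w p.1) + ∫ x, Γ (w p.1 x) ∂ν) + 4 * (J (w p.2) + ∫ x, Γ (w p.2 x) ∂ν)
          - 8 * (m + ∫ x, Γ (h p x) ∂ν)) atTop (𝓝 0) := by
      have := (((((hJlim.comp hfst).add (hIw.comp hfst)).const_mul 4).add
        (((hJlim.comp hsnd).add (hIw.comp hsnd)).const_mul 4)).sub
          ((hIh.const_add m).const_mul 8))
      rw [show 4 * (m + I) + 4 * (m + I) - 8 * (m + I) = 0 by ring] at this
      exact this
    have hsq := tendsto_of_tendsto_of_tendsto_of_le_of_le tendsto_const_nhds hlim0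
      (fun p => sq_nonneg _) hbound
    have := hsq.sqrt
    simpa [Real.sqrt_sq dist_nonneg] using this
  obtain ⟨G, hG⟩ := cauchySeq_tendsto_of_complete hcauchy
  have hGL2 : Tendsto (fun k => eLpNorm (fun x => G x - gradient (w k) x) 2 ν) atTop (𝓝 0) := by
    rw [tendsto_iff_edist_tendsto_0] at hG
    refine hG.congr fun k => ?_
    rw [edist_comm, ← Lp.toLp_coeFn G (Lp.memLp G), IsTestFunction.gradLp, Lp.edist_toLp_toLp]
    refine eLpNorm_congr_ae ?_
    filter_upwards [(Lp.memLp G).coeFn_toLp] with x hx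
    simp
  refine ⟨H10.ofTendsto hmem (Lp.memLp G) hwt hL2 hGL2, w, hwt, fun k => hψM (ns k), hu', ?_, ?_, ?_⟩
  · simpa [H10.ofTendsto] using hG
  · filter_upwards [hu'] with x hx
    refine ⟨le_of_tendsto_of_tendsto' ?_ hx fun k => (hψval (ns k) x).1,
      le_of_tendsto_of_tendsto' hx ?_ fun k => (hψval (ns k) x).2⟩
    · simpa using hinv.neg
    · simpa using hinv.const_add a
  · intro φ hφ
    have := tendsto_truncEnergy hvol P.lip P.bdd (H10.ofTendsto hmem (Lp.memLp G) hwt hL2 hGL2)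
      hwt hL2 hGL2
    rw [tendsto_nhds_unique this hJlim]
    exact hle φ hφ

end Existence

/-! ### First variation, weak equation and nontriviality -/

section EulerLagrange

variable {N : ℕ} {Ω : Set (EuclideanSpace ℝ (Fin N))}

local notation "𝔼" => EuclideanSpace ℝ (Fin N)

lemma eq_zero_of_forall_mul_add_sq_nonneg {p q : ℝ} (h : ∀ t : ℝ, 0 ≤ t * p + t ^ 2 * q) :
    p = 0 := by
  have hmin : IsLocalMin (fun t : ℝ => t * p + t ^ 2 * q) 0 :=
    Eventually.of_forall fun t => by simpa using h t
  have hd : HasDerivAt (fun t : ℝ => t * p + t ^ 2 * q) p 0 := by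
    have := ((hasDerivAt_id' (0 : ℝ)).mul_const p).fun_add
      (((hasDerivAt_id' (0 : ℝ)).fun_pow 2).mul_const q)
    exact this.congr_deriv (by simp)
  exact hmin.hasDerivAt_eq_zero hd

lemma H10.truncEnergy_le_of_forall_test (hvol : volume Ω ≠ ⊤) {Γ : ℝ → ℝ} {B C m : ℝ}
    (hl : ∀ s t, |Γ s - Γ t| ≤ B * |s - t|) (hb : ∀ s, |Γ s| ≤ C)
    (hm : ∀ φ : 𝔼 → ℝ, IsTestFunction Ω φ → m ≤ truncEnergy Ω Γ φ (gradient φ)) (v : H10 Ω) :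
    m ≤ truncEnergy Ω Γ v.toFun v.grad := by
  obtain ⟨φ, hφ, h1, h2⟩ := v.exists_approx
  exact ge_of_tendsto (tendsto_truncEnergy hvol hl hb v hφ h1 h2)
    (Eventually.of_forall fun k => hm _ (hφ k))

lemma inner_toLp {F : Type*} [NormedAddCommGroup F] [InnerProductSpace ℝ F]
    {μ : Measure 𝔼} {f h : 𝔼 → F} (hf : MemLp f 2 μ) (hh : MemLp h 2 μ) :
    ⟪hf.toLp f, hh.toLp h⟫_ℝ = ∫ x, ⟪f x, h x⟫_ℝ ∂μ := by
  rw [L2.inner_def]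
  refine integral_congr_ae ?_
  filter_upwards [hf.coeFn_toLp, hh.coeFn_toLp] with x h1 h2
  rw [h1, h2]

/-- Perturbing the smooth `w k` by tφ stays among test functions; letting k tend to infinity gives
the inequality for U + tφ. The Taylor bound for Γ then leaves a polynomial tp + t²q that is
nonnegative for every t, so p = 0. -/
lemma euler_lagrange_of_minimizer (hvol : volume Ω ≠ ⊤) {a : ℝ} {Γ γ : ℝ → ℝ} {B C K : ℝ}
    (P : TruncatedPotential a Γ γ B C K) {U : H10 Ω} {w : ℕ → 𝔼 → ℝ}
    (hw : ∀ k, IsTestFunction Ω (w k))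
    (hwU : ∀ᵐ x ∂volume.restrict Ω, Tendsto (fun k => w k x) atTop (𝓝 (U.toFun x)))
    (hgrad : Tendsto (fun k => (hw k).gradLp) atTop (𝓝 (U.memLp_grad.toLp U.grad)))
    (hmin : ∀ φ : 𝔼 → ℝ, IsTestFunction Ω φ →
        truncEnergy Ω Γ U.toFun U.grad ≤ truncEnergy Ω Γ φ (gradient φ))
    {φ : 𝔼 → ℝ} (hφ : IsTestFunction Ω φ) :
    ⟪U.memLp_grad.toLp U.grad, hφ.gradLp⟫_ℝ = ∫ x in Ω, γ (U.toFun x) * φ x := by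
  have hfin : IsFiniteMeasure (volume.restrict Ω) := ⟨by simpa using hvol.lt_top⟩
  set ν := volume.restrict Ω with hν
  have hΓ := continuous_of_abs_sub_le P.lip
  have hγ := continuous_of_abs_sub_le P.lip_deriv
  set G := U.memLp_grad.toLp U.grad with hG
  have hUm : AEStronglyMeasurable U.toFun ν := U.memLp_toFun.1
  have hφm : AEStronglyMeasurable φ ν := hφ.continuous.aestronglyMeasurable
  have hφi : Integrable φ ν := memLp_one_iff_integrable.1 (hφ.memLp 1)
  have hφ2 : Integrable (fun x => φ x ^ 2) ν := (hφ.memLp 2).integrable_sq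
  have hγφ : Integrable (fun x => γ (U.toFun x) * φ x) ν :=
    hφi.bdd_mul (hγ.comp_aestronglyMeasurable hUm) (Eventually.of_forall fun x => P.bdd_deriv _)
  refine sub_eq_zero.1 (eq_zero_of_forall_mul_add_sq_nonneg
    (q := 1 / 2 * ‖hφ.gradLp‖ ^ 2 + K * ∫ x, φ x ^ 2 ∂ν) fun t => ?_)
  have h1 : ∀ k, truncEnergy Ω Γ U.toFun U.grad ≤
      1 / 2 * ‖(hw k).gradLp + t • hφ.gradLp‖ ^ 2 - ∫ x, Γ (w k x + t * φ x) ∂ν := by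
    intro k
    have ht := (hw k).add (hφ.const_mul t)
    have := hmin _ ht
    have hg : ht.gradLp = (hw k).gradLp + t • hφ.gradLp := by
      rw [← IsTestFunction.gradLp_const_mul, ← IsTestFunction.gradLp_add]
    rwa [ht.truncEnergy_eq, hg] at this
  have h2 : Tendsto (fun k => ∫ x, Γ (w k x + t * φ x) ∂ν) atTop
      (𝓝 (∫ x, Γ (U.toFun x + t * φ x) ∂ν)) := by
    refine tendsto_integral_of_dominated_convergence (fun _ => C)
      (fun k => (hΓ.comp ((hw k).continuous.add
        (continuous_const.mul hφ.continuous))).aestronglyMeasurable)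
      (integrable_const _) (fun k => Eventually.of_forall fun x => P.bdd _) ?_
    filter_upwards [hwU] with x hx
    exact (hΓ.tendsto _).comp (hx.add_const _)
  have h3 := ge_of_tendsto ((((hgrad.add_const (t • hφ.gradLp)).norm.pow 2).const_mul
    (1 / 2 : ℝ)).sub h2) (Eventually.of_forall h1)
  have h4 : ∫ x, (Γ (U.toFun x) + t * (γ (U.toFun x) * φ x) - K * t ^ 2 * φ x ^ 2) ∂ν
      ≤ ∫ x, Γ (U.toFun x + t * φ x) ∂ν := by
    refine integral_mono (((integrable_comp_of_bounded hΓ P.bdd hUm).add (hγφ.const_mul t)).sub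
      (hφ2.const_mul _)) (integrable_comp_of_bounded hΓ P.bdd
        (hUm.add (hφm.const_mul t))) fun x => ?_
    have := P.taylor (U.toFun x) (t * φ x)
    dsimp only
    refine le_trans (le_of_eq ?_) this
    ring
  have h5 : ∫ x, (Γ (U.toFun x) + t * (γ (U.toFun x) * φ x)) ∂ν
      = ∫ x, Γ (U.toFun x) ∂ν + ∫ x, t * (γ (U.toFun x) * φ x) ∂ν :=
    integral_add (integrable_comp_of_bounded hΓ P.bdd hUm) (hγφ.const_mul t)
  have h6 : ∫ x, (Γ (U.toFun x) + t * (γ (U.toFun x) * φ x) - K * t ^ 2 * φ x ^ 2) ∂ν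
      = ∫ x, (Γ (U.toFun x) + t * (γ (U.toFun x) * φ x)) ∂ν - ∫ x, K * t ^ 2 * φ x ^ 2 ∂ν :=
    integral_sub ((integrable_comp_of_bounded hΓ P.bdd hUm).add (hγφ.const_mul t))
      (hφ2.const_mul _)
  rw [h6, h5, integral_const_mul, integral_const_mul] at h4
  rw [norm_add_sq_real, inner_smul_right, norm_smul, mul_pow, truncEnergy,
    ← norm_sq_toLp U.memLp_grad, Real.norm_eq_abs, sq_abs] at h3
  linarith

/-- The distributional form of an Euler-Lagrange equation. -/
lemma H10.integral_mul_laplacian (U : H10 Ω) {f : 𝔼 → ℝ}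
    (hEL : ∀ (φ : 𝔼 → ℝ) (hφ : IsTestFunction Ω φ),
      ⟪U.memLp_grad.toLp U.grad, hφ.gradLp⟫_ℝ = ∫ x in Ω, f x * φ x)
    {φ : 𝔼 → ℝ} (hφ : IsTestFunction Ω φ) :
    ∫ x in Ω, U.toFun x * Δ φ x = -∫ x in Ω, f x * φ x := by
  set ν := volume.restrict Ω with hν
  set b := stdOrthonormalBasis ℝ 𝔼
  have hdd : ∀ x i, fderiv ℝ (fderiv ℝ φ) x (b i) (b i)
      = fderiv ℝ (fun y => fderiv ℝ φ y (b i)) x (b i) := by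
    intro x i
    have h1 : DifferentiableAt ℝ (fderiv ℝ φ) x :=
      ((hφ.1.fderiv_right (m := ∞) (by simp)).differentiable (by simp)) x
    have := (h1.hasFDerivAt.clm_apply (hasFDerivAt_const (b i) x)).fderiv
    rw [this]; simp
  have hd : ∀ i, IsTestFunction Ω fun x => fderiv ℝ φ x (b i) := fun i => hφ.fderiv_apply (b i)
  have hi1 : ∀ i, Integrable (fun x => U.toFun x * fderiv ℝ (fun y => fderiv ℝ φ y (b i)) x (b i)) ν :=
    fun i => U.memLp_toFun.integrable_mul (((hd i).fderiv_apply (b i)).memLp 2)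
  have hi1' : ∀ i, Integrable (fun x => U.toFun x • gradient (fun y => fderiv ℝ φ y (b i)) x) ν :=
    fun i => memLp_one_iff_integrable.1 (((hd i).memLp_gradient 2).smul U.memLp_toFun)
  have hi2' : ∀ i, Integrable (fun x => fderiv ℝ φ x (b i) • U.grad x) ν :=
    fun i => memLp_one_iff_integrable.1 (U.memLp_grad.smul ((hd i).memLp 2))
  have hi2 : ∀ i, Integrable (fun x => ⟪b i, fderiv ℝ φ x (b i) • U.grad x⟫_ℝ) ν :=
    fun i => (hi2' i).const_inner (b i)
  have hpart : ∀ i, ∫ x, U.toFun x * fderiv ℝ (fun y => fderiv ℝ φ y (b i)) x (b i) ∂ν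
      = -∫ x, ⟪b i, fderiv ℝ φ x (b i) • U.grad x⟫_ℝ ∂ν := by
    intro i
    have h1 := congrArg (fun z => ⟪b i, z⟫_ℝ) (U.hasWeakGradient _ (hd i))
    simp only [inner_neg_right] at h1
    rw [← integral_inner (hi1' i), ← integral_inner (hi2' i)] at h1
    rw [← h1]
    refine integral_congr_ae (Eventually.of_forall fun x => ?_)
    dsimp only
    rw [inner_smul_right, real_inner_comm, inner_gradient_left]
  calc ∫ x, U.toFun x * Δ φ x ∂ν
      = ∫ x, ∑ i, U.toFun x * fderiv ℝ (fun y => fderiv ℝ φ y (b i)) x (b i) ∂ν := by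
        refine integral_congr_ae (Eventually.of_forall fun x => ?_)
        dsimp only
        rw [laplacian_eq_sum_fderiv b, Finset.mul_sum]
        simp_rw [hdd]
    _ = -∫ x, ∑ i, ⟪b i, fderiv ℝ φ x (b i) • U.grad x⟫_ℝ ∂ν := by
        rw [integral_finsetSum _ fun i _ => hi1 i, integral_finsetSum _ fun i _ => hi2 i,
          ← Finset.sum_neg_distrib]
        exact Finset.sum_congr rfl fun i _ => hpart i
    _ = -∫ x, ⟪U.grad x, gradient φ x⟫_ℝ ∂ν := by
        congr 1
        refine integral_congr_ae (Eventually.of_forall fun x => ?_)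
        dsimp only
        rw [← b.sum_inner_mul_inner]
        refine Finset.sum_congr rfl fun i _ => ?_
        rw [inner_smul_right, ← inner_gradient_left, real_inner_comm (U.grad x),
          real_inner_comm (b i) (gradient φ x), mul_comm]
    _ = _ := by
        rw [← hEL φ hφ, IsTestFunction.gradLp, inner_toLp]

/-- The infimum of the energy is negative if the Rayleigh quotient is small enough. -/
lemma exists_truncEnergy_neg {Γ : ℝ → ℝ} {c δ B C : ℝ}
    (hl : ∀ s t, |Γ s - Γ t| ≤ B * |s - t|) (hb : ∀ s, |Γ s| ≤ C) (hvol : volume Ω ≠ ⊤)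
    (hδ : 0 < δ) (hc : ∀ s, |s| ≤ δ → c / 2 * s ^ 2 ≤ Γ s) (v : H10 Ω)
    (hv : ∫ x in Ω, ‖v.grad x‖ ^ 2 < c * ∫ x in Ω, v.toFun x ^ 2) :
    ∃ φ : 𝔼 → ℝ, IsTestFunction Ω φ ∧ truncEnergy Ω Γ φ (gradient φ) < 0 := by
  have hfin : IsFiniteMeasure (volume.restrict Ω) := ⟨by simpa using hvol.lt_top⟩
  obtain ⟨φ, hφ, h1, h2⟩ := v.exists_approx
  have l1 := (tendsto_toLp_of_eLpNorm v.memLp_toFun (fun k => (hφ k).memLp 2) h1).norm.pow 2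
  have l2 := (tendsto_toLp_of_eLpNorm v.memLp_grad (fun k => (hφ k).memLp_gradient 2) h2).norm.pow 2
  simp_rw [norm_sq_toLp, Real.norm_eq_abs, sq_abs] at l1
  simp_rw [norm_sq_toLp] at l2
  obtain ⟨k, hk⟩ := ((l2.eventually_lt (l1.const_mul c) hv)).exists
  obtain ⟨M, hM⟩ := (hφ k).continuous.bounded_above_of_compact_support (hφ k).2.1
  have hM0 : 0 ≤ M := (norm_nonneg _).trans (hM 0)
  -- Scaling leaves the Rayleigh quotient unchanged and brings the values into the range where Γ
  -- dominates the quadratic. The summand 1 covers M = 0.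
  set t := δ / (M + 1) with ht
  have ht0 : 0 < t := by positivity
  refine ⟨fun x => t * φ k x, (hφ k).const_mul t, ?_⟩
  have htb : ∀ x, |t * φ k x| ≤ δ := fun x => by
    rw [abs_mul, abs_of_pos ht0, ht, div_mul_eq_mul_div, div_le_iff₀ (by positivity)]
    have := hM x
    rw [Real.norm_eq_abs] at this
    gcongr
    linarith
  have hΓ := continuous_of_abs_sub_le hl
  have i1 : c / 2 * t ^ 2 * ∫ x in Ω, φ k x ^ 2 ≤ ∫ x in Ω, Γ (t * φ k x) := by
    rw [← integral_const_mul]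
    refine integral_mono (((hφ k).memLp 2).integrable_sq.const_mul _)
      (integrable_comp_of_bounded hΓ hb
        (continuous_const.mul (hφ k).continuous).aestronglyMeasurable) fun x => ?_
    dsimp only
    refine le_trans (le_of_eq ?_) (hc _ (htb x))
    ring
  have i2 : ∫ x in Ω, ‖gradient (fun x => t * φ k x) x‖ ^ 2
      = t ^ 2 * ∫ x in Ω, ‖gradient (φ k) x‖ ^ 2 := by
    rw [← integral_const_mul]
    refine integral_congr_ae (Eventually.of_forall fun x => ?_)
    dsimp only
    rw [gradient_const_mul ((hφ k).differentiable x), norm_smul, mul_pow, Real.norm_eq_abs, sq_abs]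
  rw [truncEnergy, i2]
  have := mul_lt_mul_of_pos_left hk (show 0 < t ^ 2 / 2 by positivity)
  linarith

/-- A limit of test functions whose gradients tend to zero vanishes. -/
lemma integral_abs_eq_zero_of_gradLp_tendsto_zero (hN : 1 ≤ N) (hb : Bornology.IsBounded Ω)
    (hΩm : MeasurableSet Ω)
    {u : 𝔼 → ℝ} {w : ℕ → 𝔼 → ℝ} {M : ℝ} (hw : ∀ k, IsTestFunction Ω (w k))
    (hM : ∀ k x, |w k x| ≤ M)
    (hwu : ∀ᵐ x ∂volume.restrict Ω, Tendsto (fun k => w k x) atTop (𝓝 (u x)))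
    (hgrad : Tendsto (fun k => (hw k).gradLp) atTop (𝓝 0)) : ∀ᵐ x ∂volume.restrict Ω, u x = 0 := by
  have hvol : volume Ω ≠ ⊤ := hb.measure_lt_top.ne
  have hfin : IsFiniteMeasure (volume.restrict Ω) := ⟨by simpa using hvol.lt_top⟩
  set ν := volume.restrict Ω with hν
  obtain ⟨R, hR⟩ := hb.subset_ball (0 : 𝔼)
  have : Nonempty (Fin N) := ⟨⟨0, hN⟩⟩
  -- A translation longer than the diameter of the ball moves the support off itself; such a vector
  -- exists because N ≥ 1.
  obtain ⟨t, ht⟩ := NormedSpace.exists_lt_norm ℝ 𝔼 (2 * R)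
  have hmeas : ∀ k, AEStronglyMeasurable (w k) ν := fun k => (hw k).continuous.aestronglyMeasurable
  have hum : AEStronglyMeasurable u ν := aestronglyMeasurable_of_tendsto_ae atTop hmeas hwu
  have hbound : ∀ k, ∫⁻ x, ‖w k x‖ₑ ∂ν ≤ ‖t‖ₑ * volume Ω ^ (1 / 2 : ℝ) * ‖(hw k).gradLp‖ₑ := by
    intro k
    refine (lintegral_mono' Measure.restrict_le_self le_rfl).trans ?_
    refine (lintegral_le_of_subset_ball ((hw k).1.of_le ENat.LEInfty.out) (R := R)
      (fun x hx => hR (by by_contra h; exact hx ((hw k).eq_zero h))) ht.le).trans ?_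
    rw [mul_assoc, mul_comm (volume Ω ^ _)]
    gcongr
    exact (hw k).lintegral_fderiv_le hΩm
  have hc : ‖t‖ₑ * volume Ω ^ (1 / 2 : ℝ) ≠ ⊤ :=
    ENNReal.mul_ne_top (by simp) (ENNReal.rpow_ne_top_of_nonneg (by norm_num) hvol)
  have h0 : Tendsto (fun k => ‖t‖ₑ * volume Ω ^ (1 / 2 : ℝ) * ‖(hw k).gradLp‖ₑ) atTop (𝓝 0) := by
    have := ENNReal.Tendsto.const_mul hgrad.enorm (Or.inr hc)
    simpa using this
  have h1 : Tendsto (fun k => ∫⁻ x, ‖w k x‖ₑ ∂ν) atTop (𝓝 0) :=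
    tendsto_of_tendsto_of_tendsto_of_le_of_le tendsto_const_nhds h0 (fun _ => zero_le) hbound
  have h2 : Tendsto (fun k => ∫⁻ x, ‖w k x‖ₑ ∂ν) atTop (𝓝 (∫⁻ x, ‖u x‖ₑ ∂ν)) := by
    refine tendsto_lintegral_of_dominated_convergence (fun _ => ENNReal.ofReal M)
      (fun k => (hw k).continuous.enorm.measurable) (fun k => Eventually.of_forall fun x => ?_)
      (by
        rw [lintegral_const]
        exact ENNReal.mul_ne_top ENNReal.ofReal_ne_top (measure_ne_top _ _)) ?_
    · dsimp only
      rw [← ofReal_norm]; exact ENNReal.ofReal_le_ofReal (hM k x)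
    · filter_upwards [hwu] with x hx using hx.enorm
  have h3 := tendsto_nhds_unique h2 h1
  rw [lintegral_eq_zero_iff' hum.enorm] at h3
  filter_upwards [h3] with x hx
  simpa using hx

end EulerLagrange

/-! ### The clamped nonlinearity and its primitive -/

section Nonlinearity

/-- `g` composed with the projection onto `[-a, a]`. -/
def clampedNonlinearity (a : ℝ) (g : ℝ → ℝ) (s : ℝ) : ℝ := g (max (-a) (min s a))

variable {g : ℝ → ℝ} {a : ℝ}

lemma clampedNonlinearity_of_mem {s : ℝ} (h1 : -a ≤ s) (h2 : s ≤ a) :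
    clampedNonlinearity a g s = g s := by
  simp [clampedNonlinearity, h1, h2]

lemma clampedNonlinearity_of_ge (ha : 0 ≤ a) {s : ℝ} (h : a ≤ s) :
    clampedNonlinearity a g s = g a := by
  have : -a ≤ a := by linarith
  simp [clampedNonlinearity, h, this]

lemma odd_map_zero (hodd : ∀ z, g (-z) = -g z) : g 0 = 0 := by
  have := hodd 0
  rw [neg_zero] at this
  linarith

lemma map_eq_zero_of_sign_change (hc : Continuous g) (ha : 0 < a)
    (hpos : ∀ z, 0 < z → z < a → 0 < g z) (hneg : ∀ z, a < z → g z < 0) : g a = 0 := by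
  refine le_antisymm ?_ ?_
  · refine le_of_tendsto (hc.continuousAt.tendsto.mono_left nhdsWithin_le_nhds : Tendsto g (𝓝[>] a) _) ?_
    filter_upwards [self_mem_nhdsWithin] with z hz using (hneg z hz).le
  · refine ge_of_tendsto (hc.continuousAt.tendsto.mono_left nhdsWithin_le_nhds : Tendsto g (𝓝[<] a) _) ?_
    filter_upwards [Ioo_mem_nhdsLT ha] with z hz using (hpos z hz.1 hz.2).le

lemma primitive_neg {f : ℝ → ℝ} (hodd : ∀ z, f (-z) = -f z) (z : ℝ) :
    primitive f (-z) = primitive f z := by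
  have h1 : ∫ t in (0 : ℝ)..z, f (-t) = ∫ t in -z..0, f t := by
    simp
  have h2 : ∫ t in (0 : ℝ)..z, f (-t) = -∫ t in (0 : ℝ)..z, f t := by
    simp_rw [hodd, intervalIntegral.integral_neg]
  rw [primitive, primitive, intervalIntegral.integral_symm, ← h1, h2, neg_neg]

lemma primitive_abs {f : ℝ → ℝ} (hodd : ∀ z, f (-z) = -f z) (z : ℝ) :
    primitive f |z| = primitive f z := by
  rcases abs_choice z with h | h <;> rw [h]
  exact primitive_neg hodd z

lemma clampedNonlinearity_neg (ha : 0 < a) (hodd : ∀ z, g (-z) = -g z) (z : ℝ) :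
    clampedNonlinearity a g (-z) = -clampedNonlinearity a g z := by
  simp only [clampedNonlinearity]
  rw [← hodd]
  congr 1
  rcases le_total z a with h1 | h1 <;> rcases le_total (-a) z with h2 | h2 <;>
    simp only [max_def, min_def] <;> split_ifs <;> linarith

lemma primitive_sub {f : ℝ → ℝ} (hf : Continuous f) (s t : ℝ) :
    primitive f t - primitive f s = ∫ x in s..t, f x :=
  intervalIntegral.integral_interval_sub_left (hf.intervalIntegrable _ _)
    (hf.intervalIntegrable _ _)

/-- A C¹ function is Lipschitz and bounded on [-a, a], and clamping keeps both globally. Evenness of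
the primitive and γ = 0 beyond a make it invariant under s ↦ min(|s|, a), hence bounded; the Taylor
bound integrates the Lipschitz estimate. -/
lemma exists_truncatedPotential (hg : ContDiff ℝ 1 g) (ha : 0 < a) (hodd : ∀ z, g (-z) = -g z)
    (hpos : ∀ z, 0 < z → z < a → 0 < g z) (hneg : ∀ z, a < z → g z < 0) :
    ∃ B C K, TruncatedPotential a (primitive (clampedNonlinearity a g))
      (clampedNonlinearity a g) B C K := by
  set γ := clampedNonlinearity a g with hγ
  have hmem : ∀ s, max (-a) (min s a) ∈ Icc (-a) a := fun s =>
    ⟨le_max_left _ _, max_le (by linarith) (min_le_right _ _)⟩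
  obtain ⟨K, hK⟩ := (hg.contDiffOn (s := Icc (-a) a)).exists_lipschitzOnWith (by simp)
    (convex_Icc _ _) isCompact_Icc
  have hγK : ∀ s t, |γ s - γ t| ≤ K * |s - t| := by
    intro s t
    have h1 := hK.dist_le_mul _ (hmem s) _ (hmem t)
    rw [Real.dist_eq, Real.dist_eq] at h1
    refine h1.trans (mul_le_mul_of_nonneg_left ?_ K.2)
    refine (abs_max_sub_max_le_max _ _ _ _).trans (max_le (by simp) ?_)
    exact (abs_min_sub_min_le_max _ _ _ _).trans (max_le le_rfl (by simp))
  have hγc : Continuous γ := continuous_of_abs_sub_le hγK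
  obtain ⟨B, hB⟩ := isCompact_Icc.exists_bound_of_continuousOn
    (hg.continuous.continuousOn (s := Icc (-a) a))
  have hγB : ∀ s, |γ s| ≤ B := fun s => hB _ (hmem s)
  have hlip : ∀ s t, |primitive γ s - primitive γ t| ≤ B * |s - t| := by
    intro s t
    rw [primitive_sub hγc]
    have h1 := intervalIntegral.norm_integral_le_of_norm_le_const (f := γ) (a := t) (b := s)
      (C := B) fun x _ => hγB x
    rwa [Real.norm_eq_abs] at h1
  have hB0 : 0 ≤ B := (abs_nonneg _).trans (hγB 0)
  have h0 : primitive γ 0 = 0 := by simp [primitive]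
  have hγodd := clampedNonlinearity_neg ha hodd
  have htrunc : ∀ s, primitive γ (min |s| a) = primitive γ s := by
    intro s
    rw [← primitive_abs hγodd s]
    rcases le_total |s| a with h | h
    · rw [min_eq_left h]
    · rw [min_eq_right h]
      have h1 := primitive_sub hγc a |s|
      have h2 : ∫ x in a..|s|, γ x = 0 := by
        refine intervalIntegral.integral_zero_ae (Eventually.of_forall fun x hx => ?_)
        rw [uIoc_of_le h] at hx
        rw [hγ, clampedNonlinearity_of_ge ha.le hx.1.le,
          map_eq_zero_of_sign_change hg.continuous ha hpos hneg]
      linarith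
  refine ⟨B, B * a, K, ⟨hlip, fun s => ?_, htrunc, h0, hγB, hγK, fun s h => ?_⟩⟩
  · rw [← htrunc s]
    have h1 := hlip (min |s| a) 0
    rw [h0, sub_zero, sub_zero, abs_of_nonneg (le_min (abs_nonneg s) ha.le)] at h1
    exact h1.trans (mul_le_mul_of_nonneg_left (min_le_right _ _) hB0)
  · have h1 := primitive_sub hγc s (s + h)
    have h2 : ∫ x in s..s + h, (γ x - γ s) = (∫ x in s..s + h, γ x) - γ s * h := by
      rw [intervalIntegral.integral_sub (hγc.intervalIntegrable _ _)
        intervalIntegrable_const, intervalIntegral.integral_const]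
      simp [mul_comm]
    have h3 : |∫ x in s..s + h, (γ x - γ s)| ≤ K * |h| * |s + h - s| := by
      rw [← Real.norm_eq_abs]
      refine intervalIntegral.norm_integral_le_of_norm_le_const fun x hx => ?_
      rw [Real.norm_eq_abs]
      refine (hγK x s).trans (mul_le_mul_of_nonneg_left ?_ K.2)
      rw [← abs_sub_comm s x]
      have := abs_sub_left_of_mem_uIcc (uIoc_subset_uIcc hx)
      rw [abs_sub_comm]
      simpa using this
    rw [add_sub_cancel_left, mul_assoc, ← abs_mul, ← sq, abs_of_nonneg (sq_nonneg h)] at h3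
    have := abs_le.1 h3
    linarith

lemma clampedNonlinearity_nonneg (hc : Continuous g) (ha : 0 < a) (hodd : ∀ z, g (-z) = -g z)
    (hpos : ∀ z, 0 < z → z < a → 0 < g z) (hneg : ∀ z, a < z → g z < 0) {s : ℝ} (hs : 0 ≤ s) :
    0 ≤ clampedNonlinearity a g s := by
  have hga := map_eq_zero_of_sign_change hc ha hpos hneg
  rcases le_or_gt a s with h | h
  · rw [clampedNonlinearity_of_ge ha.le h, hga]
  · rw [clampedNonlinearity_of_mem (by linarith) h.le]
    rcases hs.eq_or_lt with rfl | h'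
    · rw [odd_map_zero hodd]
    · exact (hpos s h' h).le

lemma continuous_clampedNonlinearity (hc : Continuous g) : Continuous (clampedNonlinearity a g) :=
  hc.comp (by fun_prop)

lemma primitive_clamped_nonneg (hc : Continuous g) (ha : 0 < a) (hodd : ∀ z, g (-z) = -g z)
    (hpos : ∀ z, 0 < z → z < a → 0 < g z) (hneg : ∀ z, a < z → g z < 0) (s : ℝ) :
    0 ≤ primitive (clampedNonlinearity a g) s := by
  rw [← primitive_abs (clampedNonlinearity_neg ha hodd)]
  exact intervalIntegral.integral_nonneg (abs_nonneg s) fun x hx =>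
    clampedNonlinearity_nonneg hc ha hodd hpos hneg hx.1

lemma primitive_le_primitive_clamped (hc : Continuous g) (ha : 0 < a) (hodd : ∀ z, g (-z) = -g z)
    (hpos : ∀ z, 0 < z → z < a → 0 < g z) (hneg : ∀ z, a < z → g z < 0) (s : ℝ) :
    primitive g s ≤ primitive (clampedNonlinearity a g) s := by
  rw [← primitive_abs (clampedNonlinearity_neg ha hodd), ← primitive_abs hodd]
  refine intervalIntegral.integral_mono_on (abs_nonneg s) (hc.intervalIntegrable _ _)
    ((continuous_clampedNonlinearity hc).intervalIntegrable _ _) fun x hx => ?_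
  rcases le_or_gt x a with h | h
  · rw [clampedNonlinearity_of_mem (by linarith [hx.1]) h]
  · rw [clampedNonlinearity_of_ge ha.le h.le, map_eq_zero_of_sign_change hc ha hpos hneg]
    exact (hneg x h).le

lemma primitive_eq_primitive_clamped {s : ℝ} (hs : 0 ≤ s) (hsa : s ≤ a) :
    primitive g s = primitive (clampedNonlinearity a g) s := by
  refine intervalIntegral.integral_congr fun x hx => ?_
  rw [uIcc_of_le hs] at hx
  exact (clampedNonlinearity_of_mem (by linarith [hx.1]) (hx.2.trans hsa)).symm

/-- As the slope of g at 0 exceeds c, g(x) ≥ cx for small x ≥ 0; integration and evenness give the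
bound. -/
lemma exists_quadratic_le_primitive_clamped (hg : ContDiff ℝ 1 g) (ha : 0 < a)
    (hodd : ∀ z, g (-z) = -g z) {c : ℝ} (hc : c < deriv g 0) :
    ∃ δ > 0, ∀ s, |s| ≤ δ → c / 2 * s ^ 2 ≤ primitive (clampedNonlinearity a g) s := by
  have hd : HasDerivAt g (deriv g 0) 0 := ((hg.differentiable (by simp)) 0).hasDerivAt
  have h1 := hd.hasDerivWithinAt (s := Ioi 0)
  rw [hasDerivWithinAt_iff_tendsto_slope' (by simp)] at h1
  obtain ⟨δ₀, hδ₀, hsub⟩ := mem_nhdsGT_iff_exists_Ioo_subset.1 (h1.eventually (lt_mem_nhds hc))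
  have hδ₀' : 0 < δ₀ := hδ₀
  refine ⟨min (δ₀ / 2) a, by positivity, fun s hs => ?_⟩
  have hγ : Continuous (clampedNonlinearity a g) := continuous_clampedNonlinearity hg.continuous
  rw [← primitive_abs (clampedNonlinearity_neg ha hodd), ← sq_abs]
  have h2 : ∫ t in (0 : ℝ)..|s|, c * t = c / 2 * |s| ^ 2 := by
    rw [intervalIntegral.integral_const_mul, integral_id]; ring
  rw [← h2]
  refine intervalIntegral.integral_mono_on (abs_nonneg s)
    ((continuous_const.mul continuous_id).intervalIntegrable _ _)
    (hγ.intervalIntegrable _ _) fun x hx => ?_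
  have hxδ : x ≤ δ₀ / 2 := hx.2.trans (hs.trans (min_le_left _ _))
  have hxa : x ≤ a := hx.2.trans (hs.trans (min_le_right _ _))
  rw [clampedNonlinearity_of_mem (by linarith [hx.1]) hxa]
  rcases hx.1.eq_or_lt with rfl | hx0
  · simp [odd_map_zero hodd]
  · have := hsub ⟨hx0, by linarith⟩
    simp only [mem_ofPred_eq, slope_def_field, odd_map_zero hodd, sub_zero] at this
    exact ((lt_div_iff₀ hx0).1 this).le

end Nonlinearity

/-! ### Comparison with the extended-valued energy -/

section ExtendedEnergy

variable {N : ℕ} {Ω : Set (EuclideanSpace ℝ (Fin N))}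

local notation "𝔼" => EuclideanSpace ℝ (Fin N)

lemma extIntegral_mono {f h : 𝔼 → ℝ} (hle : ∀ x, f x ≤ h x) :
    extIntegral Ω f ≤ extIntegral Ω h := by
  refine EReal.sub_le_sub ?_ ?_
  · exact EReal.coe_ennreal_le_coe_ennreal_iff.2
      (lintegral_mono fun x => ENNReal.ofReal_le_ofReal (hle x))
  · exact EReal.coe_ennreal_le_coe_ennreal_iff.2
      (lintegral_mono fun x => ENNReal.ofReal_le_ofReal (neg_le_neg (hle x)))

lemma extIntegral_congr_ae {f h : 𝔼 → ℝ} (hfh : ∀ᵐ x ∂volume.restrict Ω, f x = h x) :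
    extIntegral Ω f = extIntegral Ω h := by
  have h1 : ∫⁻ x in Ω, ENNReal.ofReal (f x) = ∫⁻ x in Ω, ENNReal.ofReal (h x) :=
    lintegral_congr_ae (hfh.mono fun x hx => congrArg ENNReal.ofReal hx)
  have h2 : ∫⁻ x in Ω, ENNReal.ofReal (-f x) = ∫⁻ x in Ω, ENNReal.ofReal (-h x) :=
    lintegral_congr_ae (hfh.mono fun x hx => congrArg (fun y => ENNReal.ofReal (-y)) hx)
  rw [extIntegral, extIntegral, h1, h2]

lemma extIntegral_of_nonneg {f : 𝔼 → ℝ} (hf : Integrable f (volume.restrict Ω)) (h0 : ∀ x, 0 ≤ f x) :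
    extIntegral Ω f = ((∫ x in Ω, f x : ℝ) : EReal) := by
  have h1 : ∫⁻ x in Ω, ENNReal.ofReal (-f x) = 0 := by
    simp [ENNReal.ofReal_of_nonpos, h0]
  rw [extIntegral, h1, ← ofReal_integral_eq_lintegral_ofReal hf (Eventually.of_forall h0),
    EReal.coe_ennreal_ofReal, max_eq_left (integral_nonneg h0)]
  simp

/-- Extended integrals are monotone without integrability, so the comparison of potentials also
covers v with infinite energy. -/
lemma truncEnergy_le_energy (hvol : volume Ω ≠ ⊤) {g Γ : ℝ → ℝ} {C : ℝ} (hΓ : Continuous Γ)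
    (hb : ∀ s, |Γ s| ≤ C) (h0 : ∀ s, 0 ≤ Γ s) (hle : ∀ s, primitive g s ≤ Γ s) (v : H10 Ω) :
    ((truncEnergy Ω Γ v.toFun v.grad : ℝ) : EReal) ≤ energy Ω g v := by
  have hfin : IsFiniteMeasure (volume.restrict Ω) := ⟨by simpa using hvol.lt_top⟩
  rw [energy, truncEnergy, EReal.coe_sub]
  refine EReal.sub_le_sub le_rfl ?_
  rw [← extIntegral_of_nonneg (integrable_comp_of_bounded hΓ hb v.memLp_toFun.1) fun x => h0 _]
  exact extIntegral_mono fun x => hle _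

lemma energy_eq_truncEnergy (hvol : volume Ω ≠ ⊤) {g Γ : ℝ → ℝ} {C : ℝ} (hΓ : Continuous Γ)
    (hb : ∀ s, |Γ s| ≤ C) (h0 : ∀ s, 0 ≤ Γ s) {v : H10 Ω}
    (heq : ∀ᵐ x ∂volume.restrict Ω, primitive g (v.toFun x) = Γ (v.toFun x)) :
    energy Ω g v = ((truncEnergy Ω Γ v.toFun v.grad : ℝ) : EReal) := by
  have hfin : IsFiniteMeasure (volume.restrict Ω) := ⟨by simpa using hvol.lt_top⟩
  rw [energy, truncEnergy, EReal.coe_sub, extIntegral_congr_ae heq,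
    extIntegral_of_nonneg (integrable_comp_of_bounded hΓ hb v.memLp_toFun.1) fun x => h0 _]

/-- This makes the set of Rayleigh quotients nonempty, so that one of them lies below any number
exceeding λ₁(Ω). -/
lemma exists_H10_integral_sq_ne_zero (hΩ : IsOpen Ω) (hn : Ω.Nonempty) :
    ∃ u : H10 Ω, (∫ x in Ω, u.toFun x ^ 2) ≠ 0 := by
  obtain ⟨x₀, hx₀⟩ := hn
  obtain ⟨r, hr, hrΩ⟩ := Metric.nhds_basis_closedBall.mem_iff.1 (hΩ.mem_nhds hx₀)
  let f : ContDiffBump x₀ := ⟨r / 2, r, by positivity, by linarith⟩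
  have hf : IsTestFunction Ω f := ⟨f.contDiff, f.hasCompactSupport, by
    rw [f.tsupport_eq]; exact hrΩ⟩
  refine ⟨H10.ofTendsto (hf.memLp 2) (hf.memLp_gradient 2) (fun _ : ℕ => hf) (by simp) (by simp), ?_⟩
  change ∫ x in Ω, f x ^ 2 ≠ 0
  rw [setIntegral_eq_integral_of_forall_compl_eq_zero fun x hx => by simp [hf.eq_zero hx]]
  refine (Continuous.integral_pos_of_hasCompactSupport_nonneg_nonzero (f.continuous.pow 2) ?_
    (fun x => sq_nonneg _) (x := x₀) ?_).ne'
  · simp_rw [sq]; exact f.hasCompactSupport.mul_left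
  · simp [f.one_of_mem_closedBall (Metric.mem_closedBall_self (by positivity))]

end ExtendedEnergy

/-! ### From the minimizer to a classical solution -/

section ClassicalSolution

variable {N : ℕ} {Ω : Set (EuclideanSpace ℝ (Fin N))}

local notation "𝔼" => EuclideanSpace ℝ (Fin N)

/-- Every neighbourhood has positive measure. For continuous functions this turns closed a.e.
constraints into pointwise ones. -/
lemma frequently_nhds_of_ae_restrict (hΩ : IsOpen Ω) {p : 𝔼 → Prop}
    (hp : ∀ᵐ x ∂volume.restrict Ω, p x) {x : 𝔼} (hx : x ∈ Ω) : ∃ᶠ y in 𝓝 x, p y := by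
  intro hn
  rw [ae_restrict_iff' hΩ.measurableSet] at hp
  refine (Measure.measure_pos_of_mem_nhds volume (x := x) ?_).ne' (ae_iff.1 hp)
  filter_upwards [hn, hΩ.mem_nhds hx] with y h1 h2 h3
  exact h1 (h3 h2)

lemma mem_of_ae_restrict_mem (hΩ : IsOpen Ω) {w : 𝔼 → ℝ} (hw : ∀ x ∈ Ω, ContinuousAt w x)
    {s : Set ℝ} (hs : IsClosed s) (h : ∀ᵐ x ∂volume.restrict Ω, w x ∈ s) {x : 𝔼} (hx : x ∈ Ω) :
    w x ∈ s :=
  hs.mem_of_frequently_of_tendsto (frequently_nhds_of_ae_restrict hΩ h hx) (hw x hx)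

/-- Replacing the representative of a function of `H¹₀(Ω)`. -/
def H10.congr (U : H10 Ω) (w : 𝔼 → ℝ) (h : U.toFun =ᵐ[volume.restrict Ω] w) : H10 Ω where
  toFun := w
  grad := U.grad
  memLp_toFun := U.memLp_toFun.ae_eq h
  memLp_grad := U.memLp_grad
  hasWeakGradient φ hφ := by
    rw [← U.hasWeakGradient φ hφ]
    exact integral_congr_ae (h.mono fun x hx => by simp [hx])
  mem_closure ε hε := by
    obtain ⟨φ, hφ, h1, h2⟩ := U.mem_closure ε hε
    refine ⟨φ, hφ, ?_, h2⟩
    rwa [← eLpNorm_congr_ae (h.mono fun x hx => by simp [hx] :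
      (fun x => U.toFun x - φ x) =ᵐ[volume.restrict Ω] fun x => w x - φ x)]

lemma exists_classical_of_euler_lagrange (hΩ : IsOpen Ω) {a K : ℝ} {γ : ℝ → ℝ}
    (hγ : ∀ s t, |γ s - γ t| ≤ K * |s - t|) (U : H10 Ω)
    (hU : ∀ᵐ x ∂volume.restrict Ω, 0 ≤ U.toFun x ∧ U.toFun x ≤ a)
    (hEL : ∀ (φ : 𝔼 → ℝ) (hφ : IsTestFunction Ω φ),
      ⟪U.memLp_grad.toLp U.grad, hφ.gradLp⟫_ℝ = ∫ x in Ω, γ (U.toFun x) * φ x) :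
    ∃ w : 𝔼 → ℝ, U.toFun =ᵐ[volume.restrict Ω] w ∧
      ∀ x ∈ Ω, ContDiffAt ℝ 2 w x ∧ Δ w x = -γ (w x) ∧ 0 ≤ w x ∧ w x ≤ a := by
  have hK : 0 ≤ K := by simpa using (abs_nonneg _).trans (hγ 1 0)
  -- The regularity theorem wants a bound at every point. Clipping gives one, with |a| because no
  -- sign of a is assumed; extension by zero then defines u on the whole space.
  set V : 𝔼 → ℝ := fun x => max 0 (min (U.toFun x) |a|) with hV
  have hUV : ∀ᵐ x ∂volume.restrict Ω, U.toFun x = V x := by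
    filter_upwards [hU] with x hx
    rw [hV]
    simp only
    rw [min_eq_left (hx.2.trans (le_abs_self a)), max_eq_right hx.1]
  have hVm : AEStronglyMeasurable V (volume.restrict Ω) := U.memLp_toFun.1.congr hUV
  set u := Ω.indicator V with hu
  have huΩ : ∀ x ∈ Ω, u x = V x := fun x hx => indicator_of_mem hx _
  have hum : AEStronglyMeasurable u volume :=
    (aestronglyMeasurable_indicator_iff hΩ.measurableSet).2 hVm
  have hV0 : ∀ x, |V x| ≤ |a| := fun x => by
    rw [abs_of_nonneg (le_max_left _ _)]
    exact max_le (abs_nonneg a) (min_le_right _ _)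
  have hub : ∀ x, |u x| ≤ |a| := fun x => by
    by_cases hx : x ∈ Ω
    · rw [huΩ x hx]; exact hV0 x
    · rw [hu, indicator_of_notMem hx]; simp
  have hul : LocallyIntegrable u volume :=
    (memLp_top_of_bound hum |a| (Eventually.of_forall hub)).locallyIntegrable le_top
  have hUu : ∀ᵐ x ∂volume.restrict Ω, U.toFun x = u x := by
    filter_upwards [hUV, ae_restrict_mem hΩ.measurableSet] with x h1 h2
    rw [h1, huΩ x h2]
  obtain ⟨w, huw, hw⟩ := exists_classical_rep hΩ hul hub hK hγ (fun ψ h1 h2 h3 => by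
    have hψ : IsTestFunction Ω ψ := ⟨h1, h2, h3⟩
    have hΔ : ∀ x ∉ Ω, Δ ψ x = 0 := fun x hx => by
      have hx' : ψ =ᶠ[𝓝 x] fun _ => 0 :=
        notMem_tsupport_iff_eventuallyEq.1 fun h => hx (h3 h)
      rw [laplacian_congr_nhds hx' |>.self_of_nhds, laplacian_const, Pi.zero_apply]
    have e1 : ∫ x in Ω, u x * Δ ψ x = ∫ x, u x * Δ ψ x :=
      setIntegral_eq_integral_of_forall_compl_eq_zero fun x hx => by rw [hΔ x hx, mul_zero]
    have e2 : ∫ x in Ω, γ (u x) * ψ x = ∫ x, γ (u x) * ψ x :=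
      setIntegral_eq_integral_of_forall_compl_eq_zero fun x hx => by rw [hψ.eq_zero hx, mul_zero]
    rw [← e1, ← e2]
    have := U.integral_mul_laplacian hEL hψ
    rw [integral_congr_ae (hUu.mono fun x hx => by simp only [hx] :
        (fun x => U.toFun x * Δ ψ x) =ᵐ[volume.restrict Ω] fun x => u x * Δ ψ x),
      integral_congr_ae (hUu.mono fun x hx => by simp only [hx] :
        (fun x => γ (U.toFun x) * ψ x) =ᵐ[volume.restrict Ω] fun x => γ (u x) * ψ x)] at this
    exact this)
  have hUw : U.toFun =ᵐ[volume.restrict Ω] w := by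
    filter_upwards [hUu, ae_restrict_of_ae huw] with x h1 h2
    rw [h1, h2]
  refine ⟨w, hUw, fun x hx => ⟨(hw x hx).1, (hw x hx).2, ?_⟩⟩
  refine mem_of_ae_restrict_mem hΩ (fun y hy => (hw y hy).1.continuousAt) isClosed_Icc
    (s := Icc 0 a) ?_ hx
  filter_upwards [hU, hUw] with y h1 h2
  rw [← h2]
  exact h1

end ClassicalSolution

end Auxiliary

/-! ### Assembly of the proof -/

open Filter Topology Laplacian InnerProductSpace in
theorem proposition4p1 {N : ℕ} (hN : 1 ≤ N) (Ω : Set (EuclideanSpace ℝ (Fin N)))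
    (hΩ_open : IsOpen Ω) (hΩ_conn : IsConnected Ω) (hΩ_bdd : Bornology.IsBounded Ω)
    (g : ℝ → ℝ) (α₀ : ℝ)
    (hg_reg : ∃ σ ∈ Set.Ioo (0 : ℝ) 1, IsC1Holder σ g)
    (hg_odd : ∀ z, g (-z) = -g z)
    (hg_der : 0 < deriv g 0)
    (hα₀ : 0 < α₀)
    (hg_pos : ∀ z, 0 < z → z < α₀ → 0 < g z)
    (hg_neg : ∀ z, α₀ < z → g z < 0)
    (hlam : firstDirichletEigenvalue Ω < deriv g 0) :
    ∃ u : H10 Ω,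
      (∀ v : H10 Ω, energy Ω g u ≤ energy Ω g v) ∧
      IsClassicalSolution Ω g u.toFun ∧
      ∀ x ∈ Ω, 0 < u.toFun x ∧ u.toFun x < α₀ := by
  obtain ⟨σ, -, hg, -⟩ := hg_reg
  have hvol : volume Ω ≠ ⊤ := hΩ_bdd.measure_lt_top.ne
  obtain ⟨B, C, K, P⟩ := exists_truncatedPotential hg hα₀ hg_odd hg_pos hg_neg
  have hΓ0 := primitive_clamped_nonneg hg.continuous hα₀ hg_odd hg_pos hg_neg
  have hΓle := primitive_le_primitive_clamped hg.continuous hα₀ hg_odd hg_pos hg_neg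
  set γ := clampedNonlinearity α₀ g with hγ
  set Γ := primitive γ with hΓ
  have hΓc : Continuous Γ := continuous_of_abs_sub_le P.lip
  have hK : 0 ≤ K := by simpa using (abs_nonneg _).trans (P.lip_deriv 1 0)
  have hγα : γ α₀ = 0 := by
    rw [hγ, clampedNonlinearity_of_ge hα₀.le le_rfl,
      map_eq_zero_of_sign_change hg.continuous hα₀ hg_pos hg_neg]
  obtain ⟨U, w, hw, hwb, hwU, hgrad, hU, hmin⟩ :=
    exists_truncated_minimizer hΩ_bdd hΩ_open.measurableSet hα₀ P
  have hEL : ∀ (φ) (hφ : IsTestFunction Ω φ),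
      ⟪U.memLp_grad.toLp U.grad, hφ.gradLp⟫_ℝ = ∫ x in Ω, γ (U.toFun x) * φ x :=
    fun φ hφ => euler_lagrange_of_minimizer hvol P hw hwU hgrad hmin hφ
  obtain ⟨W, hUW, hW⟩ := exists_classical_of_euler_lagrange hΩ_open P.lip_deriv U hU hEL
  have hneg : truncEnergy Ω Γ U.toFun U.grad < 0 := by
    obtain ⟨u₀, hu₀⟩ := exists_H10_integral_sq_ne_zero hΩ_open hΩ_conn.nonempty
    rw [firstDirichletEigenvalue] at hlam
    obtain ⟨r, ⟨v, hv0, rfl⟩, hr⟩ := exists_lt_of_csInf_lt (by exact ⟨_, u₀, hu₀, rfl⟩) hlam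
    obtain ⟨c, hc1, hc2⟩ := exists_between hr
    obtain ⟨δ, hδ, hc⟩ := exists_quadratic_le_primitive_clamped hg hα₀ hg_odd hc2
    have hvpos : 0 < ∫ x in Ω, v.toFun x ^ 2 :=
      lt_of_le_of_ne (integral_nonneg fun _ => sq_nonneg _) hv0.symm
    obtain ⟨φ, hφ, hφneg⟩ := exists_truncEnergy_neg P.lip P.bdd hvol hδ hc v
      ((div_lt_iff₀ hvpos).1 hc1)
    exact (hmin φ hφ).trans_lt hφneg
  have hne : ¬ ∀ᵐ x ∂volume.restrict Ω, U.toFun x = 0 := fun h0 => by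
    have h1 : ∫ x in Ω, Γ (U.toFun x) = 0 :=
      integral_eq_zero_of_ae (h0.mono fun x hx => by simp only [hx, P.zero, Pi.zero_apply])
    rw [truncEnergy, h1, sub_zero] at hneg
    exact absurd hneg (not_lt.2 (by positivity))
  have hWγ : ∀ x ∈ Ω, γ (W x) = g (W x) := fun x hx =>
    clampedNonlinearity_of_mem (by linarith [(hW x hx).2.2.1]) (hW x hx).2.2.2
  have hWpos : ∀ x ∈ Ω, 0 < W x := by
    intro x hx
    refine lt_of_le_of_ne (hW x hx).2.2.1 fun h0 => hne ?_
    -- W is superharmonic because γ ≥ 0 on [0, ∞), so the minimum principle applies with L = 0.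
    have := eqOn_zero_of_laplacian_le hΩ_open hΩ_conn.isPreconnected le_rfl
      (fun y hy => (hW y hy).1) (fun y hy => (hW y hy).2.2.1) (fun y hy => by
        rw [(hW y hy).2.1, zero_mul, neg_nonpos]
        exact clampedNonlinearity_nonneg hg.continuous hα₀ hg_odd hg_pos hg_neg
          (hW y hy).2.2.1) hx h0.symm
    filter_upwards [hUW, ae_restrict_mem hΩ_open.measurableSet] with y h1 h2
    rw [h1, this y h2]
  have hWlt : ∀ x ∈ Ω, W x < α₀ := by
    intro x hx
    refine lt_of_le_of_ne (hW x hx).2.2.2 fun h0 => hne ?_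
    have hlap : ∀ y ∈ Ω, Δ (fun z => α₀ - W z) y = γ (W y) := fun y hy => by
      have := (contDiffAt_const (c := α₀) (x := y)).laplacian_sub (hW y hy).1
      rw [laplacian_const, Pi.zero_apply, zero_sub, (hW y hy).2.1, neg_neg] at this
      exact this
    -- Since γ(α₀) = 0, the Lipschitz bound gives Δ(α₀ - W) = γ(W) ≤ K(α₀ - W).
    have hconst := eqOn_zero_of_laplacian_le hΩ_open hΩ_conn.isPreconnected hK
      (v := fun z => α₀ - W z) (fun y hy => contDiffAt_const.sub (hW y hy).1)
      (fun y hy => sub_nonneg.2 (hW y hy).2.2.2) (fun y hy => by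
        rw [hlap y hy]
        have h1 := P.lip_deriv (W y) α₀
        rw [hγα, sub_zero, abs_sub_comm, abs_of_nonneg (sub_nonneg.2 (hW y hy).2.2.2)] at h1
        exact (le_abs_self _).trans h1) hx (by simp [h0])
    have hUα : ∀ᵐ y ∂volume.restrict Ω, U.toFun y = α₀ := by
      filter_upwards [hUW, ae_restrict_mem hΩ_open.measurableSet] with y h1 h2
      rw [h1]
      exact (sub_eq_zero.1 (hconst y h2)).symm
    -- With U = α₀ the right side of the weak equation vanishes. Testing with the approximants `w k`
    -- and passing to the limit gives ‖∇U‖² = 0.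
    have hzero : ∀ k, ⟪U.memLp_grad.toLp U.grad, (hw k).gradLp⟫_ℝ = 0 := fun k => by
      rw [hEL]
      exact integral_eq_zero_of_ae (hUα.mono fun y hy => by
        simp only [hy, hγα, zero_mul, Pi.zero_apply])
    have hlim := (tendsto_const_nhds (x := U.memLp_grad.toLp U.grad)).inner (𝕜 := ℝ) hgrad
    simp only [hzero] at hlim
    have hG : U.memLp_grad.toLp U.grad = 0 :=
      inner_self_eq_zero.1 (tendsto_nhds_unique hlim tendsto_const_nhds)
    rw [hG] at hgrad
    exact integral_abs_eq_zero_of_gradLp_tendsto_zero hN hΩ_bdd hΩ_open.measurableSet hw hwb hwU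
      hgrad
  refine ⟨U.congr W hUW, fun v => ?_, ⟨fun x hx => (hW x hx).1.contDiffWithinAt, fun x hx => ?_⟩,
    fun x hx => ⟨hWpos x hx, hWlt x hx⟩⟩
  · have h1 : energy Ω g (U.congr W hUW)
        = ((truncEnergy Ω Γ (U.congr W hUW).toFun (U.congr W hUW).grad : ℝ) : EReal) := by
      refine energy_eq_truncEnergy hvol hΓc P.bdd hΓ0 ?_
      filter_upwards [ae_restrict_mem hΩ_open.measurableSet] with x hx
      exact primitive_eq_primitive_clamped (hW x hx).2.2.1 (hW x hx).2.2.2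
    have h2 : truncEnergy Ω Γ (U.congr W hUW).toFun (U.congr W hUW).grad
        = truncEnergy Ω Γ U.toFun U.grad := by
      have : ∫ x in Ω, Γ (W x) = ∫ x in Ω, Γ (U.toFun x) :=
        integral_congr_ae (hUW.mono fun x hx => by simp only [hx])
      simp only [truncEnergy, H10.congr, this]
    rw [h1, h2]
    exact (EReal.coe_le_coe_iff.2 (H10.truncEnergy_le_of_forall_test hvol P.lip P.bdd hmin v)).trans
      (truncEnergy_le_energy hvol hΓc P.bdd hΓ0 hΓle v)
  · change -Δ W x = g (W x)
    rw [(hW x hx).2.1, neg_neg, hWγ x hx]
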